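/- Let $\Bbbk$ be an algebraically closed field and let $A$ be a basic, connected, non-simple finite dimensional $\Bbbk$-algebra (associative, unital). Put $B=A^{\mathrm{op}}$ and $E=A\otimes_{\Bbbk}B$, and let $\mathcal{C}$ be the category of finite dimensional $E$-modules. An endofunctor of $\mathcal{C}$ is called good if it belongs to the additive closure (direct summands of finite direct sums) of: the identity functor; the functors $Q\otimes_E-$ for projective $E$-$E$-bimodules $Q$; the functor of tensoring with the left component projective $E$-$E$-bimodule $(A\otimes_{\Bbbk}A)\otimes_{\Bbbk}B$; and the functor of tensoring with the right component projective $E$-$E$-bimodule $A\otimes_{\Bbbk}(B\otimes_{\Bbbk}B)$. Let $\mathcal{D}_A$ ($=\mathcal{C}_A\boxtimes\mathcal{C}_{A^{\mathrm{op}}}$) be the $2$-category with one object (identified with $\mathcal{C}$), whose $1$-morphisms are the good endofunctors of $\mathcal{C}$, with their composition, and whose $2$-morphisms are all natural transformations. For indecomposable $1$-morphisms write $F\le_L G$ if $G$ is isomorphic to a direct summand of $H\circ F$ for some $1$-morphism $H$, and $F\le_J G$ if $G$ is isomorphic to a direct summand of $H_1\circ F\circ H_2$ for some $H_1,H_2$;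 the equivalence classes of these preorders (on isomorphism classes of indecomposable $1$-morphisms) are the left cells and the two-sided cells. Let $\mathcal{J}_1,\mathcal{J}_2,\mathcal{J}_3,\mathcal{J}_4$ be the two-sided cells containing, respectively, the identity, the indecomposable functors given by left component projective bimodules, those given by right component projective bimodules, and those given by projective bimodules. Let $\mathcal{L}_1$ be the left cell of the identity and fix any left cell $\mathcal{L}\subseteq\mathcal{J}_4$. For a left cell $\mathcal{L}'$, the cell $2$-representation $\mathbf{C}_{\mathcal{L}'}$ is the quotient of the additive closure of $\{H\circ F: F\in\mathcal{L}', H\text{ a }1\text{-morphism}\}$, with $\mathcal{D}_A$ acting by composition, by the maximal $\mathcal{D}_A$-invariant ideal which does not contain $\mathrm{id}_F$ for any $F\in\mathcal{L}'$. Let $M\in\mathcal{C}$ be an indecomposable $E$-module which is projective as an $A$-module and projective as a $B$-module, and whose stable endomorphism algebra (endomorphisms modulo those factoring through projective $E$-modules) is isomorphic to $\Bbbk$. Let $\mathcal{C}_{\mathrm{proj}}$ be the full subcategory of projective $E$-modules and $\mathcal{C}_M$ the additive closure of $\mathcal{C}_{\mathrm{proj}}$ together with $M$. Then: (i) The action of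 $\mathcal{D}_A$ restricts to $\mathcal{C}_{\mathrm{proj}}$, and the resulting finitary $2$-representation $\mathbf{K}$ is equivalent to $\mathbf{C}_{\mathcal{L}}$. (ii) The action of $\mathcal{D}_A$ restricts to $\mathcal{C}_M$; denote the resulting finitary $2$-representation by $\mathbf{M}_M$. (iii) Let $\mathbf{N}_M$ be the quotient of $\mathbf{M}_M$ by the ideal generated by the identity morphisms of the objects of $\mathcal{C}_{\mathrm{proj}}$. Then the inclusion and the projection form a short exact sequence of $2$-representations $$0\to\mathbf{K}\to\mathbf{M}_M\to\mathbf{N}_M\to 0,$$ that is, $\mathbf{K}$ is a transitive sub-$2$-representation (any two of its indecomposable objects are obtained from each other, as direct summands, by the action of $1$-morphisms), $\mathbf{N}_M$ is the quotient by the ideal it generates, and the diagram of $\mathbf{M}_M$ has exactly two vertices. The finitary $2$-representation $\mathbf{N}_M$ is equivalent to $\mathbf{C}_{\mathcal{L}_1}$. (iv) The diagram of $\mathbf{M}_M$ (the Hasse diagram of the poset of equivalence classes of indecomposable objects with respect to the preorder: $X\to Y$ if $Y$ is isomorphic to a direct summand of $F\,X$ for some $1$-morphism $F$) has exactly two vertices,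 an upper vertex $\rho$, whose only element is $M$ and which corresponds to the subquotient $\mathbf{C}_{\mathcal{L}_1}$, and a lower vertex $\tau$, which consists of the indecomposable projective $E$-modules and corresponds to $\mathbf{C}_{\mathcal{L}}$; they are joined by one edge. The decoration $X$ of this edge, that is, the set of all indecomposable $1$-morphisms $F$ such that some element of $\tau$ is a direct summand of $F\,M$, is a union of left cells, and it contains at least one left cell from each of $\mathcal{J}_2$, $\mathcal{J}_3$ and $\mathcal{J}_4$. -/

import Mathlib

open CategoryTheory CategoryTheory.Limits MonoidalCategory MonoidalLeftAction
open scoped TensorProduct ModuleCat MonoidalLeftAction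

universe w v u v₁ u₁ v₂ u₂

noncomputable section

namespace FinRep

/-! ### Additive and `k`-linear categories -/

section Additive

variable {C : Type*} [Category* C] [Preadditive C]

/-- `Y` is a direct summand of `X`: there are `i : Y ⟶ X` and `r : X ⟶ Y` with `i ≫ r = 𝟙 Y`.
(In an idempotent split additive category this means `X ≅ Y ⊕ Z` for some `Z`.) -/
def IsSummand (Y X : C) : Prop := Nonempty (Retract Y X)

/-- The additive closure `add(S)`: the objects which are direct summands of a finite direct sum
`Y₁ ⊕ ⋯ ⊕ Yₙ` of objects of `S`. The two maps `X ⟶ ⨁ Yᵢ` and `⨁ Yᵢ ⟶ X` are given by their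
components `aᵢ` and `bᵢ`, and their composite is `∑ aᵢ ≫ bᵢ`. -/
def AddClosure (S : ObjectProperty C) : ObjectProperty C := fun X =>
  ∃ (n : ℕ) (Y : Fin n → C) (a : ∀ i, X ⟶ Y i) (b : ∀ i, Y i ⟶ X),
    (∀ i, S (Y i)) ∧ ∑ i, a i ≫ b i = 𝟙 X

/-- An object is indecomposable if it is non-zero and is not the direct sum of two non-zero
objects. -/
def IsIndecomposable (X : C) : Prop :=
  ¬ IsZero X ∧ ∀ (Y Z : C) (b : BinaryBicone Y Z), Nonempty b.IsBilimit →
    Nonempty (X ≅ b.pt) → IsZero Y ∨ IsZero Z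

end Additive

/-- Finitary `k`-linear categories: additive, idempotent split, Krull-Schmidt, with finitely many
indecomposable objects up to isomorphism and finite dimensional morphism spaces. -/
structure IsFinitaryCategory (k : Type*) [Field k] (C : Type*) [Category* C] [Preadditive C]
    [Linear k C] : Prop where
  additive : HasFiniteBiproducts C
  idempotent_split : IsIdempotentComplete C
  krull_schmidt : ∀ X : C, ∃ (n : ℕ) (Y : Fin n → C) (b : Bicone Y),
    Nonempty b.IsBilimit ∧ Nonempty (X ≅ b.pt) ∧ ∀ i, IsLocalRing (End (Y i))
  finitely_many : ∃ (n : ℕ) (Y : Fin n → C), ∀ X : C, IsIndecomposable X → ∃ i, Nonempty (X ≅ Y i)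
  finite_dimensional : ∀ X Y : C, FiniteDimensional k (X ⟶ Y)

/-- Two-sided ideals of a `k`-linear category. -/
structure HomIdeal (k : Type*) [Field k] (C : Type*) [Category* C] [Preadditive C]
    [Linear k C] where
  /-- the morphisms `X ⟶ Y` in the ideal -/
  hom : ∀ X Y : C, Submodule k (X ⟶ Y)
  comp_left : ∀ {X Y Z : C} (f : X ⟶ Y) {g : Y ⟶ Z}, g ∈ hom Y Z → f ≫ g ∈ hom X Z
  comp_right : ∀ {X Y Z : C} {f : X ⟶ Y} (g : Y ⟶ Z), f ∈ hom X Y → f ≫ g ∈ hom X Z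

namespace HomIdeal

variable {k : Type*} [Field k] {C : Type*} [Category* C] [Preadditive C] [Linear k C]

/-- Congruence modulo an ideal. -/
def rel (I : HomIdeal k C) : HomRel C := fun X Y f g => f - g ∈ I.hom X Y

instance (I : HomIdeal k C) : Congruence I.rel where
  equivalence := fun {X Y} =>
    { refl := fun f => by simp [rel]
      symm := fun {f g} h => by
        have := (I.hom X Y).neg_mem h
        simpa [rel] using this
      trans := fun {f g h} h₁ h₂ => by
        have := (I.hom X Y).add_mem h₁ h₂
        simpa [rel] using this }
  comp_left f _ _ h := by
    have := HomIdeal.comp_left I f h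
    simpa [rel, Preadditive.comp_sub] using this
  comp_right g h := by
    have := HomIdeal.comp_right I g h
    simpa [rel, Preadditive.sub_comp] using this

/-- The quotient of a `k`-linear category by an ideal: same objects, and the morphism spaces are
the quotient spaces. -/
abbrev Quot (I : HomIdeal k C) := Quotient I.rel

/-- The projection onto the quotient by an ideal. -/
abbrev proj (I : HomIdeal k C) : C ⥤ I.Quot := Quotient.functor I.rel

instance (I : HomIdeal k C) : Preadditive I.Quot :=
  Quotient.preadditive I.rel (fun X Y f₁ f₂ g₁ g₂ h₁ h₂ => by
    have := (I.hom X Y).add_mem h₁ h₂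
    simpa [rel, add_sub_add_comm] using this)

instance (I : HomIdeal k C) : I.proj.Additive := Quotient.functor_additive I.rel _

instance (I : HomIdeal k C) : Linear k I.Quot :=
  Quotient.linear k I.rel (fun c X Y f g h => by
    have := (I.hom X Y).smul_mem c h
    simpa [rel, smul_sub] using this)

instance (I : HomIdeal k C) : I.proj.Linear k := Quotient.linear_functor k I.rel _

/-- The ideal generated by the identity morphisms of the objects in `P`; it consists of the
linear combinations of morphisms which factor through an object in `P`. -/
def generatedBy (P : ObjectProperty C) : HomIdeal k C where
  hom X Y := Submodule.span k {f | ∃ Z, P Z ∧ ∃ (a : X ⟶ Z) (b : Z ⟶ Y), f = a ≫ b}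
  comp_left {X Y Z} f {g} hg := by
    induction hg using Submodule.span_induction with
    | mem g hg =>
      obtain ⟨W, hW, a, b, rfl⟩ := hg
      exact Submodule.subset_span ⟨W, hW, f ≫ a, b, by simp⟩
    | zero => simp
    | add g g' _ _ h h' => rw [Preadditive.comp_add]; exact Submodule.add_mem _ h h'
    | smul c g _ h => rw [Linear.comp_smul]; exact Submodule.smul_mem _ c h
  comp_right {X Y Z} {f} g hf := by
    induction hf using Submodule.span_induction with
    | mem f hf =>
      obtain ⟨W, hW, a, b, rfl⟩ := hf
      exact Submodule.subset_span ⟨W, hW, a, b ≫ g, by simp⟩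
    | zero => simp
    | add f f' _ _ h h' => rw [Preadditive.add_comp]; exact Submodule.add_mem _ h h'
    | smul c f _ h => rw [Linear.smul_comp]; exact Submodule.smul_mem _ c h

end HomIdeal

/-! ### `2`-representations of a `k`-linear `2`-category with one object

A `2`-category with one object is a monoidal category `D`: the objects of `D` are the
`1`-morphisms, the tensor product `F ⊗ G` is the composition `F ∘ G`, and the morphisms of `D` are
the `2`-morphisms. A `2`-representation is a `k`-linear category on which `D` acts from the left. -/

/-- A `k`-linear `2`-representation of the one-object `2`-category `D`. -/
structure TwoRep (k : Type w) [Field k] (D : Type u) [Category.{v} D] [Preadditive D] [Linear k D]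
    [MonoidalCategory D] where
  /-- the category assigned to the unique object of the `2`-category -/
  carrier : Type u₁
  [category : Category.{v₁} carrier]
  [preadditive : Preadditive carrier]
  [linear : Linear k carrier]
  [action : MonoidalLeftAction D carrier]
  /-- `1`-morphisms act by additive `k`-linear functors -/
  action_add : ∀ (F : D) {X Y : carrier} (f g : X ⟶ Y), F ⊴ₗ (f + g) = F ⊴ₗ f + F ⊴ₗ g
  action_smul : ∀ (F : D) {X Y : carrier} (c : k) (f : X ⟶ Y), F ⊴ₗ (c • f) = c • (F ⊴ₗ f)
  /-- the action is `k`-linear on `2`-morphisms -/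
  add_action : ∀ {F G : D} (α β : F ⟶ G) (X : carrier), (α + β) ⊵ₗ X = α ⊵ₗ X + β ⊵ₗ X
  smul_action : ∀ {F G : D} (c : k) (α : F ⟶ G) (X : carrier), (c • α) ⊵ₗ X = c • (α ⊵ₗ X)

namespace TwoRep

attribute [instance] category preadditive linear action

variable {k : Type w} [Field k] {D : Type u} [Category.{v} D] [Preadditive D] [Linear k D]
  [MonoidalCategory D]

/-- The `2`-representation is finitary. -/
def IsFinitary (M : TwoRep.{w, v, u, v₁, u₁} k D) : Prop := IsFinitaryCategory k M.carrier

/-- Morphisms of `2`-representations (`2`-natural transformations): `k`-linear functors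
commuting with the action of `D` up to coherent natural isomorphisms. -/
structure Hom (M : TwoRep.{w, v, u, v₁, u₁} k D) (N : TwoRep.{w, v, u, v₂, u₂} k D) where
  /-- the underlying functor -/
  functor : M.carrier ⥤ N.carrier
  [additive : functor.Additive]
  [linear : functor.Linear k]
  [leftLinear : functor.LeftLinear D]

/-- Two `2`-representations are equivalent if there is a morphism between them whose underlying
functor is an equivalence of categories. -/
def Equivalent (M : TwoRep.{w, v, u, v₁, u₁} k D) (N : TwoRep.{w, v, u, v₂, u₂} k D) : Prop :=
  ∃ Φ : Hom M N, Φ.functor.IsEquivalence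

/-! #### Sub-`2`-representations -/

/-- The full subcategory on `P` is invariant under the action of `D`. -/
def IsInvariant (M : TwoRep.{w, v, u, v₁, u₁} k D) (P : ObjectProperty M.carrier) : Prop :=
  ∀ (F : D) (X : M.carrier), P X → P (F ⊙ₗ X)

/-- The restriction of the action of `D` to an invariant full subcategory. -/
abbrev subAction (M : TwoRep.{w, v, u, v₁, u₁} k D) (P : ObjectProperty M.carrier)
    (hP : M.IsInvariant P) : MonoidalLeftAction D P.FullSubcategory where
  actionObj F X := ⟨F ⊙ₗ X.obj, hP F X.obj X.property⟩
  actionHomLeft α X := ObjectProperty.homMk (α ⊵ₗ X.obj)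
  actionHomRight F _ _ f := ObjectProperty.homMk (F ⊴ₗ f.hom)
  actionAssocIso F G X := P.isoMk (αₗ F G X.obj)
  actionUnitIso X := P.isoMk (λₗ X.obj)
  actionHom_comp _ _ _ _ := by ext; simp [action_exchange_assoc]
  actionAssocIso_hom_naturality f g h := by
    have := actionAssocIso_hom_naturality f g h.hom
    simp only [actionHom_def] at this
    exact ObjectProperty.hom_ext _ this
  actionUnitIso_hom_naturality f := by
    ext; simp

/-- The sub-`2`-representation on an invariant full subcategory. -/
def sub (M : TwoRep.{w, v, u, v₁, u₁} k D) (P : ObjectProperty M.carrier)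
    (hP : M.IsInvariant P) : TwoRep.{w, v, u, v₁, u₁} k D :=
  letI := M.subAction P hP
  { carrier := P.FullSubcategory
    action_add := fun F _ _ f g => ObjectProperty.hom_ext _ (M.action_add F f.hom g.hom)
    action_smul := fun F _ _ c f => ObjectProperty.hom_ext _ (M.action_smul F c f.hom)
    add_action := fun α β X => ObjectProperty.hom_ext _ (M.add_action α β X.obj)
    smul_action := fun c α X => ObjectProperty.hom_ext _ (M.smul_action c α X.obj) }

/-- For invariant full subcategories `P ⊆ Q`, the natural inclusion of the corresponding
sub-`2`-representations. -/
def subInclusion (M : TwoRep.{w, v, u, v₁, u₁} k D) {P Q : ObjectProperty M.carrier}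
    (hP : M.IsInvariant P) (hQ : M.IsInvariant Q) (h : P ≤ Q) : Hom (M.sub P hP) (M.sub Q hQ) :=
  letI := M.subAction P hP
  letI := M.subAction Q hQ
  { functor := ObjectProperty.ιOfLE h
    additive := { map_add := rfl }
    linear := { map_smul := fun _ _ => rfl }
    leftLinear :=
      { μₗ := fun F X => 𝟙 _
        δₗ := fun F X => 𝟙 _
        μₗ_naturality_left := fun _ _ => (Category.comp_id _).trans (Category.id_comp _).symm
        μₗ_naturality_right := fun _ _ _ _ => (Category.comp_id _).trans (Category.id_comp _).symm
        μₗ_associativity := fun F G X => by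
          apply ObjectProperty.hom_ext
          exact (Category.id_comp (αₗ F G X.obj).hom).trans (by
            change _ = (αₗ F G X.obj).hom ≫ F ⊴ₗ 𝟙 (G ⊙ₗ X.obj) ≫ 𝟙 _
            simp)
        μₗ_unitality := fun _ => (Category.id_comp _).symm
        δₗ_naturality_left := fun _ _ => (Category.comp_id _).trans (Category.id_comp _).symm
        δₗ_naturality_right := fun _ _ _ _ => (Category.comp_id _).trans (Category.id_comp _).symm
        δₗ_associativity := fun F G X => by
          apply ObjectProperty.hom_ext
          exact (Category.id_comp (αₗ F G X.obj).hom).trans (by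
            change _ = (αₗ F G X.obj).hom ≫ 𝟙 _ ≫ F ⊴ₗ 𝟙 (G ⊙ₗ X.obj)
            simp)
        δₗ_unitality_inv := fun _ => (Category.comp_id _).symm
        μₗ_comp_δₗ := fun _ _ => Category.id_comp _
        δₗ_comp_μₗ := fun _ _ => Category.id_comp _ } }

/-! #### Quotients -/

/-- The ideals of (the category underlying) a `2`-representation which are invariant under the
action of `D`. -/
structure InvIdeal (M : TwoRep.{w, v, u, v₁, u₁} k D) extends HomIdeal k M.carrier where
  invariant : ∀ (F : D) {X Y : M.carrier} {f : X ⟶ Y}, f ∈ hom X Y → F ⊴ₗ f ∈ hom (F ⊙ₗ X) (F ⊙ₗ Y)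

/-- The action of `F` on the quotient by an invariant ideal. -/
def quotFunctor (M : TwoRep.{w, v, u, v₁, u₁} k D) (I : M.InvIdeal) (F : D) :
    I.toHomIdeal.Quot ⥤ I.toHomIdeal.Quot :=
  CategoryTheory.Quotient.lift I.rel (actionLeft M.carrier F ⋙ I.proj) (fun X Y f g h => by
    apply CategoryTheory.Quotient.sound
    have := I.invariant F h
    have e : F ⊴ₗ f = F ⊴ₗ (f - g) + F ⊴ₗ g := by rw [← M.action_add, sub_add_cancel]
    change F ⊴ₗ f - F ⊴ₗ g ∈ I.hom _ _
    rwa [e, add_sub_cancel_right])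

/-- The action of `D` on the quotient by an invariant ideal. -/
abbrev quotAction (M : TwoRep.{w, v, u, v₁, u₁} k D) (I : M.InvIdeal) :
    MonoidalLeftAction D I.toHomIdeal.Quot where
  actionObj F X := ⟨F ⊙ₗ X.as⟩
  actionHomLeft α X := I.proj.map (α ⊵ₗ X.as)
  actionHomRight F _ _ f := (M.quotFunctor I F).map f
  actionAssocIso F G X := I.proj.mapIso (αₗ F G X.as)
  actionUnitIso X := I.proj.mapIso (λₗ X.as)
  actionHomRight_id F X := (M.quotFunctor I F).map_id X
  id_actionHomLeft F X := by rw [id_actionHomLeft]; rfl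
  actionHom_comp {F G H X Y Z} α β f g := by
    obtain ⟨f, rfl⟩ := I.proj.map_surjective f
    obtain ⟨g, rfl⟩ := I.proj.map_surjective g
    have := actionHom_comp α β f g
    simp only [actionHom_def] at this
    exact (congrArg I.proj.map this :)
  actionAssocIso_hom_naturality f g h := by
    obtain ⟨h, rfl⟩ := I.proj.map_surjective h
    have := actionAssocIso_hom_naturality f g h
    simp only [actionHom_def] at this
    exact (congrArg I.proj.map this :)
  actionUnitIso_hom_naturality f := by
    obtain ⟨f, rfl⟩ := I.proj.map_surjective f
    exact (congrArg I.proj.map (actionUnitIso_hom_naturality (C := D) f) :)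
  whiskerLeft_actionHomLeft F _ _ α X :=
    (congrArg I.proj.map (whiskerLeft_actionHomLeft F α X.as) :)
  whiskerRight_actionHomLeft F α X :=
    (congrArg I.proj.map (whiskerRight_actionHomLeft F α X.as) :)
  associator_actionHom F G H X := (congrArg I.proj.map (associator_actionHom F G H X.as) :)
  leftUnitor_actionHom F X := (congrArg I.proj.map (leftUnitor_actionHom F X.as) :)
  rightUnitor_actionHom F X := (congrArg I.proj.map (rightUnitor_actionHom F X.as) :)

/-- The quotient of a `2`-representation by an invariant ideal. -/
def quot (M : TwoRep.{w, v, u, v₁, u₁} k D) (I : M.InvIdeal) : TwoRep.{w, v, u, v₁, u₁} k D :=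
  letI := M.quotAction I
  { carrier := I.toHomIdeal.Quot
    action_add := fun F X Y f g => by
      obtain ⟨f, rfl⟩ := I.proj.map_surjective f
      obtain ⟨g, rfl⟩ := I.proj.map_surjective g
      exact (congrArg I.proj.map (M.action_add F f g) :)
    action_smul := fun F X Y c f => by
      obtain ⟨f, rfl⟩ := I.proj.map_surjective f
      exact (congrArg I.proj.map (M.action_smul F c f) :)
    add_action := fun α β X => (congrArg I.proj.map (M.add_action α β X.as) :)
    smul_action := fun c α X => (congrArg I.proj.map (M.smul_action c α X.as) :) }

/-- The natural projection onto a quotient. -/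
def quotProj (M : TwoRep.{w, v, u, v₁, u₁} k D) (I : M.InvIdeal) : Hom M (M.quot I) :=
  letI := M.quotAction I
  { functor := I.proj
    additive := inferInstanceAs I.proj.Additive
    linear := inferInstanceAs (I.proj.Linear k)
    leftLinear :=
      { μₗ := fun F X => 𝟙 (I.proj.obj (F ⊙ₗ X))
        δₗ := fun F X => 𝟙 (I.proj.obj (F ⊙ₗ X))
        μₗ_naturality_left := fun _ _ => (Category.comp_id _).trans (Category.id_comp _).symm
        μₗ_naturality_right := fun _ _ _ _ => (Category.comp_id _).trans (Category.id_comp _).symm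
        μₗ_associativity := fun F G X => by
          have : (αₗ F G X).hom = (αₗ F G X).hom ≫ F ⊴ₗ 𝟙 (G ⊙ₗ X) ≫ 𝟙 (F ⊙ₗ G ⊙ₗ X : M.carrier) := by simp
          exact (Category.id_comp _).trans (congrArg I.proj.map this :)
        μₗ_unitality := fun _ => (Category.id_comp _).symm
        δₗ_naturality_left := fun _ _ => (Category.comp_id _).trans (Category.id_comp _).symm
        δₗ_naturality_right := fun _ _ _ _ => (Category.comp_id _).trans (Category.id_comp _).symm
        δₗ_associativity := fun F G X => by
          have : (αₗ F G X).hom = (αₗ F G X).hom ≫ 𝟙 (F ⊙ₗ G ⊙ₗ X : M.carrier) ≫ F ⊴ₗ 𝟙 (G ⊙ₗ X) := by simp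
          exact (Category.id_comp _).trans (congrArg I.proj.map this :)
        δₗ_unitality_inv := fun _ => (Category.comp_id _).symm
        μₗ_comp_δₗ := fun _ _ => Category.id_comp _
        δₗ_comp_μₗ := fun _ _ => Category.id_comp _ } }

/-- The ideal generated by the identity morphisms of the objects of an invariant full
subcategory. -/
def idealOf (M : TwoRep.{w, v, u, v₁, u₁} k D) (P : ObjectProperty M.carrier)
    (hP : M.IsInvariant P) : M.InvIdeal where
  toHomIdeal := HomIdeal.generatedBy P
  invariant F X Y f hf := by
    induction hf using Submodule.span_induction with
    | mem f hf =>
      obtain ⟨Z, hZ, a, b, rfl⟩ := hf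
      exact Submodule.subset_span ⟨F ⊙ₗ Z, hP F Z hZ, F ⊴ₗ a, F ⊴ₗ b, by simp⟩
    | zero =>
      have := M.action_smul F (0 : k) (0 : X ⟶ Y)
      rw [zero_smul, zero_smul] at this
      rw [this]
      exact Submodule.zero_mem _
    | add f g _ _ hf hg => rw [M.action_add]; exact Submodule.add_mem _ hf hg
    | smul c f _ hf => rw [M.action_smul]; exact Submodule.smul_mem _ c hf

/-! #### The action preorder, diagrams and decorations -/

/-- Indecomposable objects of a `2`-representation. -/
def Ind (M : TwoRep.{w, v, u, v₁, u₁} k D) : Type u₁ := {X : M.carrier // IsIndecomposable X}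

/-- The action preorder `X → Y`: there is a `1`-morphism `F` such that `Y` is a direct summand of
`F X`. -/
def Reaches (M : TwoRep.{w, v, u, v₁, u₁} k D) (X Y : M.carrier) : Prop :=
  ∃ F : D, IsSummand Y (F ⊙ₗ X)

/-- The action preorder on indecomposable objects, written so that `Y ≤ X` means `X → Y`. -/
instance (M : TwoRep.{w, v, u, v₁, u₁} k D) : Preorder M.Ind where
  le Y X := M.Reaches X.1 Y.1
  le_refl X := ⟨𝟙_ D, ⟨⟨(λₗ X.1).inv, (λₗ X.1).hom, (λₗ X.1).inv_hom_id⟩⟩⟩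
  le_trans Z Y X := by
    rintro ⟨G, ⟨r⟩⟩ ⟨F, ⟨s⟩⟩
    refine ⟨G ⊗ F, ⟨⟨r.i ≫ G ⊴ₗ s.i ≫ (αₗ G F X.1).inv, (αₗ G F X.1).hom ≫ G ⊴ₗ s.r ≫ r.r, ?_⟩⟩⟩
    have : G ⊴ₗ s.i ≫ G ⊴ₗ s.r = 𝟙 _ := by
      rw [← actionHomRight_comp, s.retract, actionHomRight_id]
    simp [reassoc_of% this]

/-- A `2`-representation is transitive if the action preorder is the full relation (and there is
at least one indecomposable object). -/
def IsTransitive (M : TwoRep.{w, v, u, v₁, u₁} k D) : Prop :=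
  Nonempty M.Ind ∧ ∀ X Y : M.Ind, M.Reaches X.1 Y.1

/-- The poset `Ind(M)/↔` of equivalence classes of indecomposable objects with respect to the
action preorder; the diagram of `M` is the Hasse diagram of this poset. The order is such that
`τ ≤ ρ` if and only if `ρ → τ`; thus there is an edge from `ρ` down to `τ` if and only if
`τ ⋖ ρ`. -/
abbrev Diagram (M : TwoRep.{w, v, u, v₁, u₁} k D) : Type u₁ := Antisymmetrization M.Ind (· ≤ ·)

/-- The vertex of the diagram given by an indecomposable object. -/
def vertex (M : TwoRep.{w, v, u, v₁, u₁} k D) (X : M.Ind) : M.Diagram :=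
  toAntisymmetrization (· ≤ ·) X

/-- The decoration `Θ_{τ,ρ}`: the indecomposable `1`-morphisms `F` for which there is `X ∈ ρ` such
that some element of `τ` is a direct summand of `F X`. (Isomorphism classes of `1`-morphisms are
encoded by sets which are closed under isomorphism.) -/
def decoration (M : TwoRep.{w, v, u, v₁, u₁} k D) (τ ρ : M.Diagram) : Set D :=
  {F | IsIndecomposable F ∧ ∃ X Y : M.Ind, M.vertex X = ρ ∧ M.vertex Y = τ ∧
    IsSummand Y.1 (F ⊙ₗ X.1)}

/-- `0 ⟶ K ⟶ M ⟶ N ⟶ 0` is a short exact sequence of `2`-representations: the diagram of `M` has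
exactly two vertices, `ι` identifies `K` with a transitive sub-`2`-representation of `M`, and `π`
is the projection onto the quotient of `M` by the ideal generated by the identity morphisms of the
objects of `K`. -/
structure IsShortExact {K : TwoRep.{w, v, u, v₁, u₁} k D} {M : TwoRep.{w, v, u, v₁, u₁} k D}
    {N : TwoRep.{w, v, u, v₁, u₁} k D} (ι : Hom K M) (π : Hom M N) : Prop where
  card_diagram : Nat.card M.Diagram = 2
  transitive : K.IsTransitive
  full : ι.functor.Full
  faithful : ι.functor.Faithful
  proj_essSurj : π.functor.EssSurj
  proj_full : π.functor.Full
  proj_eq_zero : ∀ {X Y : M.carrier} (f : X ⟶ Y), π.functor.map f = 0 ↔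
    f ∈ (HomIdeal.generatedBy (k := k) (fun Z => ∃ W, Nonempty (ι.functor.obj W ≅ Z))).hom X Y

/-- The sum of all invariant ideals which do not contain the identity morphism of any object
in `S`. -/
def maxIdeal (M : TwoRep.{w, v, u, v₁, u₁} k D) (S : Set M.carrier) : M.InvIdeal where
  hom X Y := ⨆ J : {J : M.InvIdeal // ∀ Z ∈ S, 𝟙 Z ∉ J.hom Z Z}, J.1.hom X Y
  comp_left {X Y Z} f {g} hg := by
    induction hg using Submodule.iSup_induction' with
    | mem J g hg => exact Submodule.mem_iSup_of_mem J (J.1.comp_left f hg)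
    | zero => simp
    | add g g' _ _ h h' => rw [Preadditive.comp_add]; exact Submodule.add_mem _ h h'
  comp_right {X Y Z} {f} g hf := by
    induction hf using Submodule.iSup_induction' with
    | mem J f hf => exact Submodule.mem_iSup_of_mem J (J.1.comp_right g hf)
    | zero => simp
    | add f f' _ _ h h' => rw [Preadditive.add_comp]; exact Submodule.add_mem _ h h'
  invariant F X Y f hf := by
    induction hf using Submodule.iSup_induction' with
    | mem J f hf => exact Submodule.mem_iSup_of_mem J (J.1.invariant F hf)
    | zero =>
      have := M.action_smul F (0 : k) (0 : X ⟶ Y)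
      rw [zero_smul, zero_smul] at this
      rw [this]
      exact Submodule.zero_mem _
    | add f f' _ _ h h' => rw [M.action_add]; exact Submodule.add_mem _ h h'

end TwoRep

/-! ### Cells and cell `2`-representations -/

section Cells

variable {k : Type w} [Field k] {D : Type u} [Category.{v} D] [Preadditive D] [Linear k D]
  [MonoidalCategory D]

/-- The left preorder: `F ≤_L G` if `G` is a direct summand of `H ∘ F` for some `H`. -/
def LeftLE (F G : D) : Prop := ∃ H : D, IsSummand G (H ⊗ F)

/-- The two-sided preorder: `F ≤_J G` if `G` is a direct summand of `H₁ ∘ F ∘ H₂` for some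
`H₁`, `H₂`. -/
def TwoSidedLE (F G : D) : Prop := ∃ H₁ H₂ : D, IsSummand G (H₁ ⊗ F ⊗ H₂)

/-- The left cell of `F`. -/
def leftCell (F : D) : Set D := {G | IsIndecomposable G ∧ LeftLE F G ∧ LeftLE G F}

/-- The two-sided cell of `F`. -/
def twoSidedCell (F : D) : Set D := {G | IsIndecomposable G ∧ TwoSidedLE F G ∧ TwoSidedLE G F}

/-- Left cells, as sets of indecomposable `1`-morphisms closed under isomorphism. -/
def IsLeftCell (L : Set D) : Prop := ∃ F : D, IsIndecomposable F ∧ L = leftCell F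

variable (k D) in
/-- The principal `2`-representation: `D` acting on itself by composition. -/
def principal [MonoidalPreadditive D] [MonoidalLinear k D] : TwoRep.{w, v, u, v, u} k D where
  carrier := D
  action_add F _ _ f g := MonoidalPreadditive.whiskerLeft_add f g
  action_smul F _ _ c f := MonoidalLinear.whiskerLeft_smul F c f
  add_action α β _ := MonoidalPreadditive.add_whiskerRight α β
  smul_action c α _ := MonoidalLinear.smul_whiskerRight c α _

/-- The additive closure of all `H ∘ F`, where `F ∈ L` and `H` is a `1`-morphism. -/
def leftSpan (L : Set D) : ObjectProperty D := 
  AddClosure (fun G => ∃ F ∈ L, ∃ H : D, Nonempty (G ≅ H ⊗ F))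

lemma leftSpan_invariant [MonoidalPreadditive D] [MonoidalLinear k D] (L : Set D) :
    (principal k D).IsInvariant (leftSpan (D := D) L) := by
  rintro (F : D) (X : D) ⟨n, Y, a, b, hY, h⟩
  change leftSpan L (F ⊗ X)
  refine ⟨n, fun i => F ⊗ Y i, fun i => F ◁ a i, fun i => F ◁ b i, fun i => ?_, ?_⟩
  · obtain ⟨G, hG, H, ⟨e⟩⟩ := hY i
    exact ⟨G, hG, F ⊗ H, ⟨whiskerLeftIso F e ≪≫ (α_ F H G).symm⟩⟩
  · have : ∀ i, F ◁ a i ≫ F ◁ b i = F ◁ (a i ≫ b i) := fun i => by simp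
    simp only [this]
    rw [← MonoidalCategory.whiskerLeft_id F X, ← h]
    exact (whiskerLeft_sum F _ _).symm

/-- The cell `2`-representation of a left cell `L`: the additive closure of all `H ∘ F`, with
`F ∈ L`, is a sub-`2`-representation of the principal `2`-representation, and the cell
`2`-representation is its quotient by the maximal invariant ideal which does not contain the
identity `2`-morphism of any `F ∈ L`. -/
def cellRep (k : Type w) [Field k] {D : Type u} [Category.{v} D] [Preadditive D] [Linear k D]
    [MonoidalCategory D] [MonoidalPreadditive D] [MonoidalLinear k D] (L : Set D) :
    TwoRep.{w, v, u, v, u} k D :=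
  let N := (principal k D).sub (leftSpan (D := D) L) (leftSpan_invariant L)
  N.quot (N.maxIdeal ((leftSpan (D := D) L).ι.obj ⁻¹' L : Set (leftSpan (D := D) L).FullSubcategory))

end Cells
end FinRep
end

noncomputable section
namespace FinRep

/-! ### Finite dimensional modules and bimodules -/

section Modules

variable {k : Type u} [Field k] {R : Type u} [Ring R] [Algebra k R]

/-- The `k`-linear map underlying a homomorphism of `R`-modules. -/
def klin {X Y : FGModuleCat.{u} R} (f : X ⟶ Y) : X →ₗ[k] Y := f.hom.hom.restrictScalars k

@[simp] lemma klin_apply {X Y : FGModuleCat.{u} R} (f : X ⟶ Y) (x : X) :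
    klin (k := k) f x = f.hom.hom x := rfl

section Act

variable {W : Type u} [AddCommGroup W] [Module k W]

/-- A `k`-vector space `W` with an algebra homomorphism `ρ : R → End_k(W)`, seen as an
`R`-module. -/
def ActMod (_ρ : R →ₐ[k] Module.End k W) : Type u := W

instance (ρ : R →ₐ[k] Module.End k W) : AddCommGroup (ActMod ρ) := inferInstanceAs (AddCommGroup W)

instance (ρ : R →ₐ[k] Module.End k W) : Module R (ActMod ρ) :=
  Module.compHom W ρ.toRingHom

lemma actMod_finite [FiniteDimensional k W] (ρ : R →ₐ[k] Module.End k W) :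
    Module.Finite R (ActMod ρ) := by
  let _ : Module k (ActMod ρ) := inferInstanceAs (Module k W)
  have : Module.Finite k (ActMod ρ) := inferInstanceAs (Module.Finite k W)
  have : IsScalarTower k R (ActMod ρ) := ⟨fun c r w => by
    change ρ (c • r) w = c • ρ r w
    rw [map_smul]; rfl⟩
  exact Module.Finite.of_restrictScalars_finite k R _

variable [FiniteDimensional k W]

/-- `ActMod` as an object of the category of finitely generated modules. -/
def ofAct (ρ : R →ₐ[k] Module.End k W) : FGModuleCat.{u} R :=
  haveI := actMod_finite ρ
  FGModuleCat.of R (ActMod ρ)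

/-- The identity map `W → ofAct ρ`. -/
def actEquiv (ρ : R →ₐ[k] Module.End k W) : W ≃ₗ[k] (ofAct ρ : FGModuleCat.{u} R) where
  toFun w := w
  invFun w := w
  map_add' _ _ := rfl
  map_smul' c w := by
    change c • w = ρ (algebraMap k R c) w
    simp
  left_inv _ := rfl
  right_inv _ := rfl

lemma smul_actEquiv (ρ : R →ₐ[k] Module.End k W) (r : R) (w : W) :
    r • actEquiv ρ w = actEquiv ρ (ρ r w) := rfl

/-- An `R`-equivariant `k`-linear map as a morphism of `R`-modules. -/
def homOfKlin {X Y : FGModuleCat.{u} R} (f : X →ₗ[k] Y) (h : ∀ (r : R) (x : X), f (r • x) = r • f x) :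
    X ⟶ Y :=
  ObjectProperty.homMk (ModuleCat.ofHom
    { toFun := f, map_add' := f.map_add, map_smul' := h : X →ₗ[R] Y })

@[simp] lemma homOfKlin_apply {X Y : FGModuleCat.{u} R} (f : X →ₗ[k] Y)
    (h : ∀ (r : R) (x : X), f (r • x) = r • f x) (x : X) : (homOfKlin f h).hom.hom x = f x := rfl

@[simp] lemma homOfKlin_klin {X Y : FGModuleCat.{u} R} (f : X →ₗ[k] Y)
    (h : ∀ (r : R) (x : X), f (r • x) = r • f x) : klin (homOfKlin f h) = f := rfl

/-- Two morphisms out of `ofAct ρ` are equal if they agree on `W`. -/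
lemma actHom_ext {ρ : R →ₐ[k] Module.End k W} {Y : FGModuleCat.{u} R} {f g : ofAct ρ ⟶ Y}
    (h : klin (k := k) f ∘ₗ (actEquiv ρ).toLinearMap = klin g ∘ₗ (actEquiv ρ).toLinearMap) :
    f = g := by
  apply FGModuleCat.hom_ext
  ext w
  exact LinearMap.congr_fun h w

/-- A morphism `ofAct ρ ⟶ ofAct ρ'` given by an equivariant linear map. -/
def actHom {W' : Type u} [AddCommGroup W'] [Module k W'] [FiniteDimensional k W']
    (ρ : R →ₐ[k] Module.End k W) (ρ' : R →ₐ[k] Module.End k W') (f : W →ₗ[k] W')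
    (h : ∀ r w, f (ρ r w) = ρ' r (f w)) : ofAct ρ ⟶ ofAct ρ' :=
  homOfKlin ((actEquiv ρ').toLinearMap ∘ₗ f ∘ₗ (actEquiv ρ).symm.toLinearMap) (fun r w => h r w)

@[simp] lemma actHom_apply {W' : Type u} [AddCommGroup W'] [Module k W'] [FiniteDimensional k W']
    (ρ : R →ₐ[k] Module.End k W) (ρ' : R →ₐ[k] Module.End k W') (f : W →ₗ[k] W')
    (h : ∀ r w, f (ρ r w) = ρ' r (f w)) (w : W) :
    (actHom ρ ρ' f h).hom.hom (actEquiv ρ w) = actEquiv ρ' (f w) := rfl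

/-- An equivariant linear equivalence as an isomorphism. -/
def actIso {W' : Type u} [AddCommGroup W'] [Module k W'] [FiniteDimensional k W']
    (ρ : R →ₐ[k] Module.End k W) (ρ' : R →ₐ[k] Module.End k W') (e : W ≃ₗ[k] W')
    (h : ∀ r w, e (ρ r w) = ρ' r (e w)) : ofAct ρ ≅ ofAct ρ' where
  hom := actHom ρ ρ' e.toLinearMap h
  inv := actHom ρ' ρ e.symm.toLinearMap (fun r w => by
    apply e.injective
    simp [h])
  hom_inv_id := actHom_ext (by ext; simp)
  inv_hom_id := actHom_ext (by ext; simp)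

end Act

variable (k R) in
/-- Finite dimensional `R`-`R`-bimodules over `k`: a finite dimensional vector space with commuting
`k`-linear left and right actions of `R`. -/
structure Bimod where
  /-- the underlying vector space -/
  carrier : Type u
  [addCommGroup : AddCommGroup carrier]
  [module : Module k carrier]
  [finite : FiniteDimensional k carrier]
  /-- the left action -/
  left : R →ₐ[k] Module.End k carrier
  /-- the right action -/
  right : Rᵐᵒᵖ →ₐ[k] Module.End k carrier
  commute : ∀ r s, Commute (left r) (right s)

namespace Bimod

attribute [instance] addCommGroup module finite

/-- The algebra homomorphism `R ⊗ Rᵒᵖ → End_k(Q)` given by a bimodule `Q`. -/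
def act (Q : Bimod k R) : R ⊗[k] Rᵐᵒᵖ →ₐ[k] Module.End k Q.carrier :=
  Algebra.TensorProduct.lift Q.left Q.right Q.commute

/-- A bimodule is projective if it is projective as a module over `R ⊗ Rᵒᵖ`. -/
def IsProjective (Q : Bimod k R) : Prop := Module.Projective (R ⊗[k] Rᵐᵒᵖ) (ActMod Q.act)

/-- The relations `q r ⊗ x = q ⊗ r x`. -/
def balance (Q : Bimod k R) (X : FGModuleCat.{u} R) : Submodule k (Q.carrier ⊗[k] X) :=
  Submodule.span k {t | ∃ (q : Q.carrier) (r : R) (x : X),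
    t = Q.right (MulOpposite.op r) q ⊗ₜ[k] x - q ⊗ₜ[k] (r • x)}

/-- The tensor product `Q ⊗_R X`. -/
abbrev Tens (Q : Bimod k R) (X : FGModuleCat.{u} R) : Type u := (Q.carrier ⊗[k] X) ⧸ Q.balance X

/-- The element `q ⊗ x` of `Q ⊗_R X`. -/
def tmul (Q : Bimod k R) {X : FGModuleCat.{u} R} (q : Q.carrier) (x : X) : Q.Tens X :=
  (Q.balance X).mkQ (q ⊗ₜ[k] x)

lemma tmul_balanced (Q : Bimod k R) {X : FGModuleCat.{u} R} (q : Q.carrier) (r : R) (x : X) :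
    Q.tmul (Q.right (MulOpposite.op r) q) x = Q.tmul q (r • x) :=
  (Submodule.Quotient.eq _).2 (Submodule.subset_span ⟨q, r, x, rfl⟩)

lemma tens_hom_ext (Q : Bimod k R) {X : FGModuleCat.{u} R} {N : Type*} [AddCommGroup N] [Module k N]
    {f g : Q.Tens X →ₗ[k] N} (h : ∀ q x, f (Q.tmul q x) = g (Q.tmul q x)) : f = g := by
  apply Submodule.linearMap_qext
  ext q x
  exact h q x

/-- A `k`-linear map on `Q ⊗_k X` which respects the relations. -/
def tensLift (Q : Bimod k R) {X : FGModuleCat.{u} R} {N : Type*} [AddCommGroup N] [Module k N]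
    (f : Q.carrier ⊗[k] X →ₗ[k] N)
    (h : ∀ q r x, f (Q.right (MulOpposite.op r) q ⊗ₜ x) = f (q ⊗ₜ (r • x))) :
    Q.Tens X →ₗ[k] N :=
  (Q.balance X).liftQ f (by
    rw [balance, Submodule.span_le]
    rintro _ ⟨q, r, x, rfl⟩
    simp [h])

@[simp] lemma tensLift_tmul (Q : Bimod k R) {X : FGModuleCat.{u} R} {N : Type*} [AddCommGroup N]
    [Module k N] (f : Q.carrier ⊗[k] X →ₗ[k] N) (h) (q : Q.carrier) (x : X) :
    Q.tensLift f h (Q.tmul q x) = f (q ⊗ₜ x) := rfl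

/-- The map `φ ⊗ X` for a homomorphism `φ` of right modules. -/
def tensMap {Q Q' : Bimod k R} (φ : Q.carrier →ₗ[k] Q'.carrier)
    (h : ∀ s q, φ (Q.right s q) = Q'.right s (φ q)) (X : FGModuleCat.{u} R) :
    Q.Tens X →ₗ[k] Q'.Tens X :=
  Q.tensLift ((Q'.balance X).mkQ ∘ₗ φ.rTensor X) (fun q s x => by
    have := Q'.tmul_balanced (φ q) s x
    rw [← h] at this
    exact this)

@[simp] lemma tensMap_tmul {Q Q' : Bimod k R} (φ : Q.carrier →ₗ[k] Q'.carrier)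
    (h : ∀ s q, φ (Q.right s q) = Q'.right s (φ q)) {X : FGModuleCat.{u} R} (q : Q.carrier) (x : X) :
    tensMap φ h X (Q.tmul q x) = Q'.tmul (φ q) x := rfl

/-- `q ⊗ x` as a bilinear map. -/
def tmulₗ (Q : Bimod k R) (X : FGModuleCat.{u} R) : Q.carrier →ₗ[k] X →ₗ[k] Q.Tens X :=
  (TensorProduct.mk k Q.carrier X).compr₂ (Q.balance X).mkQ

lemma tmulₗ_apply (Q : Bimod k R) {X : FGModuleCat.{u} R} (q : Q.carrier) (x : X) :
    Q.tmulₗ X q x = Q.tmul q x := rfl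

lemma add_tmul (Q : Bimod k R) {X : FGModuleCat.{u} R} (q q' : Q.carrier) (x : X) :
    Q.tmul (q + q') x = Q.tmul q x + Q.tmul q' x := by simp [← tmulₗ_apply]

lemma smul_tmul (Q : Bimod k R) {X : FGModuleCat.{u} R} (c : k) (q : Q.carrier) (x : X) :
    Q.tmul (c • q) x = c • Q.tmul q x := by simp [← tmulₗ_apply]

lemma left_right (Q : Bimod k R) (r : R) (s : Rᵐᵒᵖ) (q : Q.carrier) :
    Q.left r (Q.right s q) = Q.right s (Q.left r q) :=
  LinearMap.congr_fun (Q.commute r s).eq q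

/-- The left action of `R` on `Q ⊗_R X`. -/
def tensAct (Q : Bimod k R) (X : FGModuleCat.{u} R) : R →ₐ[k] Module.End k (Q.Tens X) :=
  AlgHom.ofLinearMap
    { toFun := fun r => tensMap (Q.left r) (fun s q => Q.left_right r s q) X
      map_add' := fun r s => by
        apply Q.tens_hom_ext
        intro q x
        simp [add_tmul]
      map_smul' := fun c r => by
        apply Q.tens_hom_ext
        intro q x
        simp [smul_tmul] }
    (by
      apply Q.tens_hom_ext
      intro q x
      simp)
    (fun r s => by
      apply Q.tens_hom_ext
      intro q x
      simp)

@[simp] lemma tensAct_tmul (Q : Bimod k R) {X : FGModuleCat.{u} R} (r : R) (q : Q.carrier) (x : X) :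
    Q.tensAct X r (Q.tmul q x) = Q.tmul (Q.left r q) x := rfl

lemma finite_of_fg [FiniteDimensional k R] (X : FGModuleCat.{u} R) : FiniteDimensional k X :=
  Module.Finite.trans R X

variable [FiniteDimensional k R]

attribute [local instance] finite_of_fg

/-- The action of `Q ⊗_R -` on morphisms. -/
def tensMapRight (Q : Bimod k R) {X Y : FGModuleCat.{u} R} (f : X ⟶ Y) :
    Q.Tens X →ₗ[k] Q.Tens Y :=
  Q.tensLift ((Q.balance Y).mkQ ∘ₗ (klin f).lTensor Q.carrier) (fun q r x => by
    have := Q.tmul_balanced q r (f.hom.hom x)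
    rw [← map_smul] at this
    exact this)

@[simp] lemma tensMapRight_tmul (Q : Bimod k R) {X Y : FGModuleCat.{u} R} (f : X ⟶ Y)
    (q : Q.carrier) (x : X) : Q.tensMapRight f (Q.tmul q x) = Q.tmul q (f.hom.hom x) := rfl

/-- The functor `Q ⊗_R -` on the category of finitely generated `R`-modules. -/
def tensFunctor (Q : Bimod k R) : FGModuleCat.{u} R ⥤ FGModuleCat.{u} R where
  obj X := ofAct (Q.tensAct X)
  map {X Y} f := actHom (Q.tensAct X) (Q.tensAct Y) (Q.tensMapRight f) (fun r =>
    LinearMap.congr_fun (Q.tens_hom_ext (f := Q.tensMapRight f ∘ₗ Q.tensAct X r)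
      (g := Q.tensAct Y r ∘ₗ Q.tensMapRight f) (fun q x => by simp)))
  map_id X := actHom_ext (Q.tens_hom_ext fun q x => by simp)
  map_comp f g := actHom_ext (Q.tens_hom_ext fun q x => by simp)

/-- The element `q ⊗ x` of `Q ⊗_R X`. -/
def tm (Q : Bimod k R) {X : FGModuleCat.{u} R} (q : Q.carrier) (x : X) : Q.tensFunctor.obj X :=
  actEquiv (Q.tensAct X) (Q.tmul q x)

end Bimod
end Modules
end FinRep
end

noncomputable section
namespace FinRep
open Module

section Examples

variable {k : Type u} [Field k] {R : Type u} [Ring R] [Algebra k R]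

variable (k R) in
/-- The regular bimodule `R`. -/
def Bimod.regular [FiniteDimensional k R] : Bimod k R where
  carrier := R
  left := Algebra.lsmul k k R
  right := Algebra.lsmul k k R
  commute r s := by
    ext x
    simp [mul_assoc]

variable (k R) in
/-- The bimodule `R ⊗_k R`, on which `R` acts by left multiplication on the left factor and by
right multiplication on the right factor. -/
def Bimod.outer [FiniteDimensional k R] : Bimod k R where
  carrier := R ⊗[k] R
  left := (Module.End.rTensorAlgHom k R R).comp (Algebra.lsmul k k R)
  right := (Module.End.lTensorAlgHom k R R).comp (Algebra.lsmul k k R)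
  commute r s := by
    apply TensorProduct.ext'
    intro x y
    rfl

variable {A B : Type u} [Ring A] [Ring B] [Algebra k A] [Algebra k B]

/-- The external tensor product of an `A`-`A`-bimodule and a `B`-`B`-bimodule, which is a bimodule
over `A ⊗ B`. -/
def Bimod.box (P : Bimod k A) (Q : Bimod k B) : Bimod k (A ⊗[k] B) where
  carrier := P.carrier ⊗[k] Q.carrier
  left := endTensorEndAlgHom.comp (Algebra.TensorProduct.map P.left Q.left)
  right := (endTensorEndAlgHom.comp (Algebra.TensorProduct.map P.right Q.right)).comp
    (Algebra.TensorProduct.opAlgEquiv k k A B).symm.toAlgHom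
  commute r s := by
    change Commute (endTensorEndAlgHom _) (endTensorEndAlgHom _)
    apply Commute.map
    change Commute (Algebra.TensorProduct.map P.left Q.left r)
      (Algebra.TensorProduct.map P.right Q.right ((Algebra.TensorProduct.opAlgEquiv k k A B).symm s))
    generalize (Algebra.TensorProduct.opAlgEquiv k k A B).symm s = s'
    induction r using TensorProduct.induction_on with
    | zero => simp
    | add x y hx hy => rw [map_add]; exact hx.add_left hy
    | tmul a b =>
      induction s' using TensorProduct.induction_on with
      | zero => simp
      | add x y hx hy => rw [map_add]; exact hx.add_right hy
      | tmul a' b' =>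
        simp only [Algebra.TensorProduct.map_tmul, Commute, SemiconjBy,
          Algebra.TensorProduct.tmul_mul_tmul, (P.commute a a').eq, (Q.commute b b').eq]

@[simp] lemma Bimod.box_left_tmul (P : Bimod k A) (Q : Bimod k B) (a : A) (b : B) (p : P.carrier)
    (q : Q.carrier) : (P.box Q).left (a ⊗ₜ b) (p ⊗ₜ[k] q) = P.left a p ⊗ₜ[k] Q.left b q := rfl

@[simp] lemma Bimod.box_right_tmul (P : Bimod k A) (Q : Bimod k B) (a : A) (b : B) (p : P.carrier)
    (q : Q.carrier) : (P.box Q).right (MulOpposite.op (a ⊗ₜ b)) (p ⊗ₜ[k] q) =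
      P.right (MulOpposite.op a) p ⊗ₜ[k] Q.right (MulOpposite.op b) q := by
  change endTensorEndAlgHom (R := k) (S := k) (A := k) (Algebra.TensorProduct.map P.right Q.right
    ((Algebra.TensorProduct.opAlgEquiv k k A B).symm (MulOpposite.op (a ⊗ₜ b)))) _ = _
  rw [Algebra.TensorProduct.opAlgEquiv_symm_tmul]
  rfl

end Examples

/-! ### Extension functors -/

section Ext

variable {k : Type u} [Field k] {R : Type u} [Ring R] [Algebra k R] [FiniteDimensional k R]

attribute [local instance] Bimod.finite_of_fg

variable {V : Type u} [AddCommGroup V] [Module k V] [FiniteDimensional k V]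

/-- The action of `R` on `V ⊗ X` through `δ : R → End(V) ⊗ R`. -/
def extAct (δ : R →ₐ[k] Module.End k V ⊗[k] R) (X : FGModuleCat.{u} R) :
    R →ₐ[k] Module.End k (V ⊗[k] X) :=
  (endTensorEndAlgHom.comp (Algebra.TensorProduct.map (AlgHom.id k _) (Algebra.lsmul k k X))).comp δ

lemma extAct_map (δ : R →ₐ[k] Module.End k V ⊗[k] R) {X Y : FGModuleCat.{u} R} (f : X ⟶ Y) (r : R)
    (t : V ⊗[k] X) : (klin f).lTensor V (extAct δ X r t) = extAct δ Y r ((klin f).lTensor V t) := by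
  simp only [extAct, AlgHom.comp_apply]
  generalize δ r = d
  induction d using TensorProduct.induction_on with
  | zero => simp
  | add x y hx hy => simp [map_add, hx, hy]
  | tmul φ s =>
    induction t using TensorProduct.induction_on with
    | zero => simp
    | add x y hx hy => simp only [map_add, hx, hy]
    | tmul v x => simp [endTensorEndAlgHom_apply]

/-- The functor `X ↦ V ⊗ X`, with `R` acting through `δ`. -/
def extFunctor (δ : R →ₐ[k] Module.End k V ⊗[k] R) : FGModuleCat.{u} R ⥤ FGModuleCat.{u} R where
  obj X := ofAct (extAct δ X)
  map {X Y} f := actHom (extAct δ X) (extAct δ Y) ((klin f).lTensor V) (extAct_map δ f)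
  map_id X := actHom_ext (by ext; simp)
  map_comp f g := actHom_ext (by ext; simp)

/-- The map `v ⊗ r ↦ v ⊗ r x`. -/
def evalAt (V : Type u) [AddCommGroup V] [Module k V] {X : FGModuleCat.{u} R} (x : X) :
    V ⊗[k] R →ₗ[k] V ⊗[k] X :=
  ((Algebra.lsmul k k X).toLinearMap.flip x).lTensor V

@[simp] lemma evalAt_tmul {X : FGModuleCat.{u} R} (x : X) (v : V) (r : R) :
    evalAt V x (v ⊗ₜ[k] r) = v ⊗ₜ (r • x) := rfl

variable (V) in
/-- The bilinear map `(v ⊗ r, x) ↦ v ⊗ r x`. -/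
def evalBil (X : FGModuleCat.{u} R) : V ⊗[k] R →ₗ[k] X →ₗ[k] V ⊗[k] X :=
  (LinearMap.lTensorHom V ∘ₗ (Algebra.lsmul k k X).toLinearMap.flip).flip

@[simp] lemma evalBil_apply {X : FGModuleCat.{u} R} (x : X) (t : V ⊗[k] R) :
    evalBil V X t x = evalAt V x t := rfl

section Compare

variable (Q : Bimod k R) (δ : R →ₐ[k] Module.End k V ⊗[k] R) (θ : V ⊗[k] R ≃ₗ[k] Q.carrier)

/-- The map `Q ⊗_R X → V ⊗ X` induced by an isomorphism of right modules `Q ≅ V ⊗ R`. -/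
def tensToExt (hr : ∀ v r s, θ (v ⊗ₜ (r * s)) = Q.right (MulOpposite.op s) (θ (v ⊗ₜ r)))
    (X : FGModuleCat.{u} R) : Q.Tens X →ₗ[k] V ⊗[k] X :=
  Q.tensLift (TensorProduct.lift (evalBil V X ∘ₗ θ.symm.toLinearMap)) (fun q s x => by
    obtain ⟨t, rfl⟩ := θ.surjective q
    simp only [TensorProduct.lift.tmul, LinearMap.comp_apply, LinearEquiv.coe_coe, evalBil_apply]
    induction t using TensorProduct.induction_on with
    | zero => simp
    | add t t' h h' => simp only [map_add, h, h']
    | tmul v r =>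
      rw [← hr]
      simp [mul_smul])

/-- The inverse map `V ⊗ X → Q ⊗_R X`. -/
def extToTens (X : FGModuleCat.{u} R) : V ⊗[k] X →ₗ[k] Q.Tens X :=
  TensorProduct.lift ((Q.tmulₗ X) ∘ₗ θ.toLinearMap ∘ₗ (TensorProduct.mk k V R).flip 1)

@[simp] lemma extToTens_tmul {X : FGModuleCat.{u} R} (v : V) (x : X) :
    extToTens Q θ X (v ⊗ₜ x) = Q.tmul (θ (v ⊗ₜ 1)) x := rfl

/-- `Q ⊗_R X ≅ V ⊗ X`. -/
def tensEquivExt (hr : ∀ v r s, θ (v ⊗ₜ (r * s)) = Q.right (MulOpposite.op s) (θ (v ⊗ₜ r)))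
    (X : FGModuleCat.{u} R) : V ⊗[k] X ≃ₗ[k] Q.Tens X :=
  LinearEquiv.ofLinearMap (extToTens Q θ X) (tensToExt Q θ hr X)
    (Q.tens_hom_ext fun q x => by
      obtain ⟨t, rfl⟩ := θ.surjective q
      simp only [tensToExt, LinearMap.comp_apply, Bimod.tensLift_tmul, TensorProduct.lift.tmul,
        LinearEquiv.coe_coe, evalBil_apply, LinearMap.id_apply, LinearEquiv.symm_apply_apply]
      induction t using TensorProduct.induction_on with
      | zero => simp [← Bimod.tmulₗ_apply]
      | add t t' h h' => simp only [map_add, h, h', Bimod.add_tmul]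
      | tmul v r => 
        have := hr v 1 r
        rw [one_mul] at this
        rw [evalAt_tmul, extToTens_tmul, this, Q.tmul_balanced])
    (TensorProduct.ext' fun v x => by
      simp [tensToExt])

lemma extToTens_act (hr : ∀ v r s, θ (v ⊗ₜ (r * s)) = Q.right (MulOpposite.op s) (θ (v ⊗ₜ r)))
    (hl : ∀ r v s, Q.left r (θ (v ⊗ₜ s)) =
      θ (endTensorEndAlgHom (R := k) (S := k) (A := k)
        (Algebra.TensorProduct.map (AlgHom.id k _) (Algebra.lsmul k k R) (δ r)) (v ⊗ₜ s)))
    (X : FGModuleCat.{u} R) (r : R) (t : V ⊗[k] X) :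
    extToTens Q θ X (extAct δ X r t) = Q.tensAct X r (extToTens Q θ X t) := by
  induction t using TensorProduct.induction_on with
  | zero => simp
  | add t t' h h' => simp only [map_add, h, h']
  | tmul v x =>
    rw [extToTens_tmul, Bimod.tensAct_tmul, hl]
    simp only [extAct, AlgHom.comp_apply]
    generalize δ r = d
    induction d using TensorProduct.induction_on with
    | zero => simp [← Bimod.tmulₗ_apply]
    | add t t' h h' => simp only [map_add, LinearMap.add_apply, h, h', Bimod.add_tmul]
    | tmul φ s =>
      have := hr (φ v) 1 s
      rw [one_mul] at this
      simp [endTensorEndAlgHom_apply, this, Q.tmul_balanced]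

/-- The functors `Q ⊗_R -` and `V ⊗ -` are isomorphic. -/
def tensIsoExt (hr : ∀ v r s, θ (v ⊗ₜ (r * s)) = Q.right (MulOpposite.op s) (θ (v ⊗ₜ r)))
    (hl : ∀ r v s, Q.left r (θ (v ⊗ₜ s)) =
      θ (endTensorEndAlgHom (R := k) (S := k) (A := k)
        (Algebra.TensorProduct.map (AlgHom.id k _) (Algebra.lsmul k k R) (δ r)) (v ⊗ₜ s))) :
    extFunctor δ ≅ Q.tensFunctor :=
  NatIso.ofComponents (fun X => actIso _ _ (tensEquivExt Q θ hr X) (extToTens_act Q δ θ hr hl X))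
    (fun {X Y} f => actHom_ext (by 
      apply TensorProduct.ext'
      intro v x
      rfl))

end Compare

end Ext
end FinRep
end

noncomputable section
namespace FinRep

/-! ### Additive closures -/

section Additive

variable {C : Type*} [Category* C] [Preadditive C]

lemma AddClosure.of_fintype {S : ObjectProperty C} {X : C} {ι : Type*} [Fintype ι] (Y : ι → C)
    (a : ∀ i, X ⟶ Y i) (b : ∀ i, Y i ⟶ X) (hY : ∀ i, S (Y i)) (h : ∑ i, a i ≫ b i = 𝟙 X) :
    AddClosure S X := by
  let e := (Fintype.equivFin ι).symm
  exact ⟨_, fun i => Y (e i), fun i => a (e i), fun i => b (e i), fun i => hY _, by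
    rw [← h]; exact e.sum_comp (fun i => a i ≫ b i)⟩

lemma AddClosure.of_iso {S : ObjectProperty C} {X Y : C} (e : X ≅ Y) (h : S Y) : AddClosure S X :=
  .of_fintype (ι := Unit) (fun _ => Y) (fun _ => e.hom) (fun _ => e.inv) (fun _ => h) (by simp)

lemma AddClosure.of_mem {S : ObjectProperty C} {X : C} (h : S X) : AddClosure S X :=
  .of_iso (Iso.refl X) h

lemma AddClosure.bind {S T : ObjectProperty C} (h : ∀ X, S X → AddClosure T X) {X : C}
    (hX : AddClosure S X) : AddClosure T X := by
  obtain ⟨n, Y, a, b, hY, e⟩ := hX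
  choose m Z c d hZ e' using fun i => h _ (hY i)
  refine of_fintype (ι := Σ i, Fin (m i)) (fun p => Z p.1 p.2) (fun p => a p.1 ≫ c p.1 p.2)
    (fun p => d p.1 p.2 ≫ b p.1) (fun p => hZ _ _) ?_
  rw [Fintype.sum_sigma, ← e]
  refine Finset.sum_congr rfl fun i _ => ?_
  have : ∑ j, (a i ≫ c i j) ≫ d i j ≫ b i = a i ≫ (∑ j, c i j ≫ d i j) ≫ b i := by
    simp [Preadditive.sum_comp, Preadditive.comp_sum]
  rw [this, e', Category.id_comp]

lemma AddClosure.trans_iso {S : ObjectProperty C} {X Y : C} (e : X ≅ Y) (h : AddClosure S Y) :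
    AddClosure S X :=
  .bind (fun _ h => h) (AddClosure.of_iso e h)

lemma AddClosure.map {D : Type*} [Category* D] [Preadditive D] (F : C ⥤ D) [F.Additive]
    {S : ObjectProperty C} {T : ObjectProperty D} (h : ∀ X, S X → AddClosure T (F.obj X)) {X : C}
    (hX : AddClosure S X) : AddClosure T (F.obj X) := by
  obtain ⟨n, Y, a, b, hY, e⟩ := hX
  refine .bind (S := fun Z => ∃ i, Z = F.obj (Y i)) ?_
    (.of_fintype (fun i => F.obj (Y i)) (fun i => F.map (a i)) (fun i => F.map (b i))
      (fun i => ⟨i, rfl⟩) ?_)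
  · rintro _ ⟨i, rfl⟩
    exact h _ (hY i)
  · simp only [← F.map_comp]
    rw [← F.map_sum, e, F.map_id]

/-- Precomposition preserves additive closures. -/
lemma AddClosure.precomp (G : C ⥤ C) {S T : ObjectProperty (C ⥤ C)}
    (h : ∀ F, S F → AddClosure T (G ⋙ F)) {F : C ⥤ C} (hF : AddClosure S F) :
    AddClosure T (G ⋙ F) := by
  have : ((Functor.whiskeringLeft C C C).obj G).Additive := ⟨rfl⟩
  exact hF.map ((Functor.whiskeringLeft C C C).obj G) h

/-- Postcomposition with an additive functor preserves additive closures. -/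
lemma AddClosure.postcomp (G : C ⥤ C) [G.Additive] {S T : ObjectProperty (C ⥤ C)}
    (h : ∀ F, S F → AddClosure T (F ⋙ G)) {F : C ⥤ C} (hF : AddClosure S F) :
    AddClosure T (F ⋙ G) := by
  have : ((Functor.whiskeringRight C C C).obj G).Additive := ⟨by intros; ext; simp⟩
  exact hF.map ((Functor.whiskeringRight C C C).obj G) h

lemma AddClosure.map_eq {S : ObjectProperty (C ⥤ C)} {F : C ⥤ C} (hF : AddClosure S F)
    (hS : ∀ G, S G → ∀ {X Y : C} (f g : X ⟶ Y), G.map (f + g) = G.map f + G.map g)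
    {X Y : C} (f g : X ⟶ Y) : F.map (f + g) = F.map f + F.map g := by
  obtain ⟨n, G, a, b, hG, e⟩ := hF
  have key : ∀ f : X ⟶ Y, F.map f = ∑ i, (a i).app X ≫ (G i).map f ≫ (b i).app Y := by
    intro f
    have := congrArg (fun α => F.map f ≫ NatTrans.app α Y) e
    simp only [NatTrans.app_sum, NatTrans.comp_app, NatTrans.id_app, Category.comp_id] at this
    rw [← this, Preadditive.comp_sum]
    simp
  rw [key, key, key, ← Finset.sum_add_distrib]
  refine Finset.sum_congr rfl fun i _ => ?_
  rw [hS _ (hG i)]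
  simp

lemma AddClosure.map_smul {k : Type*} [Field k] [Linear k C] {S : ObjectProperty (C ⥤ C)}
    {F : C ⥤ C} (hF : AddClosure S F)
    (hS : ∀ G, S G → ∀ {X Y : C} (c : k) (f : X ⟶ Y), G.map (c • f) = c • G.map f)
    {X Y : C} (c : k) (f : X ⟶ Y) : F.map (c • f) = c • F.map f := by
  obtain ⟨n, G, a, b, hG, e⟩ := hF
  have key : ∀ f : X ⟶ Y, F.map f = ∑ i, (a i).app X ≫ (G i).map f ≫ (b i).app Y := by
    intro f
    have := congrArg (fun α => F.map f ≫ NatTrans.app α Y) e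
    simp only [NatTrans.app_sum, NatTrans.comp_app, NatTrans.id_app, Category.comp_id] at this
    rw [← this, Preadditive.comp_sum]
    simp
  rw [key, key, Finset.smul_sum]
  refine Finset.sum_congr rfl fun i _ => ?_
  rw [hS _ (hG i)]
  simp

end Additive

section Nat

variable {k : Type u} [Field k] {R : Type u} [Ring R] [Algebra k R] [FiniteDimensional k R]

attribute [local instance] Bimod.finite_of_fg

lemma Bimod.tensFunctor_map_add (Q : Bimod k R) {X Y : FGModuleCat.{u} R} (f g : X ⟶ Y) :
    Q.tensFunctor.map (f + g) = Q.tensFunctor.map f + Q.tensFunctor.map g :=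
  actHom_ext (Q.tens_hom_ext fun q x => by
    change actEquiv (Q.tensAct Y) (Q.tmulₗ Y q (f.hom.hom x + g.hom.hom x)) = _
    rw [map_add, map_add]
    rfl)

lemma Bimod.tensFunctor_map_smul (Q : Bimod k R) {X Y : FGModuleCat.{u} R} (c : k) (f : X ⟶ Y) :
    Q.tensFunctor.map (c • f) = c • Q.tensFunctor.map f :=
  actHom_ext (Q.tens_hom_ext fun q x => by
    change actEquiv (Q.tensAct Y) (Q.tmulₗ Y q (c • (f.hom.hom x))) = _
    rw [map_smul, map_smul]
    rfl)

/-- The natural transformation given by a homomorphism of bimodules. -/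
def Bimod.tensNat {Q Q' : Bimod k R} (φ : Q.carrier →ₗ[k] Q'.carrier)
    (hl : ∀ r q, φ (Q.left r q) = Q'.left r (φ q)) (hr : ∀ s q, φ (Q.right s q) = Q'.right s (φ q)) :
    Q.tensFunctor ⟶ Q'.tensFunctor where
  app X := actHom _ _ (tensMap φ hr X) (fun r =>
    LinearMap.congr_fun (Q.tens_hom_ext (f := tensMap φ hr X ∘ₗ Q.tensAct X r)
      (g := Q'.tensAct X r ∘ₗ tensMap φ hr X) (fun q x => by simp [hl])))
  naturality X Y f := by
    apply actHom_ext
    apply Q.tens_hom_ext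
    intro q x
    simp [tensFunctor]
    rfl

variable (k) in
/-- `klin` as an additive map. -/
def klinAdd (X Y : FGModuleCat.{u} R) : (X ⟶ Y) →+ (X →ₗ[k] Y) where
  toFun := klin
  map_zero' := rfl
  map_add' _ _ := rfl

lemma klin_sum {ι : Type*} [Fintype ι] {X Y : FGModuleCat.{u} R} (f : ι → (X ⟶ Y)) :
    klin (k := k) (∑ i, f i) = ∑ i, klin (f i) :=
  map_sum (klinAdd k X Y) f _

lemma klin_sum_apply {ι : Type*} [Fintype ι] {X Y : FGModuleCat.{u} R} (f : ι → (X ⟶ Y)) (x : X) :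
    klin (k := k) (∑ i, f i) x = ∑ i, klin (k := k) (f i) x := by
  rw [klin_sum, LinearMap.sum_apply]

/-- The identity map `Q → ActMod Q.act`. -/
def Bimod.toMod (Q : Bimod k R) : Q.carrier ≃+ ActMod Q.act := AddEquiv.refl _

lemma Bimod.toMod_left (Q : Bimod k R) (r : R) (q : Q.carrier) :
    Q.toMod (Q.left r q) = (r ⊗ₜ[k] (1 : Rᵐᵒᵖ)) • Q.toMod q := by
  change _ = Q.act (r ⊗ₜ 1) q
  simp [act]
  rfl

lemma Bimod.toMod_right (Q : Bimod k R) (s : Rᵐᵒᵖ) (q : Q.carrier) :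
    Q.toMod (Q.right s q) = ((1 : R) ⊗ₜ[k] s) • Q.toMod q := by
  change _ = Q.act (1 ⊗ₜ s) q
  simp [act]
  rfl

lemma Bimod.toMod_smul (Q : Bimod k R) (c : k) (q : Q.carrier) :
    Q.toMod (c • q) = algebraMap k (R ⊗[k] Rᵐᵒᵖ) c • Q.toMod q := by
  change _ = Q.act (algebraMap k _ c) q
  rw [AlgHom.commutes]
  rfl

variable (k R) in
/-- The identification of `R ⊗ Rᵒᵖ` with the bimodule `R ⊗ R`. -/
def outerEquiv : R ⊗[k] Rᵐᵒᵖ ≃ₗ[k] (Bimod.outer k R).carrier :=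
  (MulOpposite.opLinearEquiv k (M := R)).symm.lTensor R

lemma outerEquiv_left (r : R) (t : R ⊗[k] Rᵐᵒᵖ) :
    outerEquiv k R ((r ⊗ₜ[k] (1 : Rᵐᵒᵖ)) * t) = (Bimod.outer k R).left r (outerEquiv k R t) := by
  induction t using TensorProduct.induction_on with
  | zero => simp
  | add t t' h h' => simp only [mul_add, map_add, h, h']
  | tmul a b => simp [outerEquiv, Bimod.outer]; rfl

lemma outerEquiv_right (s : Rᵐᵒᵖ) (t : R ⊗[k] Rᵐᵒᵖ) :
    outerEquiv k R (((1 : R) ⊗ₜ[k] s) * t) = (Bimod.outer k R).right s (outerEquiv k R t) := by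
  induction t using TensorProduct.induction_on with
  | zero => simp
  | add t t' h h' => simp only [mul_add, map_add, h, h']
  | tmul a b => simp [outerEquiv, Bimod.outer]; rfl

/-- Tensoring with a projective bimodule belongs to the additive closure of tensoring with
`R ⊗ R`. -/
lemma Bimod.IsProjective.addClosure {Q : Bimod k R} (hQ : Q.IsProjective) :
    AddClosure (fun F => F = (Bimod.outer k R).tensFunctor) Q.tensFunctor := by
  have : Module.Finite (R ⊗[k] Rᵐᵒᵖ) (ActMod Q.act) := actMod_finite _
  have : Module.Projective (R ⊗[k] Rᵐᵒᵖ) (ActMod Q.act) := hQ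
  obtain ⟨n, f, g, -, -, h⟩ :=
    Module.Finite.exists_comp_eq_id_of_projective (R ⊗[k] Rᵐᵒᵖ) (ActMod Q.act)
  let a (j : Fin n) : Q.carrier →ₗ[k] (Bimod.outer k R).carrier :=
    { toFun := fun q => outerEquiv k R (g (Q.toMod q) j)
      map_add' := fun q q' => by simp
      map_smul' := fun c q => by
        rw [Q.toMod_smul, map_smul, algebraMap_smul, Pi.smul_apply, map_smul, RingHom.id_apply] }
  have hs (j : Fin n) (e t : R ⊗[k] Rᵐᵒᵖ) : f (Pi.single j (e * t)) = e • f (Pi.single j t) := by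
    rw [← map_smul]
    exact congrArg f ((LinearMap.single (R ⊗[k] Rᵐᵒᵖ) (fun _ : Fin n => R ⊗[k] Rᵐᵒᵖ) j).map_smul e t)
  let b (j : Fin n) : (Bimod.outer k R).carrier →ₗ[k] Q.carrier :=
    { toFun := fun t => Q.toMod.symm (f (Pi.single j ((outerEquiv k R).symm t)))
      map_add' := fun t t' => by simp [Pi.single_add]
      map_smul' := fun c t => by
        apply Q.toMod.injective
        rw [RingHom.id_apply, Q.toMod_smul]
        simp only [AddEquiv.apply_symm_apply]
        rw [← hs, map_smul]
        exact congrArg (fun e => f (Pi.single j e))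
          (Algebra.smul_def c ((outerEquiv k R).symm t)) }
  have ha (j q) : a j q = outerEquiv k R (g (Q.toMod q) j) := rfl
  have hb (j t) : b j t = Q.toMod.symm (f (Pi.single j ((outerEquiv k R).symm t))) := rfl
  refine .of_fintype (ι := Fin n) (fun _ => (Bimod.outer k R).tensFunctor)
    (fun j => tensNat (a j) (fun r q => ?_) (fun s q => ?_))
    (fun j => tensNat (b j) (fun r t => ?_) (fun s t => ?_)) (fun _ => rfl) ?_
  · rw [ha, ha, Q.toMod_left, map_smul, ← outerEquiv_left]
    rfl
  · rw [ha, ha, Q.toMod_right, map_smul, ← outerEquiv_right]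
    rfl
  · obtain ⟨t, rfl⟩ := (outerEquiv k R).surjective t
    apply Q.toMod.injective
    rw [hb, hb, Q.toMod_left, ← outerEquiv_left]
    simp only [AddEquiv.apply_symm_apply, LinearEquiv.symm_apply_apply]
    rw [hs]
  · obtain ⟨t, rfl⟩ := (outerEquiv k R).surjective t
    apply Q.toMod.injective
    rw [hb, hb, Q.toMod_right, ← outerEquiv_right]
    simp only [AddEquiv.apply_symm_apply, LinearEquiv.symm_apply_apply]
    rw [hs]
  · have key : ∑ j, b j ∘ₗ a j = LinearMap.id := by
      ext q
      apply Q.toMod.injective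
      simp only [LinearMap.sum_apply, LinearMap.comp_apply, map_sum, ha, hb,
        LinearEquiv.symm_apply_apply, AddEquiv.apply_symm_apply, LinearMap.id_apply]
      rw [← map_sum, Finset.univ_sum_single]
      exact LinearMap.congr_fun h (Q.toMod q)
    ext X : 2
    rw [NatTrans.app_sum]
    apply actHom_ext (k := k)
    apply Q.tens_hom_ext
    intro q x
    have : Q.tmulₗ X (∑ j, b j (a j q)) x = Q.tmul q x := by
      have := LinearMap.congr_fun key q
      simp only [LinearMap.sum_apply, LinearMap.comp_apply, LinearMap.id_apply] at this
      rw [this]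
      rfl
    rw [map_sum, LinearMap.sum_apply] at this
    refine Eq.trans ?_ (congrArg (actEquiv (Q.tensAct X)) this)
    rw [map_sum]
    exact klin_sum_apply (k := k) (X := Q.tensFunctor.obj X) (Y := Q.tensFunctor.obj X) _
      (actEquiv (Q.tensAct X) (Q.tmul q x))

end Nat
end FinRep
end

noncomputable section
namespace FinRep
open Module

/-! ### Compositions of extension functors -/

section Comp

attribute [local instance] Bimod.finite_of_fg

variable {k : Type u} [Field k] {R : Type u} [Ring R] [Algebra k R] [FiniteDimensional k R]
variable {V V' W : Type u} [AddCommGroup V] [Module k V] [FiniteDimensional k V]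
  [AddCommGroup V'] [Module k V'] [FiniteDimensional k V']
  [AddCommGroup W] [Module k W] [FiniteDimensional k W]

lemma extAct_tmul {δ : R →ₐ[k] Module.End k V ⊗[k] R} {r s : R} {φ : Module.End k V}
    (h : δ r = φ ⊗ₜ s) (X : FGModuleCat.{u} R) (v : V) (x : X) :
    extAct δ X r (v ⊗ₜ x) = φ v ⊗ₜ (s • x) := by
  simp [extAct, h, endTensorEndAlgHom_apply]

/-- The identification of `V ⊗ (V' ⊗ X)` with `(V ⊗ V') ⊗ X`. -/
def compEquiv (V : Type u) [AddCommGroup V] [Module k V] (δ' : R →ₐ[k] Module.End k V' ⊗[k] R)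
    (X : FGModuleCat.{u} R) :
    V ⊗[k] (ofAct (extAct δ' X) : FGModuleCat.{u} R) ≃ₗ[k] (V ⊗[k] V') ⊗[k] X :=
  (actEquiv (extAct δ' X)).symm.lTensor V ≪≫ₗ (TensorProduct.assoc k V V' X).symm

@[simp] lemma compEquiv_tmul (δ' : R →ₐ[k] Module.End k V' ⊗[k] R) (X : FGModuleCat.{u} R) (v : V)
    (v' : V') (x : X) :
    compEquiv V δ' X (v ⊗ₜ actEquiv (extAct δ' X) (v' ⊗ₜ x)) = (v ⊗ₜ v') ⊗ₜ x := rfl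

@[simp] lemma compEquiv_symm_tmul (δ' : R →ₐ[k] Module.End k V' ⊗[k] R) (X : FGModuleCat.{u} R) (v : V)
    (v' : V') (x : X) :
    (compEquiv V δ' X).symm ((v ⊗ₜ v') ⊗ₜ x) = v ⊗ₜ actEquiv (extAct δ' X) (v' ⊗ₜ x) := rfl

lemma comp_ext {δ' : R →ₐ[k] Module.End k V' ⊗[k] R} {X : FGModuleCat.{u} R} {N : Type*}
    [AddCommGroup N] [Module k N]
    {f g : V ⊗[k] (ofAct (extAct δ' X) : FGModuleCat.{u} R) →ₗ[k] N}
    (h : ∀ v v' x, f (v ⊗ₜ actEquiv (extAct δ' X) (v' ⊗ₜ x)) =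
      g (v ⊗ₜ actEquiv (extAct δ' X) (v' ⊗ₜ x))) : f = g := by
  have : f ∘ₗ (compEquiv V δ' X).symm.toLinearMap = g ∘ₗ (compEquiv V δ' X).symm.toLinearMap := by
    ext v v' x
    exact h v v' x
  ext1
  ext v y
  obtain ⟨t, ht⟩ := (compEquiv V δ' X).symm.surjective (v ⊗ₜ y)
  have := LinearMap.congr_fun this t
  simp only [LinearMap.comp_apply, LinearEquiv.coe_coe, ht] at this
  exact this

variable (δ : R →ₐ[k] Module.End k V ⊗[k] R) (δ' : R →ₐ[k] Module.End k V' ⊗[k] R)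
  (δ'' : R →ₐ[k] Module.End k W ⊗[k] R)

/-- A natural transformation from a composition of extension functors. -/
def compHom (f : V ⊗[k] V' →ₗ[k] W)
    (h : ∀ (X : FGModuleCat.{u} R) r t, f.rTensor X (compEquiv V δ' X (extAct δ (ofAct (extAct δ' X)) r t)) =
      extAct δ'' X r (f.rTensor X (compEquiv V δ' X t))) :
    extFunctor δ' ⋙ extFunctor δ ⟶ extFunctor δ'' where
  app X := actHom _ _ (f.rTensor X ∘ₗ (compEquiv V δ' X).toLinearMap) (h X)
  naturality X Y g := actHom_ext (comp_ext fun v v' x => rfl)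

/-- A natural transformation to a composition of extension functors. -/
def compInv (f : W →ₗ[k] V ⊗[k] V')
    (h : ∀ (X : FGModuleCat.{u} R) r t, (compEquiv V δ' X).symm (f.rTensor X (extAct δ'' X r t)) =
      extAct δ (ofAct (extAct δ' X)) r ((compEquiv V δ' X).symm (f.rTensor X t))) :
    extFunctor δ'' ⟶ extFunctor δ' ⋙ extFunctor δ where
  app X := actHom _ _ ((compEquiv V δ' X).symm.toLinearMap ∘ₗ f.rTensor X) (h X)
  naturality X Y g := actHom_ext (TensorProduct.ext' fun w x => by
    have key : (compEquiv V δ' Y).symm.toLinearMap ∘ₗ (klin g).lTensor (V ⊗[k] V') =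
        (klin (X := ofAct (extAct δ' X)) (Y := ofAct (extAct δ' Y))
          ((extFunctor δ').map g)).lTensor V ∘ₗ (compEquiv V δ' X).symm.toLinearMap := by
      ext v v' x
      rfl
    exact congrArg (actEquiv (extAct δ (ofAct (extAct δ' Y))))
      (LinearMap.congr_fun key (f w ⊗ₜ x)))

/-- A natural isomorphism from a composition of extension functors. -/
def compIso (f : V ⊗[k] V' ≃ₗ[k] W)
    (h : ∀ (X : FGModuleCat.{u} R) r t, f.toLinearMap.rTensor X (compEquiv V δ' X (extAct δ (ofAct (extAct δ' X)) r t)) =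
      extAct δ'' X r (f.toLinearMap.rTensor X (compEquiv V δ' X t))) :
    extFunctor δ' ⋙ extFunctor δ ≅ extFunctor δ'' :=
  NatIso.ofComponents (fun X => actIso _ _ (compEquiv V δ' X ≪≫ₗ f.rTensor X) (h X))
    (fun g => (compHom δ δ' δ'' f.toLinearMap h).naturality g)

end Comp
end FinRep
end

noncomputable section
namespace FinRep

/-! ### Good endofunctors -/

section Good

attribute [local instance] Bimod.finite_of_fg

variable (k : Type u) [Field k] (A B : Type u) [Ring A] [Ring B] [Algebra k A] [Algebra k B]
  [FiniteDimensional k A] [FiniteDimensional k B]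

/-- Tensoring with the left component projective bimodule `(A ⊗ A) ⊗ B`. -/
def leftFun : FGModuleCat.{u} (A ⊗[k] B) ⥤ FGModuleCat.{u} (A ⊗[k] B) :=
  ((Bimod.outer k A).box (Bimod.regular k B)).tensFunctor

/-- Tensoring with the right component projective bimodule `A ⊗ (B ⊗ B)`. -/
def rightFun : FGModuleCat.{u} (A ⊗[k] B) ⥤ FGModuleCat.{u} (A ⊗[k] B) :=
  ((Bimod.regular k A).box (Bimod.outer k B)).tensFunctor

/-- The functors of tensoring with projective bimodules over `A ⊗ B`. -/
def IsProjectiveFun : ObjectProperty (FGModuleCat.{u} (A ⊗[k] B) ⥤ FGModuleCat.{u} (A ⊗[k] B)) :=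
  fun F => ∃ Q : Bimod k (A ⊗[k] B), Q.IsProjective ∧ Nonempty (F ≅ Q.tensFunctor)

/-- Good endofunctors of the category of finite dimensional modules over `A ⊗ B`: the additive
closure of the identity functor, of tensoring with projective bimodules, of tensoring with the left
component projective bimodule and of tensoring with the right component projective bimodule. -/
def IsGood : ObjectProperty (FGModuleCat.{u} (A ⊗[k] B) ⥤ FGModuleCat.{u} (A ⊗[k] B)) :=
  AddClosure fun F => F = 𝟭 _ ∨ IsProjectiveFun k A B F ∨ F = leftFun k A B ∨ F = rightFun k A B

/-- The action defining the left component projective functor. -/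
def deltaL : A ⊗[k] B →ₐ[k] Module.End k A ⊗[k] (A ⊗[k] B) :=
  Algebra.TensorProduct.map (Algebra.lmul k A) Algebra.TensorProduct.includeRight

/-- The action defining the right component projective functor. -/
def deltaR : A ⊗[k] B →ₐ[k] Module.End k B ⊗[k] (A ⊗[k] B) :=
  (Algebra.TensorProduct.map (Algebra.lmul k B) Algebra.TensorProduct.includeLeft).comp
    (Algebra.TensorProduct.comm k A B).toAlgHom

/-- The action defining the free functor. -/
def deltaF : A ⊗[k] B →ₐ[k] Module.End k (A ⊗[k] B) ⊗[k] (A ⊗[k] B) :=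
  Algebra.TensorProduct.includeLeft.comp (Algebra.lmul k (A ⊗[k] B))

lemma deltaL_tmul (a : A) (b : B) :
    deltaL k A B (a ⊗ₜ b) = Algebra.lmul k A a ⊗ₜ[k] ((1 : A) ⊗ₜ[k] b) := rfl

lemma deltaR_tmul (a : A) (b : B) :
    deltaR k A B (a ⊗ₜ b) = Algebra.lmul k B b ⊗ₜ[k] (a ⊗ₜ[k] (1 : B)) := rfl

lemma deltaF_apply (r : A ⊗[k] B) :
    deltaF k A B r = Algebra.lmul k (A ⊗[k] B) r ⊗ₜ[k] (1 : A ⊗[k] B) := rfl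

variable {k A B} in
lemma box_ind {N : Type*} [AddCommGroup N] [Module k N] {f g : A ⊗[k] B →ₗ[k] N}
    (h : ∀ a b, f (a ⊗ₜ b) = g (a ⊗ₜ b)) (r : A ⊗[k] B) : f r = g r :=
  LinearMap.congr_fun (TensorProduct.ext' h) r

/-- The right module underlying the left component projective bimodule. -/
def thetaL : A ⊗[k] (A ⊗[k] B) ≃ₗ[k] ((Bimod.outer k A).box (Bimod.regular k B)).carrier :=
  (TensorProduct.assoc k A A B).symm

lemma thetaL_right (v : A) (r s : A ⊗[k] B) : thetaL k A B (v ⊗ₜ (r * s)) =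
    ((Bimod.outer k A).box (Bimod.regular k B)).right (MulOpposite.op s) (thetaL k A B (v ⊗ₜ r)) := by
  induction s using TensorProduct.induction_on with
  | zero => simp
  | add s s' h h' =>
    simp only [mul_add, TensorProduct.tmul_add, map_add, MulOpposite.op_add, LinearMap.add_apply,
      h, h']
  | tmul a' b' =>
    induction r using TensorProduct.induction_on with
    | zero => simp
    | add s s' h h' => simp only [add_mul, TensorProduct.tmul_add, map_add, h, h']
    | tmul a b =>
      rw [Algebra.TensorProduct.tmul_mul_tmul]
      exact (Bimod.box_right_tmul (Bimod.outer k A) (Bimod.regular k B) a' b' (v ⊗ₜ a) b).symm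

lemma thetaL_left (r : A ⊗[k] B) (v : A) (s : A ⊗[k] B) :
    ((Bimod.outer k A).box (Bimod.regular k B)).left r (thetaL k A B (v ⊗ₜ s)) =
      thetaL k A B (Module.endTensorEndAlgHom (R := k) (S := k) (A := k)
        (Algebra.TensorProduct.map (AlgHom.id k _) (Algebra.lsmul k k (A ⊗[k] B)) (deltaL k A B r))
          (v ⊗ₜ s)) := by
  induction r using TensorProduct.induction_on with
  | zero => simp
  | add s s' h h' => simp only [map_add, LinearMap.add_apply, h, h']
  | tmul a' b' =>
    induction s using TensorProduct.induction_on with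
    | zero => simp
    | add s s' h h' => simp only [TensorProduct.tmul_add, map_add, h, h']
    | tmul a b =>
      rw [deltaL_tmul]
      simp only [Algebra.TensorProduct.map_tmul, Module.endTensorEndAlgHom_apply,
        TensorProduct.AlgebraTensorModule.map_tmul, AlgHom.coe_id, id_eq, Algebra.lsmul_coe,
        smul_eq_mul, Algebra.TensorProduct.tmul_mul_tmul, one_mul]
      rfl

/-- The isomorphism between the extension functor and tensoring with the left component
projective bimodule. -/
def leftIso : extFunctor (deltaL k A B) ≅ leftFun k A B :=
  tensIsoExt _ (deltaL k A B) (thetaL k A B) (thetaL_right k A B) (thetaL_left k A B)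

/-- The right module underlying the right component projective bimodule. -/
def thetaR : B ⊗[k] (A ⊗[k] B) ≃ₗ[k] ((Bimod.regular k A).box (Bimod.outer k B)).carrier :=
  TensorProduct.leftComm k B A B

lemma thetaR_right (v : B) (r s : A ⊗[k] B) : thetaR k A B (v ⊗ₜ (r * s)) =
    ((Bimod.regular k A).box (Bimod.outer k B)).right (MulOpposite.op s) (thetaR k A B (v ⊗ₜ r)) := by
  induction s using TensorProduct.induction_on with
  | zero => simp
  | add s s' h h' =>
    simp only [mul_add, TensorProduct.tmul_add, map_add, MulOpposite.op_add, LinearMap.add_apply,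
      h, h']
  | tmul a' b' =>
    induction r using TensorProduct.induction_on with
    | zero => simp
    | add s s' h h' => simp only [add_mul, TensorProduct.tmul_add, map_add, h, h']
    | tmul a b =>
      rw [Algebra.TensorProduct.tmul_mul_tmul]
      exact (Bimod.box_right_tmul (Bimod.regular k A) (Bimod.outer k B) a' b' a (v ⊗ₜ b)).symm

lemma thetaR_left (r : A ⊗[k] B) (v : B) (s : A ⊗[k] B) :
    ((Bimod.regular k A).box (Bimod.outer k B)).left r (thetaR k A B (v ⊗ₜ s)) =
      thetaR k A B (Module.endTensorEndAlgHom (R := k) (S := k) (A := k)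
        (Algebra.TensorProduct.map (AlgHom.id k _) (Algebra.lsmul k k (A ⊗[k] B)) (deltaR k A B r))
          (v ⊗ₜ s)) := by
  induction r using TensorProduct.induction_on with
  | zero => simp
  | add s s' h h' => simp only [map_add, LinearMap.add_apply, h, h']
  | tmul a' b' =>
    induction s using TensorProduct.induction_on with
    | zero => simp
    | add s s' h h' => simp only [TensorProduct.tmul_add, map_add, h, h']
    | tmul a b =>
      rw [deltaR_tmul]
      simp only [Algebra.TensorProduct.map_tmul, Module.endTensorEndAlgHom_apply,
        TensorProduct.AlgebraTensorModule.map_tmul, AlgHom.coe_id, id_eq, Algebra.lsmul_coe,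
        smul_eq_mul, Algebra.TensorProduct.tmul_mul_tmul, one_mul]
      rfl

/-- The isomorphism between the extension functor and tensoring with the right component
projective bimodule. -/
def rightIso : extFunctor (deltaR k A B) ≅ rightFun k A B :=
  tensIsoExt _ (deltaR k A B) (thetaR k A B) (thetaR_right k A B) (thetaR_left k A B)

/-- The isomorphism between the free functor and tensoring with `E ⊗ E`. -/
def freeIso : extFunctor (deltaF k A B) ≅ (Bimod.outer k (A ⊗[k] B)).tensFunctor :=
  tensIsoExt _ (deltaF k A B) (LinearEquiv.refl k _)
    (fun v r s => rfl)
    (fun r v s => by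
      rw [deltaF_apply]
      simp [Module.endTensorEndAlgHom_apply]
      rfl)

end Good
end FinRep
end

noncomputable section
namespace FinRep

/-! ### Good endofunctors are closed under composition -/

section GoodComp

attribute [local instance] Bimod.finite_of_fg

variable {k : Type u} [Field k] {A B : Type u} [Ring A] [Ring B] [Algebra k A] [Algebra k B]
  [FiniteDimensional k A] [FiniteDimensional k B]

section

variable {V V' W : Type u} [AddCommGroup V] [Module k V] [FiniteDimensional k V]
  [AddCommGroup V'] [Module k V'] [FiniteDimensional k V']
  [AddCommGroup W] [Module k W] [FiniteDimensional k W]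
  {δ : A ⊗[k] B →ₐ[k] Module.End k V ⊗[k] (A ⊗[k] B)}
  {δ' : A ⊗[k] B →ₐ[k] Module.End k V' ⊗[k] (A ⊗[k] B)}
  {δ'' : A ⊗[k] B →ₐ[k] Module.End k W ⊗[k] (A ⊗[k] B)}

lemma comp_equivariant {X : FGModuleCat.{u} (A ⊗[k] B)} (f : V ⊗[k] V' →ₗ[k] W)
    (h : ∀ a b v v' x, f.rTensor X (compEquiv V δ' X (extAct δ (ofAct (extAct δ' X)) (a ⊗ₜ b)
      (v ⊗ₜ actEquiv (extAct δ' X) (v' ⊗ₜ x)))) = extAct δ'' X (a ⊗ₜ b) (f (v ⊗ₜ v') ⊗ₜ x))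
    (r : A ⊗[k] B) (t : V ⊗[k] (ofAct (extAct δ' X) : FGModuleCat.{u} (A ⊗[k] B))) :
    f.rTensor X (compEquiv V δ' X (extAct δ (ofAct (extAct δ' X)) r t)) =
      extAct δ'' X r (f.rTensor X (compEquiv V δ' X t)) := by
  induction r using TensorProduct.induction_on with
  | zero => simp
  | add s s' h h' => simp only [map_add, LinearMap.add_apply, h, h']
  | tmul a b =>
    exact LinearMap.congr_fun (comp_ext
      (f := f.rTensor X ∘ₗ (compEquiv V δ' X).toLinearMap ∘ₗ
        extAct δ (ofAct (extAct δ' X)) (a ⊗ₜ b))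
      (g := extAct δ'' X (a ⊗ₜ b) ∘ₗ f.rTensor X ∘ₗ (compEquiv V δ' X).toLinearMap)
      (fun v v' x => h a b v v' x)) t

lemma comp_equivariant_inv {X : FGModuleCat.{u} (A ⊗[k] B)} (f : W →ₗ[k] V ⊗[k] V')
    (h : ∀ a b w x, (compEquiv V δ' X).symm (f.rTensor X (extAct δ'' X (a ⊗ₜ b) (w ⊗ₜ x))) =
      extAct δ (ofAct (extAct δ' X)) (a ⊗ₜ b) ((compEquiv V δ' X).symm (f w ⊗ₜ x)))
    (r : A ⊗[k] B) (t : W ⊗[k] X) :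
    (compEquiv V δ' X).symm (f.rTensor X (extAct δ'' X r t)) =
      extAct δ (ofAct (extAct δ' X)) r ((compEquiv V δ' X).symm (f.rTensor X t)) := by
  induction r using TensorProduct.induction_on with
  | zero => simp
  | add s s' h h' => simp only [map_add, LinearMap.add_apply, h, h']
  | tmul a b =>
    exact LinearMap.congr_fun (TensorProduct.ext'
      (g := (compEquiv V δ' X).symm.toLinearMap ∘ₗ f.rTensor X ∘ₗ extAct δ'' X (a ⊗ₜ b))
      (h := extAct δ (ofAct (extAct δ' X)) (a ⊗ₜ b) ∘ₗ (compEquiv V δ' X).symm.toLinearMap ∘ₗ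
        f.rTensor X) (fun w x => h a b w x)) t

end

lemma extAct_deltaL (X : FGModuleCat.{u} (A ⊗[k] B)) (a a' : A) (b : B) (x : X) :
    extAct (deltaL k A B) X (a ⊗ₜ b) (a' ⊗ₜ x) = (a * a') ⊗ₜ (((1 : A) ⊗ₜ[k] b) • x) :=
  extAct_tmul (deltaL_tmul k A B a b) X a' x

lemma extAct_deltaR (X : FGModuleCat.{u} (A ⊗[k] B)) (a : A) (b b' : B) (x : X) :
    extAct (deltaR k A B) X (a ⊗ₜ b) (b' ⊗ₜ x) = (b * b') ⊗ₜ ((a ⊗ₜ[k] (1 : B)) • x) :=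
  extAct_tmul (deltaR_tmul k A B a b) X b' x

lemma extAct_deltaF (X : FGModuleCat.{u} (A ⊗[k] B)) (r s : A ⊗[k] B) (x : X) :
    extAct (deltaF k A B) X r (s ⊗ₜ x) = (r * s) ⊗ₜ x := by
  rw [extAct_tmul (deltaF_apply k A B r) X s x, one_smul]
  rfl

variable (k A B)

/-- Composing the right with the left component projective functor gives the free functor. -/
def leftRightIso : extFunctor (deltaR k A B) ⋙ extFunctor (deltaL k A B) ≅
    extFunctor (deltaF k A B) :=
  compIso _ _ _ (LinearEquiv.refl k (A ⊗[k] B)) (fun X => comp_equivariant _ (fun a b v v' x => by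
    rw [extAct_deltaL, smul_actEquiv, extAct_deltaR, compEquiv_tmul]
    simp only [LinearMap.rTensor_tmul, LinearEquiv.coe_coe, LinearEquiv.refl_apply]
    rw [extAct_deltaF, Algebra.TensorProduct.tmul_mul_tmul, ← Algebra.TensorProduct.one_def,
      one_smul]))

/-- Composing the left with the right component projective functor gives the free functor. -/
def rightLeftIso : extFunctor (deltaL k A B) ⋙ extFunctor (deltaR k A B) ≅
    extFunctor (deltaF k A B) :=
  compIso _ _ _ (TensorProduct.comm k B A) (fun X => comp_equivariant _ (fun a b v v' x => by
    rw [extAct_deltaR, smul_actEquiv, extAct_deltaL, compEquiv_tmul]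
    simp only [LinearMap.rTensor_tmul, LinearEquiv.coe_coe, TensorProduct.comm_tmul]
    rw [extAct_deltaF, Algebra.TensorProduct.tmul_mul_tmul, ← Algebra.TensorProduct.one_def,
      one_smul]))

lemma leftLeft : AddClosure (fun F => F = extFunctor (deltaL k A B))
    (extFunctor (deltaL k A B) ⋙ extFunctor (deltaL k A B)) := by
  let bs := Module.finBasis k A
  let p (i) : A ⊗[k] A →ₗ[k] A := (TensorProduct.rid k A).toLinearMap ∘ₗ (bs.coord i).lTensor A
  let q (i) : A →ₗ[k] A ⊗[k] A := (TensorProduct.mk k A A).flip (bs i)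
  have hp (i) (a a' : A) : p i (a ⊗ₜ a') = bs.coord i a' • a := by simp [p]
  have hq (i) (a : A) : q i a = a ⊗ₜ bs i := rfl
  refine .of_fintype (fun _ => extFunctor (deltaL k A B))
    (fun i => compHom _ _ _ (p i) (fun X => comp_equivariant _ (fun a b v v' x => ?_)))
    (fun i => compInv _ _ _ (q i) (fun X => comp_equivariant_inv _ (fun a b v x => ?_)))
    (fun _ => rfl) ?_
  · rw [extAct_deltaL, smul_actEquiv, extAct_deltaL, compEquiv_tmul, LinearMap.rTensor_tmul, hp, hp,
      one_mul, extAct_deltaL, mul_smul_comm]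
  · rw [extAct_deltaL, LinearMap.rTensor_tmul, hq, hq, compEquiv_symm_tmul, compEquiv_symm_tmul,
      extAct_deltaL, smul_actEquiv, extAct_deltaL, one_mul]
  · ext X : 2
    rw [NatTrans.app_sum]
    apply actHom_ext (k := k)
    apply comp_ext
    intro v v' x
    refine (klin_sum_apply (k := k)
      (X := (extFunctor (deltaL k A B)).obj ((extFunctor (deltaL k A B)).obj X))
      (Y := (extFunctor (deltaL k A B)).obj ((extFunctor (deltaL k A B)).obj X)) _ _).trans ?_
    let G' : A →ₗ[k] A →ₗ[k] (extFunctor (deltaL k A B)).obj ((extFunctor (deltaL k A B)).obj X) :=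
      (TensorProduct.mk k A (ofAct (extAct (deltaL k A B) X))).compr₂
        (actEquiv (extAct (deltaL k A B) (ofAct (extAct (deltaL k A B) X)))).toLinearMap |>.compl₂
        ((actEquiv (extAct (deltaL k A B) X)).toLinearMap ∘ₗ (TensorProduct.mk k A X).flip x)
    let G := G' v
    have hG : ∑ i, bs.coord i v' • G (bs i) = G v' := by
      simp only [← map_smul, ← map_sum, Module.Basis.coord_apply]
      rw [bs.sum_repr]
    refine Eq.trans ?_ hG
    refine Finset.sum_congr rfl fun i _ => ?_
    change G' (p i (v ⊗ₜ v')) (bs i) = _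
    rw [hp]
    change G' _ _ = bs.coord i v' • G' v (bs i)
    rw [map_smul]
    rfl

lemma rightRight : AddClosure (fun F => F = extFunctor (deltaR k A B))
    (extFunctor (deltaR k A B) ⋙ extFunctor (deltaR k A B)) := by
  let bs := Module.finBasis k B
  let p (i) : B ⊗[k] B →ₗ[k] B := (TensorProduct.rid k B).toLinearMap ∘ₗ (bs.coord i).lTensor B
  let q (i) : B →ₗ[k] B ⊗[k] B := (TensorProduct.mk k B B).flip (bs i)
  have hp (i) (a a' : B) : p i (a ⊗ₜ a') = bs.coord i a' • a := by simp [p]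
  have hq (i) (a : B) : q i a = a ⊗ₜ bs i := rfl
  refine .of_fintype (fun _ => extFunctor (deltaR k A B))
    (fun i => compHom _ _ _ (p i) (fun X => comp_equivariant _ (fun a b v v' x => ?_)))
    (fun i => compInv _ _ _ (q i) (fun X => comp_equivariant_inv _ (fun a b v x => ?_)))
    (fun _ => rfl) ?_
  · rw [extAct_deltaR, smul_actEquiv, extAct_deltaR, compEquiv_tmul, LinearMap.rTensor_tmul, hp, hp,
      one_mul, extAct_deltaR, mul_smul_comm]
  · rw [extAct_deltaR, LinearMap.rTensor_tmul, hq, hq, compEquiv_symm_tmul, compEquiv_symm_tmul,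
      extAct_deltaR, smul_actEquiv, extAct_deltaR, one_mul]
  · ext X : 2
    rw [NatTrans.app_sum]
    apply actHom_ext (k := k)
    apply comp_ext
    intro v v' x
    refine (klin_sum_apply (k := k)
      (X := (extFunctor (deltaR k A B)).obj ((extFunctor (deltaR k A B)).obj X))
      (Y := (extFunctor (deltaR k A B)).obj ((extFunctor (deltaR k A B)).obj X)) _ _).trans ?_
    let G' : B →ₗ[k] B →ₗ[k] (extFunctor (deltaR k A B)).obj ((extFunctor (deltaR k A B)).obj X) :=
      (TensorProduct.mk k B (ofAct (extAct (deltaR k A B) X))).compr₂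
        (actEquiv (extAct (deltaR k A B) (ofAct (extAct (deltaR k A B) X)))).toLinearMap |>.compl₂
        ((actEquiv (extAct (deltaR k A B) X)).toLinearMap ∘ₗ (TensorProduct.mk k B X).flip x)
    let G := G' v
    have hG : ∑ i, bs.coord i v' • G (bs i) = G v' := by
      simp only [← map_smul, ← map_sum, Module.Basis.coord_apply]
      rw [bs.sum_repr]
    refine Eq.trans ?_ hG
    refine Finset.sum_congr rfl fun i _ => ?_
    change G' (p i (v ⊗ₜ v')) (bs i) = _
    rw [hp]
    change G' _ _ = bs.coord i v' • G' v (bs i)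
    rw [map_smul]
    rfl

end GoodComp
end FinRep
end

noncomputable section
namespace FinRep

section GoodMonoidal

attribute [local instance] Bimod.finite_of_fg

section

variable {k : Type u} [Field k] {R : Type u} [Ring R] [Algebra k R] [FiniteDimensional k R]

instance {V : Type u} [AddCommGroup V] [Module k V] [FiniteDimensional k V]
    (δ : R →ₐ[k] Module.End k V ⊗[k] R) : (extFunctor δ).Additive where
  map_add {X Y f g} := actHom_ext (TensorProduct.ext' fun v x => by
    change actEquiv (extAct δ Y) (v ⊗ₜ (f.hom.hom x + g.hom.hom x)) = _
    rw [TensorProduct.tmul_add, map_add]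
    rfl)

lemma outer_projective : (Bimod.outer k R).IsProjective := by
  have key (s t : R ⊗[k] Rᵐᵒᵖ) : outerEquiv k R (s * t) =
      (Bimod.outer k R).act s (outerEquiv k R t) := by
    induction s using TensorProduct.induction_on with
    | zero => simp
    | add s s' h h' => simp only [add_mul, map_add, LinearMap.add_apply, h, h']
    | tmul a b =>
      have : a ⊗ₜ[k] b = (a ⊗ₜ[k] (1 : Rᵐᵒᵖ)) * ((1 : R) ⊗ₜ[k] b) := by simp
      rw [this, mul_assoc, outerEquiv_left, outerEquiv_right, map_mul]
      simp [Bimod.act]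
  let e : R ⊗[k] Rᵐᵒᵖ ≃ₗ[R ⊗[k] Rᵐᵒᵖ] ActMod (Bimod.outer k R).act :=
    { (outerEquiv k R).toAddEquiv.trans (Bimod.toMod _) with
      map_smul' := key }
  exact Module.Projective.of_equiv e

end

variable (k : Type u) [Field k] (A B : Type u) [Ring A] [Ring B] [Algebra k A] [Algebra k B]
  [FiniteDimensional k A] [FiniteDimensional k B]

/-- The four basic functors. -/
def IsElementary : ObjectProperty (FGModuleCat.{u} (A ⊗[k] B) ⥤ FGModuleCat.{u} (A ⊗[k] B)) := fun F =>
  F = 𝟭 _ ∨ F = extFunctor (deltaF k A B) ∨ F = extFunctor (deltaL k A B) ∨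
    F = extFunctor (deltaR k A B)

variable {k A B}

lemma isGood_iff {F : FGModuleCat.{u} (A ⊗[k] B) ⥤ FGModuleCat.{u} (A ⊗[k] B)} :
    IsGood k A B F ↔ AddClosure (IsElementary k A B) F := by
  constructor
  · refine AddClosure.bind fun F hF => ?_
    rcases hF with rfl | ⟨Q, hQ, ⟨e⟩⟩ | rfl | rfl
    · exact .of_mem (Or.inl rfl)
    · refine .trans_iso e (hQ.addClosure.bind ?_)
      rintro _ rfl
      exact .of_iso (freeIso k A B).symm (Or.inr (Or.inl rfl))
    · exact .of_iso (leftIso k A B).symm (Or.inr (Or.inr (Or.inl rfl)))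
    · exact .of_iso (rightIso k A B).symm (Or.inr (Or.inr (Or.inr rfl)))
  · refine AddClosure.bind fun F hF => ?_
    rcases hF with rfl | rfl | rfl | rfl
    · exact .of_mem (Or.inl rfl)
    · exact .of_mem (Or.inr (Or.inl ⟨_, outer_projective, ⟨freeIso k A B⟩⟩))
    · exact .of_iso (leftIso k A B) (Or.inr (Or.inr (Or.inl rfl)))
    · exact .of_iso (rightIso k A B) (Or.inr (Or.inr (Or.inr rfl)))

lemma comp_left {F : FGModuleCat.{u} (A ⊗[k] B) ⥤ FGModuleCat.{u} (A ⊗[k] B)}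
    (hF : AddClosure (IsElementary k A B) F) :
    AddClosure (IsElementary k A B) (F ⋙ extFunctor (deltaL k A B)) := by
  refine hF.postcomp _ fun F hF => ?_
  rcases hF with rfl | rfl | rfl | rfl
  · exact .of_iso (Functor.leftUnitor _) (Or.inr (Or.inr (Or.inl rfl)))
  · refine .trans_iso (Functor.isoWhiskerRight (leftRightIso k A B).symm _ ≪≫
      Functor.associator _ _ _) ((leftLeft k A B).precomp _ ?_)
    rintro _ rfl
    exact .of_iso (leftRightIso k A B) (Or.inr (Or.inl rfl))
  · exact (leftLeft k A B).bind (fun G hG => .of_mem (Or.inr (Or.inr (Or.inl hG))))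
  · exact .of_iso (leftRightIso k A B) (Or.inr (Or.inl rfl))

lemma comp_right {F : FGModuleCat.{u} (A ⊗[k] B) ⥤ FGModuleCat.{u} (A ⊗[k] B)}
    (hF : AddClosure (IsElementary k A B) F) :
    AddClosure (IsElementary k A B) (F ⋙ extFunctor (deltaR k A B)) := by
  refine hF.postcomp _ fun F hF => ?_
  rcases hF with rfl | rfl | rfl | rfl
  · exact .of_iso (Functor.leftUnitor _) (Or.inr (Or.inr (Or.inr rfl)))
  · refine .trans_iso (Functor.isoWhiskerRight (rightLeftIso k A B).symm _ ≪≫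
      Functor.associator _ _ _) ((rightRight k A B).precomp _ ?_)
    rintro _ rfl
    exact .of_iso (rightLeftIso k A B) (Or.inr (Or.inl rfl))
  · exact .of_iso (rightLeftIso k A B) (Or.inr (Or.inl rfl))
  · exact (rightRight k A B).bind (fun G hG => .of_mem (Or.inr (Or.inr (Or.inr hG))))

/-- The composition of two good endofunctors is good. -/
lemma IsGood.comp {F G : FGModuleCat.{u} (A ⊗[k] B) ⥤ FGModuleCat.{u} (A ⊗[k] B)}
    (hF : IsGood k A B F) (hG : IsGood k A B G) : IsGood k A B (F ⋙ G) := by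
  rw [isGood_iff] at *
  refine hG.precomp F fun G hG => ?_
  rcases hG with rfl | rfl | rfl | rfl
  · exact .trans_iso (Functor.rightUnitor F) hF
  · exact .trans_iso (Functor.isoWhiskerLeft F (leftRightIso k A B).symm ≪≫
      (Functor.associator _ _ _).symm) (comp_left (comp_right hF))
  · exact comp_left hF
  · exact comp_right hF

lemma IsGood.id : IsGood k A B (𝟭 _) := .of_mem (Or.inl rfl)

lemma map_smul_of_iso {C : Type*} [Category* C] [Preadditive C] [Linear k C] {F G : C ⥤ C}
    (e : F ≅ G) (hG : ∀ {X Y : C} (c : k) (f : X ⟶ Y), G.map (c • f) = c • G.map f)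
    {X Y : C} (c : k) (f : X ⟶ Y) : F.map (c • f) = c • F.map f := by
  rw [← cancel_mono (e.hom.app Y)]
  simp [hG]

lemma map_add_of_iso {C : Type*} [Category* C] [Preadditive C] {F G : C ⥤ C}
    (e : F ≅ G) (hG : ∀ {X Y : C} (f g : X ⟶ Y), G.map (f + g) = G.map f + G.map g)
    {X Y : C} (f g : X ⟶ Y) : F.map (f + g) = F.map f + F.map g := by
  rw [← cancel_mono (e.hom.app Y)]
  simp [hG]

lemma IsGood.map_add {F : FGModuleCat.{u} (A ⊗[k] B) ⥤ FGModuleCat.{u} (A ⊗[k] B)}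
    (hF : IsGood k A B F) {X Y : FGModuleCat.{u} (A ⊗[k] B)} (f g : X ⟶ Y) :
    F.map (f + g) = F.map f + F.map g := by
  refine AddClosure.map_eq hF ?_ f g
  rintro F (rfl | ⟨Q, -, ⟨e⟩⟩ | rfl | rfl) X Y f g
  · rfl
  · exact map_add_of_iso e Q.tensFunctor_map_add f g
  · exact Bimod.tensFunctor_map_add _ f g
  · exact Bimod.tensFunctor_map_add _ f g

lemma IsGood.map_smul {F : FGModuleCat.{u} (A ⊗[k] B) ⥤ FGModuleCat.{u} (A ⊗[k] B)}
    (hF : IsGood k A B F) {X Y : FGModuleCat.{u} (A ⊗[k] B)} (c : k) (f : X ⟶ Y) :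
    F.map (c • f) = c • F.map f := by
  refine AddClosure.map_smul hF ?_ c f
  rintro F (rfl | ⟨Q, -, ⟨e⟩⟩ | rfl | rfl) X Y c f
  · rfl
  · exact map_smul_of_iso e Q.tensFunctor_map_smul c f
  · exact Bimod.tensFunctor_map_smul _ c f
  · exact Bimod.tensFunctor_map_smul _ c f

variable (k A B)

/-- The one-object `2`-category of good endofunctors: the objects of this monoidal category are the
good endofunctors, its morphisms are all natural transformations, and its tensor product is the
composition of functors. -/
abbrev GoodFun := (IsGood k A B).FullSubcategory

instance : MonoidalCategory (GoodFun k A B) where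
  tensorObj F G := ⟨G.obj ⋙ F.obj, G.property.comp F.property⟩
  whiskerLeft F _ _ α := ObjectProperty.homMk (Functor.whiskerRight α.hom F.obj)
  whiskerRight α G := ObjectProperty.homMk (Functor.whiskerLeft G.obj α.hom)
  tensorUnit := ⟨𝟭 _, IsGood.id⟩
  associator F G H := (IsGood k A B).isoMk (Functor.associator H.obj G.obj F.obj).symm
  leftUnitor F := (IsGood k A B).isoMk (Functor.rightUnitor F.obj)
  rightUnitor F := (IsGood k A B).isoMk (Functor.leftUnitor F.obj)

instance : MonoidalPreadditive (GoodFun k A B) where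
  whiskerLeft_add {F _ _} f g := by
    apply ObjectProperty.hom_ext
    ext X : 2
    exact F.property.map_add (f.hom.app X) (g.hom.app X)
  whiskerLeft_zero {F G H} := by
    apply ObjectProperty.hom_ext
    ext X : 2
    have := F.property.map_smul (0 : k) (0 : G.obj.obj X ⟶ H.obj.obj X)
    rw [zero_smul, zero_smul] at this
    exact this
  add_whiskerRight f g := rfl
  zero_whiskerRight := rfl

instance : MonoidalLinear k (GoodFun k A B) where
  whiskerLeft_smul F _ _ c f := by
    apply ObjectProperty.hom_ext
    ext X : 2
    exact F.property.map_smul c (f.hom.app X)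
  smul_whiskerRight c _ _ f _ := rfl

/-- The evaluation action of good endofunctors. -/
instance goodAction : MonoidalLeftAction (GoodFun k A B) (FGModuleCat.{u} (A ⊗[k] B)) where
  actionObj F X := F.obj.obj X
  actionHomLeft α X := α.hom.app X
  actionHomRight F _ _ f := F.obj.map f
  actionAssocIso F G X := Iso.refl _
  actionUnitIso X := Iso.refl _

/-- The defining `2`-representation of the `2`-category of good endofunctors. -/
def defining : TwoRep k (GoodFun k A B) where
  carrier := FGModuleCat.{u} (A ⊗[k] B)
  action_add F _ _ f g := F.property.map_add f g
  action_smul F _ _ c f := F.property.map_smul c f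
  add_action α β X := rfl
  smul_action c α X := rfl

end GoodMonoidal
end FinRep
end

noncomputable section
namespace FinRep

namespace TwoRep

variable {k : Type w} [Field k] {D : Type u} [Category.{v} D] [Preadditive D] [Linear k D]
  [MonoidalCategory D]

/-- For invariant full subcategories `P ⊆ Q`, the ideal of the sub-`2`-representation on `Q`
generated by the identity morphisms of the objects in `P`. -/
def relIdeal (M : TwoRep.{w, v, u, v₁, u₁} k D) {P Q : ObjectProperty M.carrier}
    (hP : M.IsInvariant P) (hQ : M.IsInvariant Q) : (M.sub Q hQ).InvIdeal :=
  (M.sub Q hQ).idealOf (fun X : Q.FullSubcategory => P X.obj) (fun F X hX => hP F X.obj hX)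

end TwoRep

/-! ### Basic and connected algebras -/

section Algebras

variable (A : Type*) [Ring A]

variable {A} in
/-- Primitive idempotents. -/
def IsPrimitiveIdempotent (e : A) : Prop :=
  IsIdempotentElem e ∧ e ≠ 0 ∧ ∀ e₁ e₂ : A, IsIdempotentElem e₁ → IsIdempotentElem e₂ →
    e₁ * e₂ = 0 → e₂ * e₁ = 0 → e₁ + e₂ = e → e₁ = 0 ∨ e₂ = 0

/-- A (finite dimensional) algebra is basic if the indecomposable projective modules `Ae` and `Af`
are not isomorphic, for all orthogonal primitive idempotents `e` and `f`. -/
def IsBasicAlgebra : Prop :=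
  ∀ e f : A, IsPrimitiveIdempotent e → IsPrimitiveIdempotent f → e * f = 0 → f * e = 0 →
    IsEmpty (Ideal.span {e} ≃ₗ[A] Ideal.span {f})

/-- An algebra is connected if it is non-zero and has no central idempotents except for `0`
and `1`. -/
def IsConnectedAlgebra : Prop :=
  Nontrivial A ∧ ∀ e ∈ Subring.center A, IsIdempotentElem e → e = 0 ∨ e = 1

end Algebras

/-! ### The two-sided cells of the `2`-category of good endofunctors -/

section GoodCells

variable (k : Type u) [Field k] (A B : Type u) [Ring A] [Ring B] [Algebra k A] [Algebra k B]
  [FiniteDimensional k A] [FiniteDimensional k B]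

/-- The two-sided cell containing the indecomposable summands of the left component projective
functor. -/
def leftProjectiveCell : Set (GoodFun k A B) :=
  {F | ∃ G : GoodFun k A B, IsIndecomposable G ∧ AddClosure (fun H => H = leftFun k A B) G.obj ∧
    F ∈ twoSidedCell G}

/-- The two-sided cell containing the indecomposable summands of the right component projective
functor. -/
def rightProjectiveCell : Set (GoodFun k A B) :=
  {F | ∃ G : GoodFun k A B, IsIndecomposable G ∧ AddClosure (fun H => H = rightFun k A B) G.obj ∧
    F ∈ twoSidedCell G}

/-- The two-sided cell containing the indecomposable functors of tensoring with projective
bimodules. -/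
def projectiveCell : Set (GoodFun k A B) :=
  {F | ∃ G : GoodFun k A B, IsIndecomposable G ∧ IsProjectiveFun k A B G.obj ∧ F ∈ twoSidedCell G}

variable {k A B}

/-- The projective modules. -/
def projObj : ObjectProperty (FGModuleCat.{u} (A ⊗[k] B)) :=
  fun X => Module.Projective (A ⊗[k] B) X

/-- The additive closure of the projective modules together with `M`. -/
def addProj (M : FGModuleCat.{u} (A ⊗[k] B)) : ObjectProperty (FGModuleCat.{u} (A ⊗[k] B)) :=
  AddClosure fun X => projObj X ∨ X = M

lemma projObj_le_addProj (M : FGModuleCat.{u} (A ⊗[k] B)) : projObj ≤ addProj M :=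
  fun _ h => .of_mem (Or.inl h)

/-- The stable endomorphism algebra of `M`: the endomorphisms of `M` modulo those which factor
through projective modules. -/
abbrev StableEnd (M : FGModuleCat.{u} (A ⊗[k] B)) : Type u :=
  End ((HomIdeal.generatedBy (k := k) (projObj (k := k) (A := A) (B := B))).proj.obj M)

/-- `M` is projective as an `A`-module. -/
def IsLeftProjective (M : FGModuleCat.{u} (A ⊗[k] B)) : Prop :=
  Module.Projective A ((ModuleCat.restrictScalars
    (Algebra.TensorProduct.includeLeft : A →ₐ[k] A ⊗[k] B).toRingHom).obj M.obj)

/-- `M` is projective as a `B`-module. -/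
def IsRightProjective (M : FGModuleCat.{u} (A ⊗[k] B)) : Prop :=
  Module.Projective B ((ModuleCat.restrictScalars
    (Algebra.TensorProduct.includeRight : B →ₐ[k] A ⊗[k] B).toRingHom).obj M.obj)

end GoodCells
end FinRep
end

open FinRep

noncomputable section
namespace FinRep

/-! ### Finite dimensional algebras without idempotents -/

section Rings

/-! Write `E = A ⊗ B` with all tensor products over `k`. By `isGood_iff`, good functors are the
summands of finite sums of four functors: the identity, `L = A ⊗ -`, `R = B ⊗ -` and the free
functor `E ⊗ -`. The composites of `L` and `R` in either order are the free functor, and `L ∘ L`, `R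
∘ R` are sums of copies of `L`, `R`. Everything else is obtained by evaluating good functors at
suitable modules.

Invariance: values of the free functor are projective. Moreover `L X` is the module induced from the
`B`-module `X`, and `R X` the one induced from the `A`-module `X`, so a module that is projective on
both sides becomes projective under each of them (`projective_extFunctor_deltaL`,
`projective_extFunctor_deltaR`). Thus only the identity fails to send `M` into the projectives,
which gives invariance of both subcategories.

Cells: both equivalences use `TwoRep.equivalent_quot_maxIdeal`. A full and dense morphism `Φ` out of
the additive span of a left cell identifies the cell `2`-representation with its target as soon as
the kernel of `Φ` is the largest invariant ideal avoiding the identities of the cell.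

For a left cell of projective functors, `Φ` is evaluation at a simple module. Such a cell belongs to
an indecomposable projective `Q`, and its span consists of sums of summands of the functors `P ⊗
Hom(Q, -)` with `P` projective (`IsHomTens`), because composing on the left changes only `P`. Over
an algebraically closed field there is a simple `S` with `Hom(Q, S)` one-dimensional, and `P ⊗
Hom(Q, S) ≅ P`; hence evaluation at `S` is full and dense onto the projectives. A transformation `f`
with `f_S ≠ 0` yields, by contraction to `End Q`, an endomorphism of `Q` that is not nilpotent,
hence invertible. So the ideal generated by `f` contains an identity
(`exists_comp_eq_id_of_app_ne_zero`).

For the cell of the identity, `Φ` is evaluation at `M` followed by the projection modulo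
projectives. The other elementary functors die, the identity goes to `M`, and `End M` becomes `k`.
The identity functor is indecomposable: its endomorphisms are the centre of `A ⊗ B`, which is `Z(A)
⊗ Z(B)`, and each of its elements is a scalar plus a nilpotent when both algebras are connected.

Diagram: the free functor sends any non-zero module to one having every indecomposable projective as
a summand, while projectives only reach projectives; so there are two vertices, with `M` on top. An
indecomposable functor decorates the edge exactly when it sends `M` to a non-zero projective. Both
conditions are constant on left cells, and `L M`, `R M` and `E ⊗ M` are non-zero, so all three kinds
of cells occur. -/

lemma exists_pow_succ_mul_eq (k : Type*) {R : Type*} [Field k] [Ring R] [Algebra k R]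
    [FiniteDimensional k R] (a : R) :
    ∃ (n : ℕ) (y : R), Commute a y ∧ a ^ (n + 1) * y = a ^ n := by
  -- The commutative algebra `k[a]` is Artinian, so the chain of ideals generated by the powers of
  -- `a` stabilises there. The witness `y` lies in `k[a]`, hence commutes with `a`.
  let S := Algebra.adjoin k {a}
  have : IsMulCommutative S := Algebra.isMulCommutative_adjoin k (by simp)
  have : IsArtinianRing S := IsArtinianRing.of_finite k S
  let x : S := ⟨a, Algebra.self_mem_adjoin_singleton k a⟩
  obtain ⟨n, y, h⟩ := IsArtinian.exists_pow_succ_smul_dvd x (1 : S)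
  refine ⟨n, y, congrArg Subtype.val (mul_comm x y), ?_⟩
  have := congrArg Subtype.val h
  simpa using this

lemma pow_mul_mul_pow_eq {R : Type*} [Ring R] {a y : R} {n : ℕ} (hc : Commute a y)
    (h : a ^ (n + 1) * y = a ^ n) (m : ℕ) : a ^ n * (a * y) ^ m = a ^ n := by
  induction m with
  | zero => simp
  | succ m ih => rw [pow_succ, ← mul_assoc, ih, ← mul_assoc, ← pow_succ, h]

/-- Every element of a finite dimensional algebra has a power which generates an idempotent. -/
lemma isIdempotentElem_pow_mul_pow {R : Type*} [Ring R] {a y : R} {n : ℕ} (hc : Commute a y)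
    (h : a ^ (n + 1) * y = a ^ n) : IsIdempotentElem (a ^ n * y ^ n) := by
  have := pow_mul_mul_pow_eq hc h n
  rw [hc.mul_pow] at this
  rw [IsIdempotentElem, ← mul_assoc, mul_assoc _ (y ^ n), ((hc.pow_pow n n).eq).symm, this]

/-- Fitting's lemma: the idempotent `a ^ n * y ^ n` attached to `a` is `0` or `1`. In the first case
`a ^ n = 0`, in the second `y` is an inverse of `a`. -/
lemma isUnit_or_isNilpotent (k : Type*) {R : Type*} [Field k] [Ring R] [Algebra k R]
    [FiniteDimensional k R] (hR : ∀ e : R, IsIdempotentElem e → e = 0 ∨ e = 1) (a : R) :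
    IsUnit a ∨ IsNilpotent a := by
  obtain ⟨n, y, hc, h⟩ := exists_pow_succ_mul_eq k a
  rcases hR _ (isIdempotentElem_pow_mul_pow hc h) with h0 | h1
  · right
    refine ⟨n, ?_⟩
    have := pow_mul_mul_pow_eq hc h n
    rw [hc.mul_pow, h0, mul_zero] at this
    exact this.symm
  · left
    have : a * y = 1 := by
      have e : a ^ n * (a * y) = a ^ n := by simpa using pow_mul_mul_pow_eq hc h 1
      calc a * y = (a * y) * (a ^ n * y ^ n) := by rw [h1, mul_one]
        _ = (a ^ n * (a * y)) * y ^ n := by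
          rw [← mul_assoc]
          congr 1
          exact (((Commute.refl a).mul_left hc.symm).pow_right n).eq
        _ = 1 := by rw [e, h1]
    exact ⟨⟨a, y, this, hc.eq ▸ this⟩, rfl⟩

lemma isLocalRing_of_idempotents (k : Type*) {R : Type*} [Field k] [Ring R] [Algebra k R]
    [FiniteDimensional k R] [Nontrivial R]
    (hR : ∀ e : R, IsIdempotentElem e → e = 0 ∨ e = 1) : IsLocalRing R :=
  .of_isUnit_or_isUnit_one_sub_self fun a => by
    rcases isUnit_or_isNilpotent k hR a with h | h
    · exact .inl h
    · exact .inr h.isUnit_one_sub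

lemma eq_zero_or_one_of_isIdempotentElem {R : Type*} [Ring R] [IsLocalRing R] {e : R}
    (he : IsIdempotentElem e) : e = 0 ∨ e = 1 := by
  rcases IsLocalRing.isUnit_or_isUnit_of_add_one (add_sub_cancel e 1) with h | h
  · right
    exact h.mul_left_cancel (by rw [he, mul_one])
  · left
    exact h.mul_left_cancel (by rw [sub_mul, one_mul, he, sub_self, mul_zero])

/-- An eigenvalue `c` exists because `k` is algebraically closed; `a - c` is not a unit, so it is
nilpotent. -/
lemma exists_isNilpotent_sub_algebraMap {k R : Type*} [Field k] [IsAlgClosed k] [Ring R]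
    [Algebra k R] [FiniteDimensional k R] [Nontrivial R]
    (hR : ∀ e : R, IsIdempotentElem e → e = 0 ∨ e = 1) (a : R) :
    ∃ c : k, IsNilpotent (a - algebraMap k R c) := by
  obtain ⟨c, hc⟩ := spectrum.nonempty_of_isAlgClosed_of_finiteDimensional k a
  refine ⟨c, ?_⟩
  rcases isUnit_or_isNilpotent k hR (a - algebraMap k R c) with h | h
  · rw [spectrum.mem_iff] at hc
    exact absurd (by simpa using h.neg) hc
  · exact h

lemma isLocalRing_of_ringEquiv {R S : Type*} [Ring R] [Ring S] [IsLocalRing R] (e : R ≃+* S) :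
    IsLocalRing S where
  toNontrivial := e.symm.toEquiv.nontrivial
  isUnit_or_isUnit_of_add_one {a b} h := by
    have := IsLocalRing.isUnit_or_isUnit_of_add_one (a := e.symm a) (b := e.symm b)
      (by rw [← map_add, h, map_one])
    simpa using this

/-- An idempotent of a quotient of a finite dimensional algebra can be lifted. -/
lemma exists_isIdempotentElem_lift (k : Type*) {R S : Type*} [Field k] [Ring R] [Algebra k R]
    [FiniteDimensional k R] [Monoid S] (φ : R →* S) (a : R) (ha : IsIdempotentElem (φ a)) :
    ∃ e : R, IsIdempotentElem e ∧ φ e = φ a := by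
  obtain ⟨n, y, hc, h⟩ := exists_pow_succ_mul_eq k a
  -- The exponent is raised by one so that it is positive: `φ a` is idempotent, and only its
  -- positive powers are equal to it.
  have h' : a ^ (n + 1 + 1) * y = a ^ (n + 1) := by
    rw [pow_succ', mul_assoc, h, ← pow_succ']
  refine ⟨_, isIdempotentElem_pow_mul_pow hc h', ?_⟩
  have e := congrArg φ h'
  rw [map_mul, map_pow, map_pow, ha.pow_succ_eq, ha.pow_succ_eq] at e
  rw [map_mul, map_pow, map_pow, ha.pow_succ_eq]
  have key (m : ℕ) : φ a * φ y ^ m = φ a := by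
    induction m with
    | zero => simp
    | succ m ih => rw [pow_succ, ← mul_assoc, ih, e]
  exact key _

end Rings

/-! ### Krull-Schmidt categories -/

section KrullSchmidt

variable {C : Type*} [Category* C] [Preadditive C]

lemma IsSummand.trans {X Y Z : C} (h : IsSummand X Y) (h' : IsSummand Y Z) : IsSummand X Z := by
  obtain ⟨r⟩ := h
  obtain ⟨s⟩ := h'
  exact ⟨⟨r.i ≫ s.i, s.r ≫ r.r, by simp⟩⟩

lemma IsSummand.of_iso {X Y : C} (e : X ≅ Y) : IsSummand X Y := ⟨⟨e.hom, e.inv, by simp⟩⟩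

lemma IsSummand.map {D : Type*} [Category* D] [Preadditive D] (F : C ⥤ D) {X Y : C}
    (h : IsSummand X Y) : IsSummand (F.obj X) (F.obj Y) := by
  obtain ⟨r⟩ := h
  exact ⟨r.map F⟩

lemma AddClosure.of_isSummand {S : ObjectProperty C} {X Y : C} (h : IsSummand X Y)
    (hY : AddClosure S Y) : AddClosure S X := by
  obtain ⟨r⟩ := h
  refine .bind (S := fun Z => Z = Y) (by rintro _ rfl; exact hY)
    (.of_fintype (ι := Unit) (fun _ => Y) (fun _ => r.i) (fun _ => r.r) (fun _ => rfl) ?_)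
  simp

lemma AddClosure.mono {S T : ObjectProperty C} (h : ∀ X, S X → T X) {X : C}
    (hX : AddClosure S X) : AddClosure T X :=
  hX.bind fun Y hY => .of_mem (h Y hY)

lemma nontrivial_end {X : C} (h : ¬ IsZero X) : Nontrivial (End X) :=
  ⟨⟨𝟙 X, 0, fun e => h ((IsZero.iff_id_eq_zero X).2 e)⟩⟩

lemma not_isZero_of_nontrivial_end {X : C} [Nontrivial (End X)] : ¬ IsZero X := fun h =>
  one_ne_zero (α := End X) ((IsZero.iff_id_eq_zero X).1 h)

/-- The binary bicone given by a splitting of two complementary idempotents. -/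
def splitBicone {X Y Z : C} (i : Y ⟶ X) (r : X ⟶ Y) (j : Z ⟶ X) (s : X ⟶ Z) (hi : i ≫ r = 𝟙 Y)
    (hj : j ≫ s = 𝟙 Z) (h : r ≫ i + s ≫ j = 𝟙 X) : BinaryBicone Y Z where
  pt := X
  fst := r
  snd := s
  inl := i
  inr := j
  inl_fst := hi
  inr_snd := hj
  inl_snd := by
    -- Composing the total relation with `i` gives `i + i ≫ s ≫ j = i`; orthogonality need not be
    -- assumed.
    have e : i ≫ s ≫ j = 0 := by
      have : i ≫ (r ≫ i + s ≫ j) = i := by rw [h, Category.comp_id]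
      rwa [Preadditive.comp_add, reassoc_of% hi, add_eq_left] at this
    have := congrArg (· ≫ s) e
    simpa [hj] using this
  inr_fst := by
    have e : j ≫ r ≫ i = 0 := by
      have : j ≫ (r ≫ i + s ≫ j) = j := by rw [h, Category.comp_id]
      rwa [Preadditive.comp_add, reassoc_of% hj, add_eq_right] at this
    have := congrArg (· ≫ r) e
    simpa [hi] using this

lemma exists_splitting [IsIdempotentComplete C] {X : C} (p : X ⟶ X) (hp : p ≫ p = p) :
    ∃ (Y Z : C) (i : Y ⟶ X) (r : X ⟶ Y) (j : Z ⟶ X) (s : X ⟶ Z), i ≫ r = 𝟙 Y ∧ j ≫ s = 𝟙 Z ∧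
      r ≫ i = p ∧ s ≫ j = 𝟙 X - p := by
  obtain ⟨Y, i, r, h, h'⟩ := IsIdempotentComplete.idempotents_split X p hp
  obtain ⟨Z, j, s, g, g'⟩ := IsIdempotentComplete.idempotents_split X (𝟙 X - p)
    (Idempotents.idem_of_id_sub_idem p hp)
  exact ⟨Y, Z, i, r, j, s, h, g, h', g'⟩

lemma IsIndecomposable.eq_zero_or_one [IsIdempotentComplete C] {X : C} (h : IsIndecomposable X)
    (p : End X) (hp : IsIdempotentElem p) : p = 0 ∨ p = 1 := by
  obtain ⟨Y, Z, i, r, j, s, hi, hj, h1, h2⟩ := exists_splitting (C := C) (X := X) p hp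
  have htot : r ≫ i + s ≫ j = 𝟙 X := by rw [h1, h2, add_sub_cancel]
  rcases h.2 Y Z (splitBicone i r j s hi hj htot) ⟨isBinaryBilimitOfTotal _ htot⟩ ⟨Iso.refl _⟩
    with h0 | h0
  · left
    rw [← h1, h0.eq_of_src i 0, comp_zero]
  · right
    rw [h0.eq_of_src j 0, comp_zero] at h2
    exact (sub_eq_zero.1 h2.symm).symm

lemma IsIndecomposable.isLocalRing_end (k : Type*) [Field k] [Linear k C] [IsIdempotentComplete C]
    {X : C} [FiniteDimensional k (X ⟶ X)] (h : IsIndecomposable X) : IsLocalRing (End X) := by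
  have := nontrivial_end h.1
  have : FiniteDimensional k (End X) := inferInstanceAs (FiniteDimensional k (X ⟶ X))
  exact isLocalRing_of_idempotents k (fun e he => h.eq_zero_or_one e he)

/-- A decomposition into `Y` and `Z` gives the idempotent projecting onto `Y`: if it is `0` then `Y`
vanishes, if it is `1` then `Z` does. -/
lemma isIndecomposable_of_idempotents {X : C} (h0 : ¬ IsZero X)
    (h : ∀ e : End X, IsIdempotentElem e → e = 0 ∨ e = 1) : IsIndecomposable X := by
  refine ⟨h0, fun Y Z b _ ⟨e⟩ => ?_⟩
  rcases h (e.hom ≫ b.fst ≫ b.inl ≫ e.inv) (by simp [IsIdempotentElem, End.mul_def]) with h | h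
  · left
    rw [IsZero.iff_id_eq_zero]
    have := congrArg (fun f : X ⟶ X => b.inl ≫ e.inv ≫ f ≫ e.hom ≫ b.fst) h
    simpa using this
  · right
    rw [IsZero.iff_id_eq_zero]
    have := congrArg (fun f : X ⟶ X => b.inr ≫ e.inv ≫ f ≫ e.hom ≫ b.snd) h
    simpa [End.one_def] using this.symm

lemma isIndecomposable_of_isLocalRing {X : C} [IsLocalRing (End X)] : IsIndecomposable X :=
  isIndecomposable_of_idempotents not_isZero_of_nontrivial_end
    (fun _ he => eq_zero_or_one_of_isIdempotentElem he)

lemma IsSummand.of_isUnit {X Y : C} (a : X ⟶ Y) (b : Y ⟶ X) (h : IsUnit (End.of (a ≫ b))) :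
    IsSummand X Y := by
  obtain ⟨u, hu⟩ := h
  refine ⟨⟨a, b ≫ (↑u⁻¹ : End X), ?_⟩⟩
  rw [← Category.assoc]
  have := u.inv_mul
  rwa [hu] at this

/-- An object with a local endomorphism ring in the additive closure of `S` is a direct summand
of an object of `S`. -/
lemma AddClosure.exists_isSummand {S : ObjectProperty C} {X : C} [IsLocalRing (End X)]
    (h : AddClosure S X) : ∃ Y, S Y ∧ IsSummand X Y := by
  obtain ⟨n, Y, a, b, hY, e⟩ := h
  have : IsUnit (∑ i, End.of (a i ≫ b i)) := by
    have e' : ∑ i, End.of (a i ≫ b i) = 1 := e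
    rw [e']
    exact isUnit_one
  obtain ⟨i, -, hi⟩ := IsLocalRing.exists_of_isUnit_sum this
  exact ⟨Y i, hY i, .of_isUnit _ _ hi⟩

/-- The retract gives an idempotent of `Y`. If it is `1`, inclusion and retraction are inverse to
each other; if it is `0`, the summand vanishes. -/
lemma IsSummand.nonempty_iso {X Y : C} (h : IsSummand X Y) (hX : ¬ IsZero X)
    (hY : ∀ e : End Y, IsIdempotentElem e → e = 0 ∨ e = 1) : Nonempty (X ≅ Y) := by
  obtain ⟨r⟩ := h
  rcases hY (r.r ≫ r.i) (by simp [IsIdempotentElem, End.mul_def]) with h | h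
  · refine absurd ((IsZero.iff_id_eq_zero X).2 ?_) hX
    have := congrArg (fun f : Y ⟶ Y => r.i ≫ f ≫ r.r) h
    simpa using this
  · exact ⟨⟨r.i, r.r, r.retract, h⟩⟩

lemma IsSummand.nonempty_iso_of_isLocalRing {X Y : C} (h : IsSummand X Y) (hX : ¬ IsZero X)
    [IsLocalRing (End Y)] : Nonempty (X ≅ Y) :=
  h.nonempty_iso hX (fun _ he => eq_zero_or_one_of_isIdempotentElem he)

/-- A decomposition of an object into objects with local endomorphism rings. -/
def HasLocalDecomposition (X : C) : Prop :=
  ∃ (n : ℕ) (Y : Fin n → C) (b : Bicone Y),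
    Nonempty b.IsBilimit ∧ Nonempty (X ≅ b.pt) ∧ ∀ i, IsLocalRing (End (Y i))

lemma HasLocalDecomposition.of_total {X : C} {ι : Type} [Fintype ι] (Y : ι → C)
    (b : Bicone Y) (hb : ∑ j, b.π j ≫ b.ι j = 𝟙 b.pt) (e : X ≅ b.pt)
    (hY : ∀ i, IsLocalRing (End (Y i))) : HasLocalDecomposition X :=
  ⟨_, _, b.whisker (Fintype.equivFin ι).symm,
    ⟨(b.whiskerIsBilimitIff _).symm (isBilimitOfTotal b hb)⟩, ⟨e⟩, fun _ => hY _⟩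

/-- The decompositions of two complementary summands are concatenated; the mixed components vanish
because `i ≫ s` and `j ≫ r` do. -/
lemma HasLocalDecomposition.add {X Y Z : C} (i : Y ⟶ X) (r : X ⟶ Y) (j : Z ⟶ X) (s : X ⟶ Z)
    (hi : i ≫ r = 𝟙 Y) (hj : j ≫ s = 𝟙 Z) (h : r ≫ i + s ≫ j = 𝟙 X)
    (hY : HasLocalDecomposition Y) (hZ : HasLocalDecomposition Z) : HasLocalDecomposition X := by
  obtain ⟨n, P, b, ⟨hb⟩, ⟨e⟩, hP⟩ := hY
  obtain ⟨m, Q, c, ⟨hc⟩, ⟨f⟩, hQ⟩ := hZ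
  have hij : i ≫ s = 0 := (splitBicone i r j s hi hj h).inl_snd
  have hji : j ≫ r = 0 := (splitBicone i r j s hi hj h).inr_fst
  have hPP (p) : (b.ι p ≫ e.inv ≫ i) ≫ r ≫ e.hom ≫ b.π p = 𝟙 _ := by simp [reassoc_of% hi]
  have hPP' {p q} (h : p ≠ q) : (b.ι p ≫ e.inv ≫ i) ≫ r ≫ e.hom ≫ b.π q = 0 := by
    simp [reassoc_of% hi, b.ι_π, h]
  have hQQ (p) : (c.ι p ≫ f.inv ≫ j) ≫ s ≫ f.hom ≫ c.π p = 𝟙 _ := by simp [reassoc_of% hj]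
  have hQQ' {p q} (h : p ≠ q) : (c.ι p ≫ f.inv ≫ j) ≫ s ≫ f.hom ≫ c.π q = 0 := by
    simp [reassoc_of% hj, c.ι_π, h]
  have hPQ (p q) : (b.ι p ≫ e.inv ≫ i) ≫ s ≫ f.hom ≫ c.π q = 0 := by simp [reassoc_of% hij]
  have hQP (p q) : (c.ι p ≫ f.inv ≫ j) ≫ r ≫ e.hom ≫ b.π q = 0 := by simp [reassoc_of% hji]
  let B : Bicone (Sum.elim P Q) :=
    { pt := X
      π := Sum.rec (fun p => r ≫ e.hom ≫ b.π p) (fun q => s ≫ f.hom ≫ c.π q)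
      ι := Sum.rec (fun p => b.ι p ≫ e.inv ≫ i) (fun q => c.ι q ≫ f.inv ≫ j)
      ι_π := by
        rintro (p | p) (q | q)
        · by_cases hpq : p = q
          · subst hpq
            refine (hPP p).trans ?_
            rw [dif_pos rfl]
            rfl
          · refine (hPP' hpq).trans ?_
            rw [dif_neg (by simpa using hpq)]
            rfl
        · refine (hPQ p q).trans ?_
          rw [dif_neg (by simp)]
          rfl
        · refine (hQP p q).trans ?_
          rw [dif_neg (by simp)]
          rfl
        · by_cases hpq : p = q
          · subst hpq
            refine (hQQ p).trans ?_
            rw [dif_pos rfl]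
            rfl
          · refine (hQQ' hpq).trans ?_
            rw [dif_neg (by simpa using hpq)]
            rfl }
  refine .of_total (Sum.elim P Q) B ?_ (Iso.refl X) (Sum.rec hP hQ)
  rw [Fintype.sum_sum_type]
  have h1 : ∑ p, B.π (.inl p) ≫ B.ι (.inl p) = r ≫ i := by
    have hp (p) : B.π (.inl p) ≫ B.ι (.inl p) = r ≫ e.hom ≫ (b.π p ≫ b.ι p) ≫ e.inv ≫ i := by
      simp [B]
    simp only [hp, ← Preadditive.comp_sum, ← Preadditive.sum_comp]
    rw [IsBilimit.total hb]
    simp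
  have h2 : ∑ q, B.π (.inr q) ≫ B.ι (.inr q) = s ≫ j := by
    have hq (q) : B.π (.inr q) ≫ B.ι (.inr q) = s ≫ f.hom ≫ (c.π q ≫ c.ι q) ≫ f.inv ≫ j := by
      simp [B]
    simp only [hq, ← Preadditive.comp_sum, ← Preadditive.sum_comp]
    rw [IsBilimit.total hc]
    simp
  rw [h1, h2, h]

/-- Induction on the dimension of `End X`: either `X` is zero, or it has only trivial idempotents
and its endomorphism ring is local, or a non-trivial idempotent splits it into two pieces with
smaller endomorphism spaces. -/
lemma hasLocalDecomposition (k : Type*) [Field k] [Linear k C] [IsIdempotentComplete C]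
    (hfin : ∀ X Y : C, FiniteDimensional k (X ⟶ Y)) (X : C) : HasLocalDecomposition X := by
  induction hn : Module.finrank k (X ⟶ X) using Nat.strong_induction_on generalizing X with
  | _ n ih =>
    by_cases h0 : IsZero X
    · refine .of_total (ι := Empty) (fun e => e.elim)
        { pt := X, π := fun e => e.elim, ι := fun e => e.elim, ι_π := fun e => e.elim } ?_
        (Iso.refl X) (fun e => e.elim)
      exact h0.eq_of_src _ _
    by_cases hX : ∀ e : End X, IsIdempotentElem e → e = 0 ∨ e = 1
    · have := nontrivial_end h0
      have : FiniteDimensional k (End X) := hfin X X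
      have := isLocalRing_of_idempotents k hX
      refine .of_total (ι := Unit) (fun _ => X)
        { pt := X, π := fun _ => 𝟙 X, ι := fun _ => 𝟙 X } ?_ (Iso.refl X) (fun _ => this)
      simp
    push Not at hX
    obtain ⟨p, hp, hp0, hp1⟩ := hX
    obtain ⟨Y, Z, i, r, j, s, hi, hj, h1, h2⟩ := exists_splitting (C := C) (X := X) p hp
    -- The map `f ↦ r ≫ f ≫ i` embeds `End Y` into `End X`. If it reached `𝟙 X`, the preimage would
    -- be `𝟙 Y` and `r ≫ i` would be the identity.
    have key {Y : C} (i : Y ⟶ X) (r : X ⟶ Y) (hi : i ≫ r = 𝟙 Y) (hne : r ≫ i ≠ 𝟙 X) :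
        Module.finrank k (Y ⟶ Y) < Module.finrank k (X ⟶ X) := by
      let φ : (Y ⟶ Y) →ₗ[k] (X ⟶ X) := Linear.rightComp k X i ∘ₗ Linear.leftComp k Y r
      have hφ (f) : φ f = (r ≫ f) ≫ i := rfl
      have hinj : Function.Injective φ := fun f g hfg => by
        have := congrArg (fun f => i ≫ f ≫ r) hfg
        simpa [hφ, hi, reassoc_of% hi] using this
      rw [← LinearMap.finrank_range_of_inj hinj]
      refine Submodule.finrank_lt fun htop => hne ?_
      obtain ⟨f, hf⟩ := LinearMap.range_eq_top.1 htop (𝟙 X)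
      rw [hφ] at hf
      have : f = 𝟙 Y := by
        have := congrArg (fun f => i ≫ f ≫ r) hf
        simpa [hi, reassoc_of% hi] using this
      rw [← hf, this, Category.comp_id]
    refine .add i r j s hi hj (by rw [h1, h2, add_sub_cancel]) (ih _ ?_ Y rfl) (ih _ ?_ Z rfl)
    · rw [← hn]
      exact key i r hi (by rw [h1]; exact hp1)
    · rw [← hn]
      refine key j s hj fun h => hp0 ?_
      rw [h2, sub_eq_self] at h
      exact h

lemma HasLocalDecomposition.addClosure {X : C} (h : HasLocalDecomposition X) :
    AddClosure (fun Y => IsLocalRing (End Y) ∧ IsSummand Y X) X := by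
  obtain ⟨n, Y, b, ⟨hb⟩, ⟨e⟩, hY⟩ := h
  refine ⟨n, Y, fun i => e.hom ≫ b.π i, fun i => b.ι i ≫ e.inv,
    fun i => ⟨hY i, ⟨⟨b.ι i ≫ e.inv, e.hom ≫ b.π i, by simp⟩⟩⟩, ?_⟩
  have hi (i) : (e.hom ≫ b.π i) ≫ b.ι i ≫ e.inv = e.hom ≫ (b.π i ≫ b.ι i) ≫ e.inv := by simp
  simp only [hi, ← Preadditive.comp_sum, ← Preadditive.sum_comp]
  rw [IsBilimit.total hb]
  simp

lemma HasLocalDecomposition.exists_isSummand {X : C} (h : HasLocalDecomposition X)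
    (hX : ¬ IsZero X) : ∃ Y, IsLocalRing (End Y) ∧ IsSummand Y X := by
  obtain ⟨n, Y, a, b, hY, e⟩ := h.addClosure
  by_cases hn : n = 0
  · subst hn
    simp only [Finset.univ_eq_empty, Finset.sum_empty] at e
    exact absurd ((IsZero.iff_id_eq_zero X).2 e.symm) hX
  · exact ⟨_, hY ⟨0, Nat.pos_of_ne_zero hn⟩⟩

/-- A criterion for a category to be finitary. -/
lemma isFinitaryCategory_of_generators (k : Type*) [Field k] [Linear k C]
    (hbi : HasFiniteBiproducts C) (hidem : IsIdempotentComplete C)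
    (hfin : ∀ X Y : C, FiniteDimensional k (X ⟶ Y)) {n : ℕ} (Y : Fin n → C)
    (hY : ∀ i, IsLocalRing (End (Y i))) (h : ∀ X, AddClosure (fun Z => ∃ i, Z = Y i) X) :
    IsFinitaryCategory k C where
  additive := hbi
  idempotent_split := hidem
  krull_schmidt := hasLocalDecomposition k hfin
  finitely_many := ⟨n, Y, fun X hX => by
    have := hfin X X
    have := hX.isLocalRing_end k
    obtain ⟨_, ⟨i, rfl⟩, hi⟩ := (h X).exists_isSummand
    have := hY i
    exact ⟨i, hi.nonempty_iso_of_isLocalRing hX.1⟩⟩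
  finite_dimensional := hfin

/-! ### Full subcategories and quotients -/

/-- The structure maps of a biproduct formed in `C` exhibit it as an object of the additive closure
of `P`, so it stays in `P`. -/
lemma hasFiniteBiproducts_fullSubcategory [HasFiniteBiproducts C] {P : ObjectProperty C}
    (hP : ∀ X, AddClosure P X → P X) : HasFiniteBiproducts P.FullSubcategory :=
  ⟨fun n => ⟨fun F => by
    let B := biproduct.bicone (fun i => (F i).obj)
    have hB : ∑ i, B.π i ≫ B.ι i = 𝟙 B.pt := IsBilimit.total (biproduct.isBilimit _)
    let pt : P.FullSubcategory := ⟨B.pt, hP _ ⟨n, _, B.π, B.ι, fun i => (F i).property, hB⟩⟩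
    let B' : Bicone F :=
      { pt := pt
        π := fun i => ObjectProperty.homMk (B.π i)
        ι := fun i => ObjectProperty.homMk (B.ι i)
        ι_π := fun i j => by
          apply ObjectProperty.hom_ext
          refine (B.ι_π i j).trans ?_
          by_cases h : i = j
          · subst h; simp
          · simp [h] }
    exact .mk ⟨B', isBilimitOfTotal B' (by
      apply ObjectProperty.hom_ext
      refine Eq.trans ?_ hB
      exact map_sum (P.ι.mapAddHom) _ _)⟩⟩⟩

lemma isIdempotentComplete_fullSubcategory [IsIdempotentComplete C] {P : ObjectProperty C}
    (hP : ∀ X, AddClosure P X → P X) : IsIdempotentComplete P.FullSubcategory :=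
  ⟨fun X p hp => by
    obtain ⟨Y, i, r, h, h'⟩ := IsIdempotentComplete.idempotents_split X.obj p.hom
      (congrArg (fun f => f.hom) hp)
    exact ⟨⟨Y, hP _ (.of_isSummand ⟨⟨i, r, h⟩⟩ (.of_mem X.property))⟩, ObjectProperty.homMk i,
      ObjectProperty.homMk r, ObjectProperty.hom_ext _ h, ObjectProperty.hom_ext _ h'⟩⟩

lemma isSummand_fullSubcategory_iff {P : ObjectProperty C} {X Y : P.FullSubcategory} :
    IsSummand X Y ↔ IsSummand X.obj Y.obj :=
  ⟨fun ⟨r⟩ => ⟨r.map P.ι⟩, fun ⟨r⟩ => ⟨⟨ObjectProperty.homMk r.i, ObjectProperty.homMk r.r,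
    ObjectProperty.hom_ext _ r.retract⟩⟩⟩

lemma isZero_fullSubcategory_iff {P : ObjectProperty C} {X : P.FullSubcategory} :
    IsZero X ↔ IsZero X.obj := by
  rw [IsZero.iff_id_eq_zero, IsZero.iff_id_eq_zero]
  exact ⟨fun h => congrArg (fun f => f.hom) h, fun h => ObjectProperty.hom_ext _ h⟩

lemma isLocalRing_end_fullSubcategory_iff {P : ObjectProperty C} {X : P.FullSubcategory} :
    IsLocalRing (End X) ↔ IsLocalRing (End X.obj) := by
  let e : End X ≃+* End X.obj :=
    { toFun := fun f => f.hom
      invFun := fun f => ObjectProperty.homMk f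
      left_inv := fun _ => rfl
      right_inv := fun _ => rfl
      map_mul' := fun _ _ => rfl
      map_add' := fun _ _ => rfl }
  exact ⟨fun _ => isLocalRing_of_ringEquiv e, fun _ => isLocalRing_of_ringEquiv e.symm⟩

lemma finiteDimensional_fullSubcategory (k : Type*) [Field k] [Linear k C] {P : ObjectProperty C}
    (X Y : P.FullSubcategory) [FiniteDimensional k (X.obj ⟶ Y.obj)] :
    FiniteDimensional k (X ⟶ Y) :=
  haveI : FiniteDimensional k (P.ι.obj X ⟶ P.ι.obj Y) :=
    inferInstanceAs (FiniteDimensional k (X.obj ⟶ Y.obj))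
  Module.Finite.of_injective (P.ι.mapLinearMap k : (X ⟶ Y) →ₗ[k] (X.obj ⟶ Y.obj))
    (fun _ _ h => ObjectProperty.hom_ext _ h)

/-- The additive closure of a property of the objects of a full subcategory. -/
lemma addClosure_fullSubcategory {P S : ObjectProperty C} (hS : ∀ X, S X → P X)
    {X : P.FullSubcategory} (h : AddClosure S X.obj) : AddClosure (fun Y => S Y.obj) X := by
  obtain ⟨n, Y, a, b, hY, e⟩ := h
  refine ⟨n, fun i => ⟨Y i, hS _ (hY i)⟩, fun i => ObjectProperty.homMk (a i),
    fun i => ObjectProperty.homMk (b i), hY, ObjectProperty.hom_ext _ ?_⟩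
  refine Eq.trans ?_ e
  exact map_sum (P.ι.mapAddHom) _ _

namespace HomIdeal

variable {k : Type*} [Field k] [Linear k C]

lemma proj_map_eq_zero_iff (I : HomIdeal k C) {X Y : C} (f : X ⟶ Y) :
    I.proj.map f = 0 ↔ f ∈ I.hom X Y := by
  rw [← I.proj.map_zero, Quotient.functor_map_eq_iff]
  simp [rel]

lemma hasFiniteBiproducts_quot [HasFiniteBiproducts C] (I : HomIdeal k C) :
    HasFiniteBiproducts I.Quot :=
  ⟨fun _ => ⟨fun F => by
    let B := biproduct.bicone (fun i => (F i).as)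
    have hB : ∑ i, B.π i ≫ B.ι i = 𝟙 B.pt := IsBilimit.total (biproduct.isBilimit _)
    exact .mk ⟨I.proj.mapBicone B, isBilimitOfTotal (I.proj.mapBicone B) (by
      have := congrArg I.proj.map hB
      rw [I.proj.map_sum, I.proj.map_id] at this
      refine Eq.trans (Finset.sum_congr rfl fun i _ => ?_) this
      exact (I.proj.map_comp _ _).symm)⟩⟩⟩

/-- An idempotent modulo the ideal lifts to an idempotent because endomorphism algebras are finite
dimensional; the lift splits in `C` and its splitting is projected. -/
lemma isIdempotentComplete_quot [IsIdempotentComplete C] (I : HomIdeal k C)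
    (hfin : ∀ X : C, FiniteDimensional k (X ⟶ X)) : IsIdempotentComplete I.Quot :=
  ⟨fun X p hp => by
    obtain ⟨q, rfl⟩ := I.proj.map_surjective (X := X.as) (Y := X.as) p
    have : FiniteDimensional k (End X.as) := hfin X.as
    obtain ⟨e, he, he'⟩ := exists_isIdempotentElem_lift k (I.proj.mapEnd X.as) q hp
    obtain ⟨Y, i, r, h, h'⟩ := IsIdempotentComplete.idempotents_split X.as e he
    refine ⟨I.proj.obj Y, I.proj.map i, I.proj.map r, ?_, ?_⟩
    · rw [← I.proj.map_comp, h, I.proj.map_id]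
    · rw [← I.proj.map_comp, h']
      exact he'⟩

lemma finiteDimensional_quot (I : HomIdeal k C) (hfin : ∀ X Y : C, FiniteDimensional k (X ⟶ Y))
    (X Y : I.Quot) : FiniteDimensional k (X ⟶ Y) := by
  have := hfin X.as Y.as
  exact Module.Finite.of_surjective (I.proj.mapLinearMap k : (X.as ⟶ Y.as) →ₗ[k] _)
    (I.proj.map_surjective (X := X.as) (Y := Y.as))

end HomIdeal

end KrullSchmidt
end FinRep
end

noncomputable section
namespace FinRep
open Functor Functor.LaxLeftLinear Functor.OplaxLeftLinear Functor.LeftLinear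

/-! ### Left linear functors -/

section LeftLinear

variable {C C' : Type*} [Category* C] [Category* C'] {D : Type*} [Category* D] [MonoidalCategory D]
  [MonoidalLeftAction D C] [MonoidalLeftAction D C']

/-- A lax left linear functor whose structure morphisms are isomorphisms is left linear. -/
abbrev leftLinearOfLax (F : C ⥤ C') [F.LaxLeftLinear D] (μ : ∀ (c : D) (X : C), IsIso (μₗ F c X)) :
    F.LeftLinear D where
  δₗ c X := inv (μₗ F c X)
  δₗ_naturality_left f X := by
    rw [← cancel_epi (μₗ F _ X), IsIso.hom_inv_id_assoc, ← cancel_mono (μₗ F _ X)]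
    simp
  δₗ_naturality_right c X Y f := by
    rw [← cancel_epi (μₗ F _ X), IsIso.hom_inv_id_assoc, ← cancel_mono (μₗ F _ Y)]
    simp
  δₗ_associativity c c' X := by
    rw [← cancel_epi (μₗ F (c ⊗ c') X), IsIso.hom_inv_id_assoc, μₗ_associativity_assoc,
      IsIso.hom_inv_id_assoc, ← actionHomRight_comp, IsIso.hom_inv_id, actionHomRight_id,
      Category.comp_id]
  δₗ_unitality_inv X := by
    rw [← cancel_mono (μₗ F _ X), Category.assoc, IsIso.inv_hom_id, Category.comp_id,
      ← cancel_mono (F.map (λₗ X).hom), Category.assoc, ← μₗ_unitality, ← F.map_comp]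
    simp
  μₗ_comp_δₗ c X := IsIso.hom_inv_id _
  δₗ_comp_μₗ c X := IsIso.inv_hom_id _

/-- The structure isomorphism of a right inverse of a fully faithful left linear functor. -/
def invMu (F : C ⥤ C') [F.Full] [F.Faithful] [F.LeftLinear D] {G : C' ⥤ C} (ε : G ⋙ F ≅ 𝟭 C')
    (c : D) (X : C') : c ⊙ₗ G.obj X ≅ G.obj (c ⊙ₗ X) :=
  F.preimageIso ((μₗIso F c (G.obj X)).symm ≪≫ (actionLeft C' c).mapIso (ε.app X) ≪≫
    (ε.app (c ⊙ₗ X)).symm)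

lemma map_invMu (F : C ⥤ C') [F.Full] [F.Faithful] [F.LeftLinear D] {G : C' ⥤ C}
    (ε : G ⋙ F ≅ 𝟭 C') (c : D) (X : C') :
    F.map (invMu F ε c X).hom = δₗ F c (G.obj X) ≫ c ⊴ₗ ε.hom.app X ≫ ε.inv.app (c ⊙ₗ X) := by
  simp [invMu]
  rfl

/-- A right inverse of a fully faithful left linear functor is left linear. -/
abbrev leftLinearInv (F : C ⥤ C') [F.Full] [F.Faithful] [F.LeftLinear D] {G : C' ⥤ C}
    (ε : G ⋙ F ≅ 𝟭 C') : G.LeftLinear D := by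
  have nat {X Y : C'} (f : X ⟶ Y) : F.map (G.map f) ≫ ε.hom.app Y = ε.hom.app X ≫ f :=
    ε.hom.naturality f
  have nat' {X Y : C'} (f : X ⟶ Y) : ε.inv.app X ≫ F.map (G.map f) = f ≫ ε.inv.app Y :=
    (ε.inv.naturality f).symm
  have inv_hom (X : C') : ε.inv.app X ≫ ε.hom.app X = 𝟙 _ := ε.inv_hom_id_app X
  have hom_inv (X : C') : ε.hom.app X ≫ ε.inv.app X = 𝟙 _ := ε.hom_inv_id_app X
  letI : G.LaxLeftLinear D :=
    -- The axioms are tested after applying the faithful functor `F`, where `map_invMu` expresses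
    -- the structure maps through those of `F` and the isomorphism `ε`.
    { μₗ := fun c X => (invMu F ε c X).hom
      μₗ_naturality_left := fun f X => by
        apply F.map_injective
        simp only [F.map_comp, map_invMu, Category.assoc, nat', δₗ_naturality_left_assoc]
        have hx := action_exchange_assoc f (ε.hom.app X) (ε.inv.app (_ ⊙ₗ X))
        exact congrArg (δₗ F _ (G.obj X) ≫ ·) hx.symm
      μₗ_naturality_right := fun c X Y f => by
        apply F.map_injective
        simp only [F.map_comp, map_invMu, Category.assoc, nat', δₗ_naturality_right_assoc]
        rw [← actionHomRight_comp_assoc, ← actionHomRight_comp_assoc, nat]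
      μₗ_associativity := fun c c' X => by
        apply F.map_injective
        simp only [F.map_comp, map_invMu, Category.assoc, nat', δₗ_naturality_right_assoc]
        rw [← actionHomRight_comp_assoc, Category.assoc, Category.assoc, inv_hom]
        simp only [actionHomRight_comp, Category.assoc]
        have h1 := δₗ_associativity F c c' (G.obj X)
        have h2 : (c ⊗ c') ⊴ₗ ε.hom.app X ≫ (αₗ c c' X).hom =
            (αₗ c c' (F.obj (G.obj X))).hom ≫ c ⊴ₗ c' ⊴ₗ ε.hom.app X := by
          have := actionAssocIso_hom_naturality (𝟙 c) (𝟙 c') (ε.hom.app X)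
          simpa using this
        rw [reassoc_of% h2, reassoc_of% h1]
        simp
      μₗ_unitality := fun X => by
        apply F.map_injective
        simp only [F.map_comp, map_invMu, Category.assoc, nat']
        have h1 := δₗ_unitality_hom F (C := D) (G.obj X)
        have h2 : (𝟙_ D) ⊴ₗ ε.hom.app X ≫ (λₗ X).hom =
            (λₗ (F.obj (G.obj X))).hom ≫ ε.hom.app X := by
          have := actionUnitIso_hom_naturality (C := D) (ε.hom.app X)
          simpa using this
        rw [reassoc_of% h2, hom_inv]
        simp [h1] }
  exact leftLinearOfLax _ (fun c X => inferInstanceAs (IsIso (invMu F ε c X).hom))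

end LeftLinear

/-! ### Morphisms of `2`-representations and a criterion for cell `2`-representations -/

namespace TwoRep

variable {k : Type w} [Field k] {D : Type u} [Category.{v} D] [Preadditive D] [Linear k D]
  [MonoidalCategory D]

attribute [local instance] Hom.additive Hom.linear Hom.leftLinear

universe v₃ u₃

/-- The quasi-inverse inherits its structure isomorphisms through `leftLinearInv`. This reduces an
equivalence with a cell `2`-representation to a functor out of it, which evaluation at an object
provides. -/
lemma Equivalent.symm {M : TwoRep.{w, v, u, v₁, u₁} k D} {N : TwoRep.{w, v, u, v₂, u₂} k D}
    (h : M.Equivalent N) : N.Equivalent M := by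
  obtain ⟨Φ, hΦ⟩ := h
  letI : Φ.functor.inv.LeftLinear D := leftLinearInv Φ.functor Φ.functor.asEquivalence.counitIso
  have : Φ.functor.asEquivalence.functor.Additive := inferInstanceAs Φ.functor.Additive
  have : Φ.functor.asEquivalence.functor.Linear k := inferInstanceAs (Φ.functor.Linear k)
  exact ⟨{ functor := Φ.functor.inv
           additive := Equivalence.inverse_additive Φ.functor.asEquivalence
           linear := Equivalence.inverseLinear k Φ.functor.asEquivalence }, inferInstanceAs (Φ.functor.inv.IsEquivalence)⟩

/-- The composition of two morphisms of `2`-representations. -/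
def Hom.comp {M : TwoRep.{w, v, u, v₁, u₁} k D} {N : TwoRep.{w, v, u, v₂, u₂} k D}
    {P : TwoRep.{w, v, u, v₃, u₃} k D} (Φ : Hom M N) (Ψ : Hom N P) : Hom M P where
  functor := Φ.functor ⋙ Ψ.functor
  leftLinear :=
    letI : (Φ.functor ⋙ Ψ.functor).LaxLeftLinear D :=
      { μₗ := fun c X => μₗ Ψ.functor c (Φ.functor.obj X) ≫ Ψ.functor.map (μₗ Φ.functor c X)
        μₗ_naturality_left := fun f X => by
          simp [← Functor.map_comp]
        μₗ_naturality_right := fun c X Y f => by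
          simp [← Functor.map_comp]
        μₗ_associativity := fun c c' X => by
          rw [Functor.comp_map, Category.assoc, ← Functor.map_comp, μₗ_associativity, Functor.map_comp,
            μₗ_associativity_assoc, Functor.map_comp, actionHomRight_comp]
          simp
        μₗ_unitality := fun X => by
          simp [← Functor.map_comp] }
    leftLinearOfLax _ (fun c X => inferInstanceAs
      (IsIso (μₗ Ψ.functor c (Φ.functor.obj X) ≫ Ψ.functor.map (μₗ Φ.functor c X))))

/-- A morphism of `2`-representations restricted to full subcategories. -/
def Hom.restrict {M : TwoRep.{w, v, u, v₁, u₁} k D} {N : TwoRep.{w, v, u, v₂, u₂} k D}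
    (Φ : Hom M N) {P : ObjectProperty M.carrier} {Q : ObjectProperty N.carrier}
    (hP : M.IsInvariant P) (hQ : N.IsInvariant Q) (h : ∀ X, P X → Q (Φ.functor.obj X)) :
    Hom (M.sub P hP) (N.sub Q hQ) :=
  letI := M.subAction P hP
  letI := N.subAction Q hQ
  let F : P.FullSubcategory ⥤ Q.FullSubcategory := Q.lift (P.ι ⋙ Φ.functor) (fun X => h _ X.property)
  letI : F.LeftLinear D :=
    { μₗ := fun c X => ObjectProperty.homMk (μₗ Φ.functor c X.obj)
      δₗ := fun c X => ObjectProperty.homMk (δₗ Φ.functor c X.obj)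
      μₗ_naturality_left := fun f X => ObjectProperty.hom_ext _ (μₗ_naturality_left Φ.functor f X.obj)
      μₗ_naturality_right := fun c X Y f =>
        ObjectProperty.hom_ext _ (μₗ_naturality_right Φ.functor c f.hom)
      μₗ_associativity := fun c c' X =>
        ObjectProperty.hom_ext _ (μₗ_associativity Φ.functor c c' X.obj)
      μₗ_unitality := fun X => ObjectProperty.hom_ext _ (μₗ_unitality Φ.functor X.obj)
      δₗ_naturality_left := fun f X => ObjectProperty.hom_ext _ (δₗ_naturality_left Φ.functor f X.obj)
      δₗ_naturality_right := fun c X Y f =>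
        ObjectProperty.hom_ext _ (δₗ_naturality_right Φ.functor c f.hom)
      δₗ_associativity := fun c c' X =>
        ObjectProperty.hom_ext _ (δₗ_associativity Φ.functor c c' X.obj)
      δₗ_unitality_inv := fun X => ObjectProperty.hom_ext _ (δₗ_unitality_inv Φ.functor X.obj)
      μₗ_comp_δₗ := fun c X => ObjectProperty.hom_ext _ (μₗ_comp_δₗ Φ.functor c X.obj)
      δₗ_comp_μₗ := fun c X => ObjectProperty.hom_ext _ (δₗ_comp_μₗ Φ.functor c X.obj) }
  { functor := F
    additive := { map_add := ObjectProperty.hom_ext _ (Φ.functor.map_add) }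
    linear := { map_smul := fun _ _ => ObjectProperty.hom_ext _ (Φ.functor.map_smul _ _) }
    leftLinear := this }

/-- The evaluation of `1`-morphisms at an object of a `2`-representation. -/
def evalHom [MonoidalPreadditive D] [MonoidalLinear k D] (M : TwoRep.{w, v, u, v₁, u₁} k D)
    (X₀ : M.carrier) : Hom (principal k D) M :=
  let F : D ⥤ M.carrier := actionRight D X₀
  letI : F.LeftLinear D :=
    { μₗ := fun c G => (αₗ c G X₀).inv
      δₗ := fun c G => (αₗ c G X₀).hom
      μₗ_naturality_left := fun f X => by
        change f ⊵ₗ (X ⊙ₗ X₀) ≫ (αₗ _ X X₀).inv = (αₗ _ X X₀).inv ≫ (f ▷ X) ⊵ₗ X₀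
        simp
      μₗ_naturality_right := fun c X Y f => by
        change c ⊴ₗ (f ⊵ₗ X₀) ≫ (αₗ c Y X₀).inv = (αₗ c X X₀).inv ≫ (c ◁ f) ⊵ₗ X₀
        simp
      μₗ_associativity := fun c c' X => by
        change (αₗ (c ⊗ c') X X₀).inv ≫ (α_ c c' X).hom ⊵ₗ X₀ =
          (αₗ c c' (X ⊙ₗ X₀)).hom ≫ c ⊴ₗ (αₗ c' X X₀).inv ≫ (αₗ c (c' ⊗ X) X₀).inv
        rw [Iso.inv_comp_eq, ← cancel_mono (αₗ c (c' ⊗ X) X₀).hom,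
          ← cancel_mono (c ⊴ₗ (αₗ c' X X₀).hom)]
        simp
      μₗ_unitality := fun X => by
        change (λₗ[D] (X ⊙ₗ X₀)).hom = (αₗ (𝟙_ D) X X₀).inv ≫ (λ_ X).hom ⊵ₗ X₀
        simp
      δₗ_naturality_left := fun f X => by
        change (f ▷ X) ⊵ₗ X₀ ≫ (αₗ _ X X₀).hom = (αₗ _ X X₀).hom ≫ f ⊵ₗ (X ⊙ₗ X₀)
        simp
      δₗ_naturality_right := fun c X Y f => by
        change (c ◁ f) ⊵ₗ X₀ ≫ (αₗ c Y X₀).hom = (αₗ c X X₀).hom ≫ c ⊴ₗ (f ⊵ₗ X₀)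
        simp
      δₗ_associativity := fun c c' X => by
        change (αₗ (c ⊗ c') X X₀).hom ≫ (αₗ c c' (X ⊙ₗ X₀)).hom =
          (α_ c c' X).hom ⊵ₗ X₀ ≫ (αₗ c (c' ⊗ X) X₀).hom ≫ c ⊴ₗ (αₗ c' X X₀).hom
        simp
      δₗ_unitality_inv := fun X => by
        change (λₗ[D] (X ⊙ₗ X₀)).inv = (λ_ X).inv ⊵ₗ X₀ ≫ (αₗ (𝟙_ D) X X₀).hom
        have h : (λₗ[D] (X ⊙ₗ X₀)).hom = (αₗ (𝟙_ D) X X₀).inv ≫ (λ_ X).hom ⊵ₗ X₀ := by simp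
        rw [← cancel_epi (λₗ[D] (X ⊙ₗ X₀)).hom, Iso.hom_inv_id, h, Category.assoc,
          ← comp_actionHomLeft_assoc, Iso.hom_inv_id]
        simp
      μₗ_comp_δₗ := fun c X => (αₗ c X X₀).inv_hom_id
      δₗ_comp_μₗ := fun c X => (αₗ c X X₀).hom_inv_id }
  { functor := F
    additive := { map_add := M.add_action _ _ X₀ }
    linear := { map_smul := fun _ _ => M.smul_action _ _ X₀ }
    leftLinear := this }

/-- A morphism of `2`-representations which annihilates an invariant ideal induces a morphism from
the quotient. -/
def Hom.lift {M : TwoRep.{w, v, u, v₁, u₁} k D} {N : TwoRep.{w, v, u, v₂, u₂} k D}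
    (Φ : Hom M N) (I : M.InvIdeal) (h : ∀ {X Y} (f : X ⟶ Y), f ∈ I.hom X Y → Φ.functor.map f = 0) :
    Hom (M.quot I) N :=
  letI := M.quotAction I
  let F : I.toHomIdeal.Quot ⥤ N.carrier := CategoryTheory.Quotient.lift I.rel Φ.functor
    (fun X Y f g hfg => by
      have := h _ hfg
      rwa [Functor.map_sub, sub_eq_zero] at this)
  letI : F.LeftLinear D :=
    { μₗ := fun c X => μₗ Φ.functor c X.as
      δₗ := fun c X => δₗ Φ.functor c X.as
      μₗ_naturality_left := fun f X => μₗ_naturality_left Φ.functor f X.as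
      μₗ_naturality_right := fun c X Y f => by
        obtain ⟨f, rfl⟩ := I.proj.map_surjective (X := X.as) (Y := Y.as) f
        exact μₗ_naturality_right Φ.functor c f
      μₗ_associativity := fun c c' X => μₗ_associativity Φ.functor c c' X.as
      μₗ_unitality := fun X => μₗ_unitality Φ.functor X.as
      δₗ_naturality_left := fun f X => δₗ_naturality_left Φ.functor f X.as
      δₗ_naturality_right := fun c X Y f => by
        obtain ⟨f, rfl⟩ := I.proj.map_surjective (X := X.as) (Y := Y.as) f
        exact δₗ_naturality_right Φ.functor c f
      δₗ_associativity := fun c c' X => δₗ_associativity Φ.functor c c' X.as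
      δₗ_unitality_inv := fun X => δₗ_unitality_inv Φ.functor X.as
      μₗ_comp_δₗ := fun c X => μₗ_comp_δₗ Φ.functor c X.as
      δₗ_comp_μₗ := fun c X => δₗ_comp_μₗ Φ.functor c X.as }
  { functor := F
    additive := ⟨fun {X Y f g} => by
      obtain ⟨f, rfl⟩ := I.proj.map_surjective (X := X.as) (Y := Y.as) f
      obtain ⟨g, rfl⟩ := I.proj.map_surjective (X := X.as) (Y := Y.as) g
      exact Φ.functor.map_add⟩
    linear := ⟨fun {X Y} f c => by
      obtain ⟨f, rfl⟩ := I.proj.map_surjective (X := X.as) (Y := Y.as) f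
      exact Φ.functor.map_smul _ _⟩
    leftLinear := this }

lemma action_zero (M : TwoRep.{w, v, u, v₁, u₁} k D) (F : D) (X Y : M.carrier) :
    F ⊴ₗ (0 : X ⟶ Y) = 0 := by
  have := M.action_smul F (0 : k) (0 : X ⟶ Y)
  rwa [zero_smul, zero_smul] at this

/-- The kernel of a morphism of `2`-representations. -/
def Hom.ker {M : TwoRep.{w, v, u, v₁, u₁} k D} {N : TwoRep.{w, v, u, v₂, u₂} k D}
    (Φ : Hom M N) : M.InvIdeal where
  hom X Y := LinearMap.ker (Φ.functor.mapLinearMap k : (X ⟶ Y) →ₗ[k] _)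
  comp_left f g hg := by
    have hg : Φ.functor.map g = 0 := hg
    change Φ.functor.map (f ≫ g) = 0
    rw [Functor.map_comp, hg, comp_zero]
  comp_right {_ _ _ f} g hf := by
    have hf : Φ.functor.map f = 0 := hf
    change Φ.functor.map (f ≫ g) = 0
    rw [Functor.map_comp, hf, zero_comp]
  invariant F X Y f hf := by
    have hf : Φ.functor.map f = 0 := hf
    change Φ.functor.map (F ⊴ₗ f) = 0
    -- Up to the structure isomorphisms, the image of `F ⊴ₗ f` is `F` acting on the image of `f`,
    -- which is zero.
    rw [← cancel_epi (μₗ Φ.functor F X), ← μₗ_naturality_right, hf, action_zero, zero_comp,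
      comp_zero]

/-- A criterion for the quotient by the maximal invariant ideal which does not contain the
identity morphisms of the objects in `S` to be equivalent to a given `2`-representation. -/
lemma equivalent_quot_maxIdeal {M : TwoRep.{w, v, u, v₁, u₁} k D}
    {N : TwoRep.{w, v, u, v₂, u₂} k D} (Φ : Hom M N) (S : Set M.carrier)
    (hfull : ∀ {X Y : M.carrier} (g : Φ.functor.obj X ⟶ Φ.functor.obj Y), ∃ f, Φ.functor.map f = g)
    (hsurj : ∀ Y : N.carrier, ∃ X, Nonempty (Φ.functor.obj X ≅ Y))
    (hS : ∀ Z ∈ S, Φ.functor.map (𝟙 Z) ≠ 0)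
    (hJ : ∀ (J : M.InvIdeal) {X Y : M.carrier} (f : X ⟶ Y), f ∈ J.hom X Y →
      Φ.functor.map f ≠ 0 → ∃ Z ∈ S, 𝟙 Z ∈ J.hom Z Z) :
    N.Equivalent (M.quot (M.maxIdeal S)) := by
  -- The maximal ideal is exactly the kernel of `Φ`: `hJ` puts every admissible ideal inside the
  -- kernel, and `hS` says that the kernel is itself admissible.
  have hker {X Y : M.carrier} (f : X ⟶ Y) :
      f ∈ (M.maxIdeal S).hom X Y ↔ Φ.functor.map f = 0 := by
    constructor
    · intro hf
      refine (iSup_le fun J => ?_ : (M.maxIdeal S).hom X Y ≤ Φ.ker.hom X Y) hf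
      intro f hf
      by_contra h
      obtain ⟨Z, hZ, hZJ⟩ := hJ J.1 f hf h
      exact J.2 Z hZ hZJ
    · intro hf
      exact Submodule.mem_iSup_of_mem (⟨Φ.ker, hS⟩ : {J : M.InvIdeal // ∀ Z ∈ S, 𝟙 Z ∉ J.hom Z Z}) hf
  refine Equivalent.symm ⟨Φ.lift (M.maxIdeal S) (fun f hf => (hker f).1 hf), ?_⟩
  have : (Φ.lift (M.maxIdeal S) (fun f hf => (hker f).1 hf)).functor.Full := ⟨fun {X Y} g => by
    obtain ⟨f, hf⟩ := hfull (X := X.as) (Y := Y.as) g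
    exact ⟨(M.maxIdeal S).proj.map f, hf⟩⟩
  have : (Φ.lift (M.maxIdeal S) (fun f hf => (hker f).1 hf)).functor.Faithful :=
    ⟨fun {X Y} f g hfg => by
      obtain ⟨f, rfl⟩ := (M.maxIdeal S).proj.map_surjective (X := X.as) (Y := Y.as) f
      obtain ⟨g, rfl⟩ := (M.maxIdeal S).proj.map_surjective (X := X.as) (Y := Y.as) g
      apply CategoryTheory.Quotient.sound
      change f - g ∈ _
      rw [hker, Functor.map_sub, sub_eq_zero]
      exact hfg⟩
  have : (Φ.lift (M.maxIdeal S) (fun f hf => (hker f).1 hf)).functor.EssSurj := ⟨fun Y => by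
    obtain ⟨X, ⟨e⟩⟩ := hsurj Y
    exact ⟨⟨X⟩, ⟨e⟩⟩⟩
  exact {}

end TwoRep
end FinRep
end

noncomputable section
namespace FinRep
open Module

/-! ### The category of finite dimensional modules -/

section FGModules

attribute [local instance] Bimod.finite_of_fg

variable {k : Type u} [Field k] {R : Type u} [Ring R] [Algebra k R] [FiniteDimensional k R]

lemma fg_surjective_epi {X Y Z : FGModuleCat.{u} R} (f : X ⟶ Y)
    (hf : Function.Surjective f.hom.hom) {g h : Y ⟶ Z} (e : f ≫ g = f ≫ h) : g = h := by
  apply FGModuleCat.hom_ext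
  ext y
  obtain ⟨x, rfl⟩ := hf y
  exact congrArg (fun f : X ⟶ Z => f.hom.hom x) e

variable (k) in
/-- `klin` as a linear map. -/
def klinLin (X Y : FGModuleCat.{u} R) : (X ⟶ Y) →ₗ[k] (X →ₗ[k] Y) where
  toFun := klin
  map_add' _ _ := rfl
  map_smul' _ _ := rfl

lemma finiteDimensional_hom (X Y : FGModuleCat.{u} R) : FiniteDimensional k (X ⟶ Y) :=
  Module.Finite.of_injective (klinLin k X Y) (fun f g h => by
    apply FGModuleCat.hom_ext
    ext x
    exact LinearMap.congr_fun h x)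

attribute [local instance] finiteDimensional_hom

/-- The evaluation of homomorphisms at an element. -/
def evalHomAt {X Y : FGModuleCat.{u} R} (x : X) : (X ⟶ Y) →ₗ[k] Y where
  toFun f := f.hom.hom x
  map_add' _ _ := rfl
  map_smul' _ _ := rfl

lemma fg_sum_apply {ι : Type*} [Fintype ι] {X Y : FGModuleCat.{u} R} (f : ι → (X ⟶ Y)) (x : X) :
    (∑ i, f i).hom.hom x = ∑ i, (f i).hom.hom x := by
  have : ∀ s : Finset ι, (∑ i ∈ s, f i).hom.hom x = ∑ i ∈ s, (f i).hom.hom x := by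
    classical
    intro s
    induction s using Finset.induction_on with
    | empty => simp
    | insert i s hi ih => rw [Finset.sum_insert hi, Finset.sum_insert hi, ← ih]; rfl
  exact this _

variable (R) in
/-- The regular module. -/
abbrev regMod : FGModuleCat.{u} R := FGModuleCat.of R R

/-- The homomorphism `r ↦ r x` from the regular module. -/
def fromReg {X : FGModuleCat.{u} R} (x : X) : regMod R ⟶ X :=
  FGModuleCat.ofHom (LinearMap.toSpanSingleton R X x)

lemma hom_regMod_ext {X : FGModuleCat.{u} R} {f g : regMod R ⟶ X}
    (h : f.hom.hom (1 : R) = g.hom.hom (1 : R)) : f = g := by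
  apply FGModuleCat.hom_ext
  exact LinearMap.ext_ring h

lemma fromReg_eval {X : FGModuleCat.{u} R} (f : regMod R ⟶ X) :
    fromReg (f.hom.hom (1 : R)) = f :=
  hom_regMod_ext (one_smul R _)

/-- A finitely generated projective module splits off some `Rⁿ`, and the coordinates of `Rⁿ` give
the components. Projectivity can thus be treated as membership in an additive closure. -/
lemma projective_iff_addClosure {X : FGModuleCat.{u} R} :
    Module.Projective R X ↔ AddClosure (fun Y => Y = regMod R) X := by
  constructor
  · intro h
    obtain ⟨n, f, g, -, -, e⟩ := Module.Finite.exists_comp_eq_id_of_projective R X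
    refine ⟨n, fun _ => regMod R, fun i => FGModuleCat.ofHom ((LinearMap.proj i) ∘ₗ g),
      fun i => FGModuleCat.ofHom (f ∘ₗ LinearMap.single R (fun _ => R) i), fun _ => rfl, ?_⟩
    apply FGModuleCat.hom_ext
    ext x
    rw [fg_sum_apply]
    change ∑ i, f (Pi.single i (g x i)) = x
    rw [← map_sum, Finset.univ_sum_single]
    exact LinearMap.congr_fun e x
  · rintro ⟨n, Y, a, b, hY, e⟩
    obtain rfl : Y = fun _ => regMod R := funext hY
    refine Module.Projective.of_split (M := Fin n → R) (LinearMap.pi fun i => (a i).hom.hom)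
      (∑ i, (b i).hom.hom ∘ₗ LinearMap.proj i) ?_
    ext x
    have := congrArg (fun f : X ⟶ X => f.hom.hom x) e
    simp only [fg_sum_apply] at this
    simpa [LinearMap.sum_apply] using this

lemma projective_regMod : Module.Projective R (regMod R) :=
  inferInstanceAs (Module.Projective R R)

lemma projective_of_addClosure {S : ObjectProperty (FGModuleCat.{u} R)}
    (hS : ∀ X, S X → Module.Projective R X) {X : FGModuleCat.{u} R} (h : AddClosure S X) :
    Module.Projective R X :=
  projective_iff_addClosure.2 (h.bind fun Y hY => projective_iff_addClosure.1 (hS Y hY))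

lemma exists_surjection (X : FGModuleCat.{u} R) : ∃ (P : FGModuleCat.{u} R) (f : P ⟶ X),
    AddClosure (fun Y => Y = regMod R) P ∧ Function.Surjective f.hom.hom := by
  obtain ⟨n, f, hf⟩ := Module.Finite.exists_fin' R X
  exact ⟨FGModuleCat.of R (Fin n → R), FGModuleCat.ofHom f,
    projective_iff_addClosure.1 (inferInstanceAs (Module.Projective R (Fin n → R))), hf⟩

lemma projective_lift {P X Y : FGModuleCat.{u} R} (hP : Module.Projective R P) (f : X ⟶ Y)
    (hf : Function.Surjective f.hom.hom) (g : P ⟶ Y) : ∃ h : P ⟶ X, h ≫ f = g := by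
  obtain ⟨h, e⟩ := Module.projective_lifting_property f.hom.hom g.hom.hom hf
  exact ⟨FGModuleCat.ofHom h, FGModuleCat.hom_ext e⟩

lemma isZero_iff_forall {X : FGModuleCat.{u} R} : IsZero X ↔ ∀ x : X, x = 0 := by
  rw [IsZero.iff_id_eq_zero]
  constructor
  · intro h x
    exact congrArg (fun f : X ⟶ X => f.hom.hom x) h
  · intro h
    apply FGModuleCat.hom_ext
    ext x
    exact (h x).trans (h _).symm

/-! ### The functors `P ⊗ Hom(Q, -)` -/

variable (k) in
/-- The action of `R` on `P ⊗ Hom(Q, X)`. -/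
def homTensAct (P Q X : FGModuleCat.{u} R) : R →ₐ[k] Module.End k (P ⊗[k] (Q ⟶ X)) :=
  (Module.End.rTensorAlgHom k P (Q ⟶ X)).comp (Algebra.lsmul k k P)

@[simp] lemma homTensAct_tmul (P Q X : FGModuleCat.{u} R) (r : R) (p : P) (q : Q ⟶ X) :
    homTensAct k P Q X r (p ⊗ₜ q) = (r • p) ⊗ₜ q := rfl

lemma equivariant_of_tmul {V W : Type*} [AddCommGroup V] [Module k V] [AddCommGroup W] [Module k W]
    {N : Type*} [AddCommGroup N] [Module k N] {φ : V ⊗[k] W →ₗ[k] N} {ρ : Module.End k (V ⊗[k] W)}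
    {σ : Module.End k N} (h : ∀ v w, φ (ρ (v ⊗ₜ w)) = σ (φ (v ⊗ₜ w))) (t : V ⊗[k] W) :
    φ (ρ t) = σ (φ t) :=
  LinearMap.congr_fun (TensorProduct.ext' (g := φ ∘ₗ ρ) (h := σ ∘ₗ φ) h) t

variable (k) in
/-- The functor `P ⊗ Hom(Q, -)`. -/
def homTens (P Q : FGModuleCat.{u} R) : FGModuleCat.{u} R ⥤ FGModuleCat.{u} R where
  obj X := ofAct (homTensAct k P Q X)
  map {X Y} f := actHom _ _ ((Linear.rightComp k Q f).lTensor P)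
    (fun r => equivariant_of_tmul fun p q => rfl)
  map_id X := actHom_ext (TensorProduct.ext' fun p q => by
    change actEquiv (homTensAct k P Q X) (p ⊗ₜ (q ≫ 𝟙 X)) = _
    rw [Category.comp_id]
    rfl)
  map_comp {X Y Z} f g := actHom_ext (TensorProduct.ext' fun p q => by
    change actEquiv (homTensAct k P Q Z) (p ⊗ₜ (q ≫ f ≫ g)) = _
    rw [← Category.assoc]
    rfl)

variable (k) in
/-- The element `p ⊗ q` of `P ⊗ Hom(Q, X)`. -/
def ht {P Q X : FGModuleCat.{u} R} : P →ₗ[k] (Q ⟶ X) →ₗ[k] (homTens k P Q).obj X :=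
  (TensorProduct.mk k P (Q ⟶ X)).compr₂ (actEquiv (homTensAct k P Q X)).toLinearMap

lemma homTens_map_ht {P Q X Y : FGModuleCat.{u} R} (f : X ⟶ Y) (p : P) (q : Q ⟶ X) :
    ((homTens k P Q).map f).hom.hom (ht k p q) = ht k p (q ≫ f) := rfl

lemma homTens_hom_ext {P Q X Y : FGModuleCat.{u} R} {f g : (homTens k P Q).obj X ⟶ Y}
    (h : ∀ p q, f.hom.hom (ht k p q) = g.hom.hom (ht k p q)) : f = g :=
  actHom_ext (TensorProduct.ext' h)

lemma homTens_induction {P Q X : FGModuleCat.{u} R} {motive : (homTens k P Q).obj X → Prop}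
    (zero : motive 0) (add : ∀ x y, motive x → motive y → motive (x + y))
    (tmul : ∀ p q, motive (ht k p q)) (x : (homTens k P Q).obj X) : motive x := by
  obtain ⟨t, rfl⟩ := (actEquiv (homTensAct k P Q X)).surjective x
  induction t using TensorProduct.induction_on with
  | zero => exact zero
  | add s t hs ht => rw [map_add]; exact add _ _ hs ht
  | tmul p q => exact tmul p q

/-- The functor `P ⊗ Hom(Q, -)` as a functor in `P`. -/
def homTensMap {P P' : FGModuleCat.{u} R} (Q : FGModuleCat.{u} R) (α : P ⟶ P') :
    homTens k P Q ⟶ homTens k P' Q where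
  app X := actHom _ _ ((klin α).rTensor (Q ⟶ X)) (fun r => equivariant_of_tmul fun p q => by
    change (α.hom.hom (r • p)) ⊗ₜ[k] q = (r • α.hom.hom p) ⊗ₜ[k] q
    rw [map_smul])
  naturality X Y f := homTens_hom_ext fun p q => rfl

/-- The functor `P ⊗ Hom(Q, -)` as a contravariant functor in `Q`. -/
def homTensComap {Q Q' : FGModuleCat.{u} R} (P : FGModuleCat.{u} R) (β : Q' ⟶ Q) :
    homTens k P Q ⟶ homTens k P Q' where
  app X := actHom _ _ ((Linear.leftComp k X β).lTensor P) (fun r => equivariant_of_tmul fun p q => rfl)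
  naturality X Y f := homTens_hom_ext fun p q => by
    change ht k p (β ≫ q ≫ f) = ht k p ((β ≫ q) ≫ f)
    rw [Category.assoc]

variable (k) in
/-- The functor `P ⊗ Hom(Q, -)` as a functor in `P`. -/
def homTensFunctor (Q : FGModuleCat.{u} R) :
    FGModuleCat.{u} R ⥤ FGModuleCat.{u} R ⥤ FGModuleCat.{u} R where
  obj P := homTens k P Q
  map α := homTensMap Q α
  map_id P := by
    ext X : 2
    exact homTens_hom_ext fun p q => rfl
  map_comp α β := by
    ext X : 2
    exact homTens_hom_ext fun p q => rfl

instance (Q : FGModuleCat.{u} R) : (homTensFunctor k Q).Additive where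
  map_add {P P' α β} := by
    ext X : 2
    refine homTens_hom_ext fun p q => ?_
    change ht k (α.hom.hom p + β.hom.hom p) q = _
    rw [map_add]
    rfl

lemma AddClosure.homTens_left {S : ObjectProperty (FGModuleCat.{u} R)} (Q : FGModuleCat.{u} R)
    {P : FGModuleCat.{u} R} (h : AddClosure S P) :
    AddClosure (fun F => ∃ P', S P' ∧ F = homTens k P' Q) (homTens k P Q) :=
  h.map (homTensFunctor k Q) (fun P' hP' => .of_mem ⟨P', hP', rfl⟩)

lemma homTensComap_id (P Q : FGModuleCat.{u} R) : homTensComap (k := k) P (𝟙 Q) = 𝟙 _ := by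
  ext X : 2
  refine homTens_hom_ext fun p q => ?_
  change ht k p (𝟙 Q ≫ q) = _
  rw [Category.id_comp]
  rfl

lemma homTensComap_comp (P : FGModuleCat.{u} R) {Q Q' Q'' : FGModuleCat.{u} R} (β : Q' ⟶ Q)
    (β' : Q'' ⟶ Q') : homTensComap (k := k) P β ≫ homTensComap P β' = homTensComap P (β' ≫ β) := by
  ext X : 2
  refine homTens_hom_ext fun p q => ?_
  change ht k p (β' ≫ β ≫ q) = ht k p ((β' ≫ β) ≫ q)
  rw [Category.assoc]

lemma homTensComap_sum (P : FGModuleCat.{u} R) {Q Q' : FGModuleCat.{u} R} {ι : Type*} [Fintype ι]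
    (β : ι → (Q' ⟶ Q)) :
    homTensComap (k := k) P (∑ i, β i) = ∑ i, homTensComap (k := k) P (β i) := by
  ext X : 2
  refine homTens_hom_ext fun p q => ?_
  rw [NatTrans.app_sum, fg_sum_apply]
  change ht k p ((∑ i, β i) ≫ q) = ∑ i, ht k p (β i ≫ q)
  rw [Preadditive.sum_comp, map_sum]

/-- The functor is contravariant in `Q`, so the components `a` and `b` of the decomposition of `Q`
exchange their roles. -/
lemma AddClosure.homTens_right {S : ObjectProperty (FGModuleCat.{u} R)} (P : FGModuleCat.{u} R)
    {Q : FGModuleCat.{u} R} (h : AddClosure S Q) :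
    AddClosure (fun F => ∃ Q', S Q' ∧ F = homTens k P Q') (homTens k P Q) := by
  obtain ⟨n, Y, a, b, hY, e⟩ := h
  refine ⟨n, fun i => homTens k P (Y i), fun i => homTensComap P (b i),
    fun i => homTensComap P (a i), fun i => ⟨Y i, hY i, rfl⟩, ?_⟩
  simp only [homTensComap_comp]
  rw [← homTensComap_sum, e, homTensComap_id]

end FGModules
end FinRep
end

noncomputable section
namespace FinRep
open Module

/-! ### Values and composites of the functors `P ⊗ Hom(Q, -)` -/

section FGModules

attribute [local instance] Bimod.finite_of_fg finiteDimensional_hom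

variable {k : Type u} [Field k] {R : Type u} [Ring R] [Algebra k R] [FiniteDimensional k R]

lemma isIdempotentComplete_fgModuleCat (k : Type u) [Field k] (R : Type u) [Ring R]
    [Algebra k R] [FiniteDimensional k R] : IsIdempotentComplete (FGModuleCat.{u} R) :=
  haveI : IsNoetherianRing R := isNoetherian_of_tower k inferInstance
  inferInstance

lemma hasFiniteBiproducts_fgModuleCat (k : Type u) [Field k] (R : Type u) [Ring R]
    [Algebra k R] [FiniteDimensional k R] : HasFiniteBiproducts (FGModuleCat.{u} R) :=
  haveI : IsNoetherianRing R := isNoetherian_of_tower k inferInstance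
  Abelian.hasFiniteBiproducts

lemma hasLocalDecomposition_fgModuleCat (k : Type u) [Field k] {R : Type u} [Ring R]
    [Algebra k R] [FiniteDimensional k R] (X : FGModuleCat.{u} R) : HasLocalDecomposition X :=
  haveI := isIdempotentComplete_fgModuleCat k R
  hasLocalDecomposition k (fun X Y => finiteDimensional_hom X Y) X

variable (k) in
-- A basis of `Hom(Q, X)` identifies the module with a sum of copies of `P`: coordinate forms give
-- the projections, basis vectors the injections.
lemma addClosure_homTens_obj (P Q X : FGModuleCat.{u} R) :
    AddClosure (fun Y => Y = P) ((homTens k P Q).obj X) := by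
  let bs := Module.finBasis k (Q ⟶ X)
  let a (i) : P ⊗[k] (Q ⟶ X) →ₗ[k] P :=
    (TensorProduct.rid k P).toLinearMap ∘ₗ (bs.coord i).lTensor P
  have ha (i) (p : P) (q : Q ⟶ X) : a i (p ⊗ₜ q) = bs.coord i q • p := by simp [a]
  refine .of_fintype (fun _ => P)
    (fun i => homOfKlin (k := k) (a i ∘ₗ (actEquiv (homTensAct k P Q X)).symm.toLinearMap)
      (fun r => equivariant_of_tmul (φ := a i) (ρ := homTensAct k P Q X r)
        (σ := Algebra.lsmul k k P r) fun p q => ?_))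
    (fun i => homOfKlin (k := k) ((ht k).flip (bs i)) (fun r p => rfl)) (fun _ => rfl) ?_
  · rw [homTensAct_tmul, ha, ha]
    exact smul_comm _ _ _
  · refine homTens_hom_ext fun p q => ?_
    rw [fg_sum_apply]
    have key (i) : ((homOfKlin (k := k) (a i ∘ₗ (actEquiv (homTensAct k P Q X)).symm.toLinearMap)
      (fun r => equivariant_of_tmul (φ := a i) (ρ := homTensAct k P Q X r)
        (σ := Algebra.lsmul k k P r) fun p q => by
          rw [homTensAct_tmul, ha, ha]
          exact smul_comm _ _ _) ≫
          homOfKlin (k := k) ((ht k).flip (bs i)) (fun r p => rfl)).hom.hom (ht k p q)) =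
          bs.coord i q • ht k p (bs i) := by
      change ht k (a i (p ⊗ₜ q)) (bs i) = _
      rw [ha, map_smul]
      rfl
    refine (Finset.sum_congr rfl fun i _ => key i).trans ?_
    simp only [← map_smul, ← map_sum, Module.Basis.coord_apply]
    rw [bs.sum_repr]
    rfl

variable (k) in
lemma projective_homTens_obj {P : FGModuleCat.{u} R} (hP : Module.Projective R P)
    (Q X : FGModuleCat.{u} R) : Module.Projective R ((homTens k P Q).obj X) :=
  projective_of_addClosure (by rintro _ rfl; exact hP) (addClosure_homTens_obj k P Q X)

section Ext

variable {V : Type u} [AddCommGroup V] [Module k V] [FiniteDimensional k V]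

/-- The identification of `V ⊗ (P ⊗ Hom(Q, X))` with `(V ⊗ P) ⊗ Hom(Q, X)`. -/
def extHomTensEquiv (δ : R →ₐ[k] Module.End k V ⊗[k] R) (P Q X : FGModuleCat.{u} R) :
    V ⊗[k] ((homTens k P Q).obj X) ≃ₗ[k] ((extFunctor δ).obj P) ⊗[k] (Q ⟶ X) :=
  (actEquiv (homTensAct k P Q X)).symm.lTensor V ≪≫ₗ
    (TensorProduct.assoc k V P (Q ⟶ X)).symm ≪≫ₗ (actEquiv (extAct δ P)).rTensor (Q ⟶ X)

lemma extHomTens_hom_ext {P Q X : FGModuleCat.{u} R} {N : Type*} [AddCommGroup N] [Module k N]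
    {f g : V ⊗[k] ((homTens k P Q).obj X) →ₗ[k] N}
    (h : ∀ v p q, f (v ⊗ₜ ht k p q) = g (v ⊗ₜ ht k p q)) : f = g := by
  apply TensorProduct.ext'
  intro v t
  induction t using homTens_induction with
  | zero => simp
  | add t t' h h' => simp only [TensorProduct.tmul_add, map_add, h, h']
  | tmul p q => exact h v p q

lemma extHomTensEquiv_act (δ : R →ₐ[k] Module.End k V ⊗[k] R) (P Q X : FGModuleCat.{u} R) (r : R)
    (t : V ⊗[k] ((homTens k P Q).obj X)) :
    extHomTensEquiv δ P Q X (extAct δ _ r t) =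
      homTensAct k ((extFunctor δ).obj P) Q X r (extHomTensEquiv δ P Q X t) := by
  refine LinearMap.congr_fun (extHomTens_hom_ext
    (f := (extHomTensEquiv δ P Q X).toLinearMap ∘ₗ extAct δ _ r)
    (g := homTensAct k ((extFunctor δ).obj P) Q X r ∘ₗ (extHomTensEquiv δ P Q X).toLinearMap)
    fun v p q => ?_) t
  change extHomTensEquiv δ P Q X (endTensorEndAlgHom (R := k) (S := k) (A := k)
      (Algebra.TensorProduct.map (AlgHom.id k _) (Algebra.lsmul k k ((homTens k P Q).obj X)) (δ r))
        (v ⊗ₜ ht k p q)) =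
    actEquiv (extAct δ P) (endTensorEndAlgHom (R := k) (S := k) (A := k)
      (Algebra.TensorProduct.map (AlgHom.id k _) (Algebra.lsmul k k P) (δ r)) (v ⊗ₜ p)) ⊗ₜ[k] q
  -- Both sides are linear in `δ r`, and on a pure tensor they agree by definition.
  generalize δ r = d
  induction d using TensorProduct.induction_on with
  | zero => simp; rfl
  | add x y hx hy =>
    simp only [map_add, LinearMap.add_apply, TensorProduct.add_tmul] at hx hy ⊢
    rw [hx, hy]
    rfl
  | tmul φ s => rfl

/-- Composing `P ⊗ Hom(Q, -)` with an extension functor. -/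
def homTensExtIso (δ : R →ₐ[k] Module.End k V ⊗[k] R) (P Q : FGModuleCat.{u} R) :
    homTens k P Q ⋙ extFunctor δ ≅ homTens k ((extFunctor δ).obj P) Q :=
  NatIso.ofComponents
    (fun X => actIso _ _ (extHomTensEquiv δ P Q X) (extHomTensEquiv_act δ P Q X))
    (fun {X Y} f => actHom_ext (extHomTens_hom_ext fun v p q => rfl))

end Ext

variable (k) in
/-- Homomorphisms from the regular module. -/
def regHomEquiv (X : FGModuleCat.{u} R) : X ≃ₗ[k] (regMod R ⟶ X) :=
  LinearEquiv.symm
    { evalHomAt (k := k) (X := regMod R) (Y := X) (1 : R) with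
      invFun := fromReg
      left_inv := fromReg_eval
      right_inv := fun x => one_smul R x }

variable (k R) in
/-- The functor `R ⊗ Hom(R, -)`, which is isomorphic to `R ⊗ -`. -/
abbrev freeTens : FGModuleCat.{u} R ⥤ FGModuleCat.{u} R := homTens k (regMod R) (regMod R)

/-- Both `P` and `Q` are summands of free modules, and the construction is additive in each
variable. -/
lemma addClosure_freeTens {P Q : FGModuleCat.{u} R} (hP : Module.Projective R P)
    (hQ : Module.Projective R Q) : AddClosure (fun F => F = freeTens k R) (homTens k P Q) := by
  refine ((projective_iff_addClosure.1 hP).homTens_left Q).bind ?_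
  rintro _ ⟨_, rfl, rfl⟩
  refine ((projective_iff_addClosure.1 hQ).homTens_right (k := k) (regMod R)).mono ?_
  rintro _ ⟨_, rfl, rfl⟩
  rfl

/-! ### Contractions -/

/-- The map `λ ⊗ Hom(Q, X)` for a linear form `λ` on `P`. -/
def contract {P Q X : FGModuleCat.{u} R} (l : P →ₗ[k] k) :
    (homTens k P Q).obj X →ₗ[k] (Q ⟶ X) :=
  ((TensorProduct.lid k (Q ⟶ X)).toLinearMap ∘ₗ l.rTensor (Q ⟶ X)) ∘ₗ
    (actEquiv (homTensAct k P Q X)).symm.toLinearMap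

@[simp] lemma contract_ht {P Q X : FGModuleCat.{u} R} (l : P →ₗ[k] k) (p : P) (q : Q ⟶ X) :
    contract l (ht k p q) = l p • q := rfl

lemma contract_map {P Q X Y : FGModuleCat.{u} R} (l : P →ₗ[k] k) (f : X ⟶ Y)
    (t : (homTens k P Q).obj X) :
    contract l (((homTens k P Q).map f).hom.hom t) = contract l t ≫ f := by
  induction t using homTens_induction with
  | zero => rw [map_zero, map_zero, map_zero, zero_comp]
  | add x y hx hy => rw [map_add, map_add, map_add, hx, hy, Preadditive.add_comp]
  | tmul p q => rw [homTens_map_ht, contract_ht, contract_ht, Linear.smul_comp]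

/-- The natural transformation `P₀ ⊗ Hom(Q, -) ⟶ P₀ ⊗ Hom(Q', F -)` given by a natural family of
linear maps. -/
def homTensIn (P₀ : FGModuleCat.{u} R) {Q Q' : FGModuleCat.{u} R}
    {F : FGModuleCat.{u} R ⥤ FGModuleCat.{u} R} (φ : ∀ X, (Q ⟶ X) →ₗ[k] (Q' ⟶ F.obj X))
    (h : ∀ {X Y} (f : X ⟶ Y) (q : Q ⟶ X), φ Y (q ≫ f) = φ X q ≫ F.map f) :
    homTens k P₀ Q ⟶ F ⋙ homTens k P₀ Q' where
  app X := actHom _ _ ((φ X).lTensor P₀) (fun r => equivariant_of_tmul fun _ _ => rfl)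
  naturality X Y f := homTens_hom_ext fun e q => congrArg (ht k e) (h f q)

/-- The natural transformation `P₀ ⊗ Hom(Q', F -) ⟶ P₀ ⊗ Hom(Q, -)` given by a natural family of
linear maps. -/
def homTensOut (P₀ : FGModuleCat.{u} R) {Q Q' : FGModuleCat.{u} R}
    {F : FGModuleCat.{u} R ⥤ FGModuleCat.{u} R} (φ : ∀ X, (Q' ⟶ F.obj X) →ₗ[k] (Q ⟶ X))
    (h : ∀ {X Y} (f : X ⟶ Y) (q : Q' ⟶ F.obj X), φ Y (q ≫ F.map f) = φ X q ≫ f) :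
    F ⋙ homTens k P₀ Q' ⟶ homTens k P₀ Q where
  app X := actHom (homTensAct k P₀ Q' (F.obj X)) (homTensAct k P₀ Q X) ((φ X).lTensor P₀)
    (fun r => equivariant_of_tmul fun _ _ => rfl)
  naturality X Y f := homTens_hom_ext (P := P₀) (Q := Q') (X := F.obj X)
    fun e q => congrArg (ht k e) (h f q)

/-- The factor `P₀` is inert: the composite is governed by the family `q ↦ ψ (φ q ≫ α)` on `Hom(Q,
-)`, assumed to be precomposition with `z`. -/
lemma homTensIn_comp_homTensOut (P₀ : FGModuleCat.{u} R) {Q Q' : FGModuleCat.{u} R}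
    {F G : FGModuleCat.{u} R ⥤ FGModuleCat.{u} R} (α : F ⟶ G)
    (φ : ∀ X, (Q ⟶ X) →ₗ[k] (Q' ⟶ F.obj X)) (h) (ψ : ∀ X, (Q' ⟶ G.obj X) →ₗ[k] (Q ⟶ X)) (h')
    (z : Q ⟶ Q) (hz : ∀ X q, ψ X (φ X q ≫ α.app X) = z ≫ q) :
    homTensIn P₀ φ h ≫ Functor.whiskerRight α (homTens k P₀ Q') ≫ homTensOut P₀ ψ h' =
      homTensComap P₀ z := by
  ext X : 2
  exact homTens_hom_ext fun e q => congrArg (ht k e) (hz X q)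

/-- The natural transformation `P₀ ⊗ Hom(Q, -) ⟶ P₀ ⊗ Hom(R, P ⊗ Hom(Q, -))` given by an element
of `P`. -/
def insertNat (P₀ : FGModuleCat.{u} R) {P Q : FGModuleCat.{u} R} (p : P) :
    homTens k P₀ Q ⟶ homTens k P Q ⋙ homTens k P₀ (regMod R) :=
  homTensIn P₀ (fun X => (regHomEquiv k _).toLinearMap ∘ₗ ht k (X := X) p) fun {X Y} f q => by
    apply hom_regMod_ext
    change (1 : R) • ht k p (q ≫ f) = ((homTens k P Q).map f).hom.hom ((1 : R) • ht k p q)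
    rw [one_smul, one_smul, homTens_map_ht]

/-- The natural transformation `P₀ ⊗ Hom(R, P ⊗ Hom(Q, -)) ⟶ P₀ ⊗ Hom(Q, -)` given by a linear form
on `P`. -/
def contractNat (P₀ : FGModuleCat.{u} R) {P Q : FGModuleCat.{u} R} (l : P →ₗ[k] k) :
    homTens k P Q ⋙ homTens k P₀ (regMod R) ⟶ homTens k P₀ Q :=
  homTensOut P₀ (fun X => contract (X := X) l ∘ₗ (regHomEquiv k _).symm.toLinearMap)
    fun {X Y} f q => contract_map l f (q.hom.hom (1 : R))

/-- Yoneda: inserting `p`, applying `f` and contracting with `l` is a natural endomorphism of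
`Hom(Q, -)`, hence precomposition with its value at `𝟙 Q`. A transformation of functors is thereby
tested by an endomorphism of `Q`. -/
lemma insertNat_comp_contractNat {P₀ P P' Q : FGModuleCat.{u} R} (f : homTens k P Q ⟶ homTens k P' Q)
    (p : P) (l : P' →ₗ[k] k) :
    insertNat (k := k) P₀ p ≫ Functor.whiskerRight f (homTens k P₀ (regMod R)) ≫ contractNat P₀ l =
      homTensComap P₀ (contract l ((f.app Q).hom.hom (ht k p (𝟙 Q)))) := by
  refine homTensIn_comp_homTensOut P₀ f _ _ _ _ _ fun X q => ?_
  change contract l ((f.app X).hom.hom ((1 : R) • ht k p q)) = _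
  rw [one_smul, ← contract_map]
  have h := congrArg (fun g => g.hom.hom (ht k p (𝟙 Q))) (f.naturality q)
  change (f.app X).hom.hom (ht k p (𝟙 Q ≫ q)) =
    ((homTens k P' Q).map q).hom.hom ((f.app Q).hom.hom (ht k p (𝟙 Q))) at h
  rw [Category.id_comp] at h
  rw [h]

end FGModules
end FinRep
end

noncomputable section
namespace FinRep
open Module

section FGModules

attribute [local instance] Bimod.finite_of_fg finiteDimensional_hom

variable {k : Type u} [Field k] {R : Type u} [Ring R] [Algebra k R] [FiniteDimensional k R]

/-! ### Detecting direct summands -/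

/-- When `q` spans `Hom(Q, S)`, every tensor is elementary. -/
lemma exists_eq_ht {P Q S : FGModuleCat.{u} R} {q : Q ⟶ S} (hq : ∀ q', ∃ c : k, q' = c • q)
    (t : (homTens k P Q).obj S) : ∃ p : P, t = ht k p q := by
  induction t using homTens_induction with
  | zero => exact ⟨0, by simp⟩
  | add x y hx hy =>
    obtain ⟨p, rfl⟩ := hx
    obtain ⟨p', rfl⟩ := hy
    exact ⟨p + p', by simp⟩
  | tmul p q' =>
    obtain ⟨c, rfl⟩ := hq q'
    exact ⟨c • p, by simp⟩

lemma end_pow_comp {C : Type*} [Category* C] {X Y : C} {z : X ⟶ X} {q : X ⟶ Y} (h : z ≫ q = q)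
    (n : ℕ) : (End.of z ^ n : End X) ≫ q = q := by
  induction n with
  | zero => exact Category.id_comp q
  | succ n ih =>
    rw [pow_succ', End.mul_def, Category.assoc]
    exact (congrArg (fun f => (End.of z ^ n : End X) ≫ f) h).trans ih

/-- Choose `p` with `f (p ⊗ q) = p' ⊗ q ≠ 0` and a linear form `l` with `l p' = 1`. Contraction
turns `f` into an endomorphism `z` of `Q` with `z ≫ q = q`; it cannot be nilpotent, so it is
invertible, and the identity factors through the whiskered `f`. Hence an ideal invariant under left
composition that contains `f` contains an identity. -/
lemma exists_comp_eq_id_of_app_ne_zero (P₀ : FGModuleCat.{u} R) {P P' Q S : FGModuleCat.{u} R}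
    (hQ : ∀ z : End Q, IsUnit z ∨ IsNilpotent z) {q : Q ⟶ S} (hq : ∀ q', ∃ c : k, q' = c • q)
    (f : homTens k P Q ⟶ homTens k P' Q) (hf : f.app S ≠ 0) :
    ∃ (α : homTens k P₀ Q ⟶ homTens k P Q ⋙ homTens k P₀ (regMod R))
      (β : homTens k P' Q ⋙ homTens k P₀ (regMod R) ⟶ homTens k P₀ Q),
      α ≫ Functor.whiskerRight f _ ≫ β = 𝟙 _ := by
  obtain ⟨p, hp⟩ : ∃ p, (f.app S).hom.hom (ht k p q) ≠ 0 := by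
    by_contra! h
    refine hf (homTens_hom_ext fun p q' => ?_)
    obtain ⟨c, rfl⟩ := hq q'
    rw [map_smul, ← LinearMap.smul_apply, ← map_smul]
    exact h _
  obtain ⟨p', hp'⟩ := exists_eq_ht hq ((f.app S).hom.hom (ht k p q))
  rw [hp'] at hp
  have hp0 : p' ≠ 0 := by
    rintro rfl
    simp at hp
  have hq0 : q ≠ 0 := by
    rintro rfl
    simp at hp
  obtain ⟨l, hl⟩ : ∃ l : P' →ₗ[k] k, l p' = 1 := by
    obtain ⟨l, hl⟩ := not_forall.1 (mt (Module.forall_dual_apply_eq_zero_iff k p').1 hp0)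
    exact ⟨(l p')⁻¹ • l, by simp [inv_mul_cancel₀ hl]⟩
  -- Naturality of `f` along `q : Q ⟶ S` moves the computation from `𝟙 Q` to `f (p ⊗ q) = p' ⊗ q`,
  -- which contracts to `q`.
  have hz : contract l ((f.app Q).hom.hom (ht k p (𝟙 Q))) ≫ q = q := by
    rw [← contract_map]
    have h := congrArg (fun g => g.hom.hom (ht k p (𝟙 Q))) (f.naturality q)
    change (f.app S).hom.hom (ht k p (𝟙 Q ≫ q)) =
      ((homTens k P' Q).map q).hom.hom ((f.app Q).hom.hom (ht k p (𝟙 Q))) at h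
    rw [← h, Category.id_comp, hp', contract_ht, hl, one_smul]
  rcases hQ (End.of (contract l ((f.app Q).hom.hom (ht k p (𝟙 Q))))) with ⟨u, hu⟩ | ⟨n, hn⟩
  · refine ⟨insertNat P₀ p, contractNat P₀ l ≫ homTensComap P₀ (↑u⁻¹ : End Q), ?_⟩
    have h := insertNat_comp_contractNat (P₀ := P₀) f p l
    rw [← Category.assoc, ← Category.assoc, Category.assoc _ _ (contractNat P₀ l), h,
      homTensComap_comp]
    have e : (↑u⁻¹ : End Q) ≫ contract l ((f.app Q).hom.hom (ht k p (𝟙 Q))) = 𝟙 Q := by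
      have := u.mul_inv
      rw [hu] at this
      exact this
    rw [e, homTensComap_id]
  -- A nilpotent `z` fixing `q` would force `q = 0`.
  · have := end_pow_comp hz n
    rw [hn] at this
    exact absurd (this.symm.trans zero_comp) hq0

/-! ### Simple modules -/

/-- `Hom(Q, -)` is left exact and `P` is flat over the field `k`; projectivity of `Q` plays no role
for exactness in the middle. -/
lemma homTens_exact (P Q : FGModuleCat.{u} R) {X : FGModuleCat.{u} R} (N : Submodule R X)
    [Module.Finite R N] (t : (homTens k P Q).obj X)
    (ht : ((homTens k P Q).map (FGModuleCat.ofHom N.mkQ : X ⟶ FGModuleCat.of R (X ⧸ N))).hom.hom t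
      = 0) :
    ∃ s, ((homTens k P Q).map (FGModuleCat.ofHom N.subtype : FGModuleCat.of R N ⟶ X)).hom.hom s
      = t := by
  let π : X ⟶ FGModuleCat.of R (X ⧸ N) := FGModuleCat.ofHom N.mkQ
  let ι : FGModuleCat.of R N ⟶ X := FGModuleCat.ofHom N.subtype
  have hex : Function.Exact (Linear.rightComp k Q ι) (Linear.rightComp k Q π) := by
    intro q
    constructor
    · intro h
      have h' (x : Q) : q.hom.hom x ∈ N := by
        have : (q ≫ π).hom.hom x = 0 := congrArg (fun g : Q ⟶ _ => g.hom.hom x) h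
        exact (Submodule.Quotient.mk_eq_zero N).1 this
      exact ⟨FGModuleCat.ofHom (q.hom.hom.codRestrict N h'), rfl⟩
    · rintro ⟨q', rfl⟩
      apply FGModuleCat.hom_ext
      ext x
      exact (Submodule.Quotient.mk_eq_zero N).2 (q'.hom.hom x).2
  obtain ⟨s, hs⟩ := (Module.Flat.lTensor_exact P hex
    ((actEquiv (homTensAct k P Q X)).symm t)).1 ht
  exact ⟨actEquiv (homTensAct k P Q _) s, hs⟩

/-- Every non-zero homomorphism to `S` is surjective. -/
def IsSimpleTarget (S : FGModuleCat.{u} R) : Prop :=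
  ∀ (Y : FGModuleCat.{u} R) (g : Y ⟶ S), g ≠ 0 → Function.Surjective g.hom.hom

/-- Take `S` of minimal dimension with `e_S ≠ 0`. The image `N` of a non-zero, non-surjective map to
`S` would be a proper non-zero submodule, so `e` would vanish on `N` and on `S / N`; exactness in
the middle and `e ≫ e = e` then give `e_S = 0`. -/
lemma exists_simple_app_ne_zero {P Q : FGModuleCat.{u} R} (e : homTens k P Q ⟶ homTens k P Q)
    (he : e ≫ e = e) (h0 : e ≠ 0) : ∃ S, e.app S ≠ 0 ∧ IsSimpleTarget S := by
  have : IsNoetherianRing R := isNoetherian_of_tower k inferInstance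
  have hex : ∃ n, ∃ X : FGModuleCat.{u} R, finrank k X = n ∧ e.app X ≠ 0 := by
    by_contra! h
    exact h0 (by ext X : 2; exact h _ X rfl)
  classical
  obtain ⟨S, hS, hS0⟩ := Nat.find_spec hex
  have hmin (X : FGModuleCat.{u} R) (hX : finrank k X < finrank k S) : e.app X = 0 := by
    by_contra h
    exact Nat.find_min hex (hS ▸ hX) ⟨X, rfl, h⟩
  refine ⟨S, hS0, fun Y g hg => ?_⟩
  by_contra hsurj
  have : IsNoetherian R S := isNoetherian_of_isNoetherianRing_of_finite R S
  let N := LinearMap.range g.hom.hom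
  have hN1 : finrank k N < finrank k S := by
    change finrank k (N.restrictScalars k) < _
    refine Submodule.finrank_lt (fun h => hsurj ?_)
    exact LinearMap.range_eq_top.1 ((Submodule.restrictScalars_eq_top_iff k R S).1 h)
  have hN2 : finrank k (S ⧸ N) < finrank k S := by
    have h : 1 ≤ finrank k (N.restrictScalars k) := by
      refine Submodule.one_le_finrank_iff.2 fun h => hg (FGModuleCat.hom_ext ?_)
      exact LinearMap.range_eq_bot.1 ((Submodule.restrictScalars_eq_bot_iff k R S).1 h)
    have h2 : finrank k (S ⧸ N.restrictScalars k) + finrank k (N.restrictScalars k) =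
        finrank k S := Submodule.finrank_quotient_add_finrank (N.restrictScalars k)
    have h3 : finrank k (S ⧸ N) = finrank k (S ⧸ N.restrictScalars k) :=
      (Submodule.Quotient.restrictScalarsEquiv k N).symm.finrank_eq
    omega
  have e1 : e.app (FGModuleCat.of R N) = 0 := hmin _ hN1
  have e2 : e.app (FGModuleCat.of R (S ⧸ N)) = 0 := hmin _ hN2
  refine hS0 (FGModuleCat.hom_ext (LinearMap.ext fun t => ?_))
  have hee : (e.app S).hom.hom ((e.app S).hom.hom t) = (e.app S).hom.hom t :=
    
    congrArg (fun α : homTens k P Q ⟶ homTens k P Q => (α.app S).hom.hom t) he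
  -- Since `e` vanishes on `S / N`, the element `e t` comes from `N`; since `e` vanishes on `N`,
  -- applying `e` again gives zero. But `e (e t) = e t`.
  have n2 := congrArg (fun g => g.hom.hom t)
    (e.naturality (FGModuleCat.ofHom N.mkQ : S ⟶ FGModuleCat.of R (S ⧸ N)))
  rw [e2, comp_zero] at n2
  obtain ⟨s, hs⟩ := homTens_exact P Q N ((e.app S).hom.hom t) n2.symm
  have n1 := congrArg (fun g => g.hom.hom s)
    (e.naturality (FGModuleCat.ofHom N.subtype : FGModuleCat.of R N ⟶ S))
  rw [e1, zero_comp] at n1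
  have n1' : (e.app S).hom.hom
    (((homTens k P Q).map (FGModuleCat.ofHom N.subtype : FGModuleCat.of R N ⟶ S)).hom.hom s) = 0 := n1
  rw [hs, hee] at n1'
  exact n1'

/-- Any `q'` factors as `z ≫ q` because `Q` is projective and `q` is surjective. Write `z` as a
scalar plus a nilpotent `n`; the nilpotent part annihilates `q`, so `Hom(Q, S)` is spanned by `q`.
-/
lemma IsSimpleTarget.exists_smul_eq {Q S : FGModuleCat.{u} R} (hS : IsSimpleTarget S)
    (hQ : Module.Projective R Q) (hQ' : ∀ z : End Q, IsUnit z ∨ IsNilpotent z)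
    (hQ'' : ∀ z : End Q, ∃ c : k, IsNilpotent (z - algebraMap k _ c))
    {q : Q ⟶ S} (hq : q ≠ 0) (q' : Q ⟶ S) : ∃ c : k, q' = c • q := by
  obtain ⟨z, rfl⟩ := projective_lift hQ q (hS Q q hq) q'
  obtain ⟨c, hc⟩ := hQ'' (End.of z)
  refine ⟨c, ?_⟩
  set n : End Q := End.of z - algebraMap k _ c with hn
  have key : (n : Q ⟶ Q) ≫ q = 0 := by
    -- Otherwise `n ≫ q` is surjective and `q = w ≫ n ≫ q` for some `w`. Then `w ≫ n` fixes `q`, so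
    -- it is not nilpotent; if it were invertible, the nilpotent `n` would have a one-sided inverse,
    -- forcing `𝟙 Q = 0`.
    by_contra h
    obtain ⟨w, hw⟩ := projective_lift hQ _ (hS Q _ h) q
    have hw' : (n * End.of w : End Q) ≫ q = q := (Category.assoc _ _ _).trans hw
    rcases hQ' (n * End.of w) with ⟨u, hu⟩ | ⟨m, hm⟩
    · obtain ⟨m, hm⟩ := hc
      have h1 : n * (End.of w * ↑u⁻¹) = 1 := by rw [← mul_assoc, ← hu, u.mul_inv]
      have h2 := pow_mul_pow_eq_one m h1
      rw [hm, zero_mul] at h2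
      have h3 : 𝟙 Q = 0 := h2.symm
      exact hq (by rw [← Category.id_comp q, h3, zero_comp])
    · have h1 := end_pow_comp (z := (n * End.of w : End Q)) hw' m
      have h2 : (End.of (n * End.of w : End Q) ^ m : End Q) = 0 := hm
      rw [h2] at h1
      exact hq (h1.symm.trans zero_comp)
  have hz : z = (show Q ⟶ Q from n) + c • 𝟙 Q := (sub_add_cancel (End.of z) (algebraMap k _ c)).symm
  have key' : (show Q ⟶ Q from n) ≫ q = 0 := key
  rw [hz, Preadditive.add_comp, key', zero_add, Linear.smul_comp, Category.id_comp]

end FGModules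
end FinRep
end

noncomputable section
namespace FinRep
open Module

/-! ### Good functors: finiteness of morphism spaces and action on projective modules -/

section GoodFunctors

attribute [local instance] Bimod.finite_of_fg finiteDimensional_hom

section

variable {k : Type u} [Field k] {R : Type u} [Ring R] [Algebra k R] [FiniteDimensional k R]

/-- The evaluation `P ⊗ Hom(P, X) ⟶ X`. -/
def evalTens (P X : FGModuleCat.{u} R) : (homTens k P P).obj X ⟶ X :=
  homOfKlin (k := k) (TensorProduct.lift (klinLin k P X).flip ∘ₗ
      (actEquiv (homTensAct k P P X)).symm.toLinearMap)
    (fun r => equivariant_of_tmul (φ := TensorProduct.lift (klinLin k P X).flip)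
      (ρ := homTensAct k P P X r) (σ := Algebra.lsmul k k X r) fun p q => q.hom.hom.map_smul r p)

variable (k) in
-- Evaluation `R ⊗ Hom(R, X) ⟶ X` is surjective, so it splits when `X` is projective.
lemma isSummand_freeTens_obj {X : FGModuleCat.{u} R} (hX : Module.Projective R X) :
    IsSummand X ((freeTens k R).obj X) := by
  obtain ⟨s, hs⟩ := projective_lift hX (evalTens (k := k) (regMod R) X) (fun x =>
    ⟨ht k (1 : R) (fromReg x), one_smul R x⟩) (𝟙 X)
  exact ⟨⟨s, _, hs⟩⟩

lemma extFunctor_surjective {V : Type u} [AddCommGroup V] [Module k V] [FiniteDimensional k V]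
    (δ : R →ₐ[k] Module.End k V ⊗[k] R) {X Y : FGModuleCat.{u} R} (f : X ⟶ Y)
    (hf : Function.Surjective f.hom.hom) :
    Function.Surjective ((extFunctor δ).map f).hom.hom :=
  LinearMap.lTensor_surjective V (g := klin f) hf

lemma AddClosure.surjective {S : ObjectProperty (FGModuleCat.{u} R ⥤ FGModuleCat.{u} R)}
    (hS : ∀ F, S F → ∀ {X Y : FGModuleCat.{u} R} (f : X ⟶ Y), Function.Surjective f.hom.hom →
      Function.Surjective (F.map f).hom.hom)
    {F : FGModuleCat.{u} R ⥤ FGModuleCat.{u} R} (hF : AddClosure S F) {X Y : FGModuleCat.{u} R}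
    (f : X ⟶ Y) (hf : Function.Surjective f.hom.hom) : Function.Surjective (F.map f).hom.hom := by
  obtain ⟨n, G, a, b, hG, e⟩ := hF
  intro y
  choose w hw using fun i => hS _ (hG i) f hf (((a i).app Y).hom.hom y)
  refine ⟨∑ i, ((b i).app X).hom.hom (w i), ?_⟩
  rw [map_sum]
  have h1 (i) : (F.map f).hom.hom (((b i).app X).hom.hom (w i)) =
      ((a i ≫ b i).app Y).hom.hom y := by
    have := congrArg (fun g => g.hom.hom (w i)) ((b i).naturality f)
    refine Eq.trans this.symm ?_
    change ((b i).app Y).hom.hom (((G i).map f).hom.hom (w i)) = _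
    rw [hw]
    rfl
  simp only [h1]
  have h2 := congrArg (fun α : F ⟶ F => (α.app Y).hom.hom y) e
  simp only [NatTrans.app_sum, fg_sum_apply] at h2
  exact h2

/-- A natural transformation is determined by its component at the regular module: additivity passes
vanishing to summands of `Rⁿ`, and a surjection from such a module, preserved by `F`, passes it to
any `X`. -/
lemma finiteDimensional_natTrans {F G : FGModuleCat.{u} R ⥤ FGModuleCat.{u} R}
    (hF : ∀ {X Y : FGModuleCat.{u} R} (f : X ⟶ Y), Function.Surjective f.hom.hom →
      Function.Surjective (F.map f).hom.hom)
    (hF' : ∀ {X Y : FGModuleCat.{u} R} (f g : X ⟶ Y), F.map (f + g) = F.map f + F.map g) :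
    FiniteDimensional k (F ⟶ G) := by
  let φ : (F ⟶ G) →ₗ[k] (F.obj (regMod R) ⟶ G.obj (regMod R)) :=
    { toFun := fun α => α.app _
      map_add' := fun _ _ => rfl
      map_smul' := fun _ _ => rfl }
  refine Module.Finite.of_injective φ ((injective_iff_map_eq_zero φ).2 fun α hα => ?_)
  have : F.Additive := ⟨hF' _ _⟩
  have hα : α.app (regMod R) = 0 := hα
  ext X : 2
  obtain ⟨P, f, ⟨n, Y, a, b, hY, e⟩, hf⟩ := exists_surjection X
  obtain rfl : Y = fun _ => regMod R := funext hY
  have hP : α.app P = 0 := by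
    have h1 := F.map_id P
    rw [← e, F.map_sum] at h1
    rw [← Category.id_comp (α.app P), ← h1, Preadditive.sum_comp]
    refine Finset.sum_eq_zero fun i _ => ?_
    rw [F.map_comp, Category.assoc, α.naturality, ← Category.assoc, Category.assoc]
    rw [hα, zero_comp, comp_zero]
  refine fg_surjective_epi (F.map f) (hF f hf) ?_
  rw [α.naturality, hP, zero_comp, NatTrans.app_zero, comp_zero]

end

variable {k : Type u} [Field k] {A B : Type u} [Ring A] [Ring B] [Algebra k A] [Algebra k B]
  [FiniteDimensional k A] [FiniteDimensional k B]

lemma IsGood.surjective {F : FGModuleCat.{u} (A ⊗[k] B) ⥤ FGModuleCat.{u} (A ⊗[k] B)}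
    (hF : IsGood k A B F) {X Y : FGModuleCat.{u} (A ⊗[k] B)} (f : X ⟶ Y)
    (hf : Function.Surjective f.hom.hom) : Function.Surjective (F.map f).hom.hom := by
  refine AddClosure.surjective (fun F hF X Y f hf => ?_) (isGood_iff.1 hF) f hf
  rcases hF with rfl | rfl | rfl | rfl
  · exact hf
  all_goals exact extFunctor_surjective _ f hf

lemma IsGood.of_addClosure {F : FGModuleCat.{u} (A ⊗[k] B) ⥤ FGModuleCat.{u} (A ⊗[k] B)}
    (hF : AddClosure (IsGood k A B) F) : IsGood k A B F :=
  hF.bind fun _ h => h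

instance (F G : GoodFun k A B) : FiniteDimensional k (F ⟶ G) :=
  haveI : FiniteDimensional k (F.obj ⟶ G.obj) :=
    finiteDimensional_natTrans F.property.surjective F.property.map_add
  finiteDimensional_fullSubcategory k F G

instance : IsIdempotentComplete (GoodFun k A B) :=
  haveI := isIdempotentComplete_fgModuleCat k (A ⊗[k] B)
  isIdempotentComplete_fullSubcategory fun _ => IsGood.of_addClosure

lemma hasLocalDecomposition_goodFun (F : GoodFun k A B) : HasLocalDecomposition F :=
  hasLocalDecomposition k (fun _ _ => inferInstance) F

lemma IsIndecomposable.isLocalRing_end_goodFun {F : GoodFun k A B} (hF : IsIndecomposable F) :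
    IsLocalRing (End F) :=
  hF.isLocalRing_end k

/-- The identification of `E ⊗ X` with `P ⊗ Hom(E, X)`, for a free module `P` with basis `p`. -/
def freeTensEquiv (P : FGModuleCat.{u} (A ⊗[k] B)) (p : P)
    (hp : Function.Bijective (fun r : A ⊗[k] B => r • p)) (X : FGModuleCat.{u} (A ⊗[k] B)) :
    (A ⊗[k] B) ⊗[k] X ≃ₗ[k] P ⊗[k] (regMod (A ⊗[k] B) ⟶ X) :=
  TensorProduct.congr (LinearEquiv.ofBijective ((Algebra.lsmul k k P).toLinearMap.flip p) hp)
    (regHomEquiv k X)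

/-- The free functor is isomorphic to `P ⊗ Hom(E, -)`, for a free module `P` with basis `p`. -/
def freeTensIsoOfBasis (P : FGModuleCat.{u} (A ⊗[k] B)) (p : P)
    (hp : Function.Bijective (fun r : A ⊗[k] B => r • p)) :
    extFunctor (deltaF k A B) ≅ homTens k P (regMod (A ⊗[k] B)) :=
  NatIso.ofComponents (fun X => actIso (extAct (deltaF k A B) X)
      (homTensAct k P (regMod (A ⊗[k] B)) X) (freeTensEquiv P p hp X)
      (fun r => equivariant_of_tmul (φ := (freeTensEquiv P p hp X).toLinearMap)
        (ρ := extAct (deltaF k A B) X r)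
        (σ := homTensAct k P (regMod (A ⊗[k] B)) X r) fun s x => by
          rw [extAct_deltaF]
          change ((r * s) • p) ⊗ₜ[k] fromReg x = (r • s • p) ⊗ₜ[k] fromReg x
          rw [mul_smul]))
    (fun {X Y} f => actHom_ext (TensorProduct.ext' fun s x =>
      congrArg (ht k (s • p))
        (hom_regMod_ext (f := fromReg (f.hom.hom x)) (g := fromReg x ≫ f)
          (f.hom.hom.map_smul 1 x).symm)))

variable (k A B) in
/-- The free functor is isomorphic to `E ⊗ Hom(E, -)`. -/
def freeTensIso : extFunctor (deltaF k A B) ≅ freeTens k (A ⊗[k] B) :=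
  freeTensIsoOfBasis (regMod (A ⊗[k] B)) (1 : A ⊗[k] B)
    ⟨fun r s h => (mul_one r).symm.trans (h.trans (mul_one s)), fun r => ⟨r, mul_one r⟩⟩

lemma projective_extFunctor_deltaF (X : FGModuleCat.{u} (A ⊗[k] B)) :
    Module.Projective (A ⊗[k] B) ((extFunctor (deltaF k A B)).obj X) :=
  projective_of_addClosure (by rintro _ rfl; exact projective_homTens_obj k projective_regMod _ X)
    (.of_iso ((freeTensIso k A B).app X) rfl)

lemma homTens_good {P Q : FGModuleCat.{u} (A ⊗[k] B)} (hP : projObj P) (hQ : projObj Q) :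
    IsGood k A B (homTens k P Q) := by
  rw [isGood_iff]
  refine (addClosure_freeTens hP hQ).bind ?_
  rintro _ rfl
  exact .of_iso (freeTensIso k A B).symm (Or.inr (Or.inl rfl))

variable (k A B) in
-- The free functor is the right functor followed by the left one, and two consecutive left functors
-- reduce to copies of one.
lemma free_left : AddClosure (fun F => F = extFunctor (deltaF k A B))
    (extFunctor (deltaF k A B) ⋙ extFunctor (deltaL k A B)) := by
  refine .trans_iso (Functor.isoWhiskerRight (leftRightIso k A B).symm _ ≪≫
    Functor.associator _ _ _) ((leftLeft k A B).precomp _ ?_)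
  rintro _ rfl
  exact .of_iso (leftRightIso k A B) rfl

variable (k A B) in
lemma free_right : AddClosure (fun F => F = extFunctor (deltaF k A B))
    (extFunctor (deltaF k A B) ⋙ extFunctor (deltaR k A B)) := by
  refine .trans_iso (Functor.isoWhiskerRight (rightLeftIso k A B).symm _ ≪≫
    Functor.associator _ _ _) ((rightRight k A B).precomp _ ?_)
  rintro _ rfl
  exact .of_iso (rightLeftIso k A B) rfl

lemma AddClosure.app {S : ObjectProperty (FGModuleCat.{u} (A ⊗[k] B) ⥤ FGModuleCat.{u} (A ⊗[k] B))}
    {T : ObjectProperty (FGModuleCat.{u} (A ⊗[k] B))}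
    {F : FGModuleCat.{u} (A ⊗[k] B) ⥤ FGModuleCat.{u} (A ⊗[k] B)} (hF : AddClosure S F)
    (X : FGModuleCat.{u} (A ⊗[k] B)) (h : ∀ G, S G → AddClosure T (G.obj X)) :
    AddClosure T (F.obj X) :=
  haveI : ((evaluation _ (FGModuleCat.{u} (A ⊗[k] B))).obj X).Additive := ⟨rfl⟩
  hF.map ((evaluation _ _).obj X) h

/-- A projective `X` is a summand of `E ⊗ X`, and the hypothesis says that the functor maps `E ⊗ X`
to a summand of a sum of copies of it. -/
lemma projective_extFunctor_of_free {V : Type u} [AddCommGroup V] [Module k V]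
    [FiniteDimensional k V] (δ : A ⊗[k] B →ₐ[k] Module.End k V ⊗[k] (A ⊗[k] B))
    (h : AddClosure (fun F => F = extFunctor (deltaF k A B))
      (extFunctor (deltaF k A B) ⋙ extFunctor δ))
    {X : FGModuleCat.{u} (A ⊗[k] B)} (hX : projObj X) : projObj ((extFunctor δ).obj X) := by
  have h1 : AddClosure projObj ((extFunctor (deltaF k A B) ⋙ extFunctor δ).obj X) :=
    h.app X (by rintro _ rfl; exact .of_mem (projective_extFunctor_deltaF X))
  have h2 : IsSummand X ((extFunctor (deltaF k A B)).obj X) :=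
    (isSummand_freeTens_obj k hX).trans (.of_iso ((freeTensIso k A B).app X).symm)
  exact projective_of_addClosure (fun _ h => h) (h1.of_isSummand (h2.map (extFunctor δ)))

lemma IsGood.projective {F : FGModuleCat.{u} (A ⊗[k] B) ⥤ FGModuleCat.{u} (A ⊗[k] B)}
    (hF : IsGood k A B F) {X : FGModuleCat.{u} (A ⊗[k] B)} (hX : projObj X) :
    projObj (F.obj X) := by
  refine projective_of_addClosure (fun _ h => h) ((isGood_iff.1 hF).app (T := projObj) X ?_)
  rintro G (rfl | rfl | rfl | rfl)
  · exact .of_mem hX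
  · exact .of_mem (projective_extFunctor_deltaF X)
  · exact .of_mem (projective_extFunctor_of_free _ (free_left k A B) hX)
  · exact .of_mem (projective_extFunctor_of_free _ (free_right k A B) hX)

/-- The functors `P ⊗ Hom(Q, -)` for projective modules `P`. -/
def IsHomTens (Q : FGModuleCat.{u} (A ⊗[k] B)) :
    ObjectProperty (FGModuleCat.{u} (A ⊗[k] B) ⥤ FGModuleCat.{u} (A ⊗[k] B)) :=
  fun F => ∃ P, projObj P ∧ F = homTens k P Q

/-- Applying an extension functor after `P ⊗ Hom(Q, -)` changes only the projective module `P`. So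
`Q` is an invariant of left composition, which is why it labels left cells. -/
lemma IsHomTens.comp {Q : FGModuleCat.{u} (A ⊗[k] B)}
    {F G : FGModuleCat.{u} (A ⊗[k] B) ⥤ FGModuleCat.{u} (A ⊗[k] B)} (hF : IsHomTens Q F)
    (hG : IsGood k A B G) : AddClosure (IsHomTens Q) (F ⋙ G) := by
  obtain ⟨P, hP, rfl⟩ := hF
  refine (isGood_iff.1 hG).precomp _ ?_
  rintro G (rfl | rfl | rfl | rfl)
  · exact .of_iso (Functor.rightUnitor _) ⟨P, hP, rfl⟩
  · exact .of_iso (homTensExtIso _ P Q) ⟨_, projective_extFunctor_deltaF P, rfl⟩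
  · exact .of_iso (homTensExtIso _ P Q)
      ⟨_, projective_extFunctor_of_free _ (free_left k A B) hP, rfl⟩
  · exact .of_iso (homTensExtIso _ P Q)
      ⟨_, projective_extFunctor_of_free _ (free_right k A B) hP, rfl⟩

lemma IsHomTens.addClosure_comp {Q : FGModuleCat.{u} (A ⊗[k] B)}
    {F G : FGModuleCat.{u} (A ⊗[k] B) ⥤ FGModuleCat.{u} (A ⊗[k] B)}
    (hF : AddClosure (IsHomTens Q) F) (hG : IsGood k A B G) :
    AddClosure (IsHomTens Q) (F ⋙ G) := by
  have : G.Additive := ⟨hG.map_add _ _⟩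
  exact hF.postcomp G fun F hF => hF.comp hG

/-! ### One-sided projective modules -/

section OneSided

variable {k : Type u} [Field k] {R S : Type u} [Ring R] [Algebra k R] [Ring S] [Algebra k S]

/-- A homomorphism to the restriction of scalars along `φ : S → R` of an `R`-module lifts along
surjections of `R`-modules. -/
lemma exists_lift_restrictScalars (φ : S →+* R) {X : Type u} [AddCommGroup X] [Module S X]
    [Module.Projective S X] {N Y : Type u} [AddCommGroup N] [Module R N] [AddCommGroup Y]
    [Module R Y] (f : N →ₗ[R] Y) (hf : Function.Surjective f) (g : X →+ Y)
    (hg : ∀ s x, g (s • x) = φ s • g x) :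
    ∃ h : X →+ N, (∀ s x, h (s • x) = φ s • h x) ∧ ∀ x, f (h x) = g x := by
  let _ : Module S N := Module.compHom N φ
  let _ : Module S Y := Module.compHom Y φ
  let f' : N →ₗ[S] Y := { f with map_smul' := fun s x => f.map_smul (φ s) x }
  let g' : X →ₗ[S] Y := { g with map_smul' := hg }
  obtain ⟨h, hh⟩ := Module.projective_lifting_property f' g' hf
  exact ⟨h.toAddMonoidHom, fun s x => h.map_smul s x, fun x => LinearMap.congr_fun hh x⟩

end OneSided

/-- The hypotheses present `V ⊗ X` as the module induced from the `S`-module `X`: `v₀ ⊗ X` is a copy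
of `X` over `S`, the elements `ψ v` carry it onto the slices `v ⊗ X`, and `h` records how `a ⊗ b`
moves past `ψ v`. A surjection onto an induced module splits by lifting over `S` and extending. Both
one-sided free functors are instances. -/
lemma projective_extFunctor_of_restrictScalars {S : Type u} [Ring S] [Algebra k S] {V : Type u}
    [AddCommGroup V] [Module k V] [FiniteDimensional k V]
    (δ : A ⊗[k] B →ₐ[k] Module.End k V ⊗[k] (A ⊗[k] B)) (φ : S →ₐ[k] A ⊗[k] B)
    (ψ : V →ₗ[k] A ⊗[k] B) (v₀ : V) {X : FGModuleCat.{u} (A ⊗[k] B)}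
    (hX : Module.Projective S ((ModuleCat.restrictScalars φ.toRingHom).obj X.obj))
    (h₀ : ∀ (s : S) (x : X), extAct δ X (φ s) (v₀ ⊗ₜ x) = v₀ ⊗ₜ (φ s • x))
    (hψ : ∀ (v : V) (x : X), extAct δ X (ψ v) (v₀ ⊗ₜ x) = v ⊗ₜ x)
    (h : ∀ (a : A) (b : B) (v : V), ∃ (v' : V) (s : S),
      (∀ x : X, extAct δ X (a ⊗ₜ b) (v ⊗ₜ x) = v' ⊗ₜ (φ s • x)) ∧ (a ⊗ₜ b) * ψ v = ψ v' * φ s) :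
    projObj ((extFunctor δ).obj X) := by
  refine Module.Projective.of_lifting_property'' fun f hf => ?_
  let g : X →+ (extFunctor δ).obj X :=
    ((actEquiv (extAct δ X)).toLinearMap ∘ₗ TensorProduct.mk k V X v₀).toAddMonoidHom
  obtain ⟨l, hl, hl'⟩ := exists_lift_restrictScalars φ.toRingHom
    (X := (ModuleCat.restrictScalars φ.toRingHom).obj X.obj) f hf g
    (fun s x => congrArg (actEquiv (extAct δ X)) (h₀ s x).symm)
  replace hl (s : S) (x : X) : l (φ s • x) = φ s • l x := hl s x
  replace hl' (x : X) : f (l x) = actEquiv (extAct δ X) (v₀ ⊗ₜ x) := hl' x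
  let N := (extFunctor δ).obj X →₀ A ⊗[k] B
  -- The lift commutes with `S`, in particular with the scalars of `k`.
  let lk : X →ₗ[k] N :=
    { toFun := l
      map_add' := fun x y => l.map_add x y
      map_smul' := fun c x => by
        have := hl (algebraMap k S c) x
        rwa [AlgHom.commutes, algebraMap_smul, algebraMap_smul] at this }
  -- The section is forced: `v ⊗ x = ψ v • (v₀ ⊗ x)` must go to `ψ v • l x`.
  let σ : V ⊗[k] X →ₗ[k] N :=
    TensorProduct.lift (((Algebra.lsmul k k N : A ⊗[k] B →ₐ[k] _).toLinearMap.comp ψ).compl₂ lk)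
  have hσ (v x) : σ (v ⊗ₜ x) = ψ v • l x := rfl
  have hσ' (r : A ⊗[k] B) (t : V ⊗[k] X) : σ (extAct δ X r t) = r • σ t := by
    refine equivariant_of_tmul (φ := σ) (ρ := extAct δ X r) (σ := Algebra.lsmul k k N r)
      (fun v x => ?_) t
    change σ (extAct δ X r (v ⊗ₜ x)) = r • σ (v ⊗ₜ x)
    induction r using TensorProduct.induction_on with
    | zero => simp
    | add s s' e e' => simp only [map_add, LinearMap.add_apply, e, e', add_smul]
    | tmul a b =>
      obtain ⟨v', s, e, e'⟩ := h a b v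
      rw [e, hσ, hσ, hl, ← mul_smul, ← mul_smul, e']
  have hf' (t : V ⊗[k] X) : f (σ t) = actEquiv (extAct δ X) t := by
    induction t using TensorProduct.induction_on with
    | zero => simp; rfl
    | add s s' e e' => simp only [map_add, e, e']; rfl
    | tmul v x =>
      rw [hσ, map_smul, hl']
      exact congrArg (actEquiv (extAct δ X)) (hψ v x)
  refine ⟨{ toFun := fun t => σ ((actEquiv (extAct δ X)).symm t)
            map_add' := fun t t' => σ.map_add ((actEquiv (extAct δ X)).symm t)
              ((actEquiv (extAct δ X)).symm t')
            map_smul' := fun r t => hσ' r _ }, LinearMap.ext fun t => hf' _⟩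

/-- Here `A` acts on the new factor and only `B` acts on `X`, so `A ⊗ X` is induced from the
`B`-module `X`; projectivity over `B` is what is needed. -/
lemma projective_extFunctor_deltaL {X : FGModuleCat.{u} (A ⊗[k] B)} (hX : IsRightProjective X) :
    projObj ((extFunctor (deltaL k A B)).obj X) := by
  refine projective_extFunctor_of_restrictScalars (deltaL k A B)
    Algebra.TensorProduct.includeRight
    (Algebra.TensorProduct.includeLeft : A →ₐ[k] A ⊗[k] B).toLinearMap 1 hX ?_ ?_ ?_
  · intro s x
    rw [Algebra.TensorProduct.includeRight_apply, extAct_deltaL, one_mul]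
  · intro a x
    change extAct (deltaL k A B) X (a ⊗ₜ 1) _ = _
    rw [extAct_deltaL, mul_one, ← Algebra.TensorProduct.one_def, one_smul]
  · intro a b a'
    refine ⟨a * a', b, fun x => by rw [extAct_deltaL]; rfl, ?_⟩
    change (a ⊗ₜ b) * (a' ⊗ₜ 1) = ((a * a') ⊗ₜ 1) * (1 ⊗ₜ b)
    simp

/-- The mirror image: `B ⊗ X` is induced from the `A`-module `X`. -/
lemma projective_extFunctor_deltaR {X : FGModuleCat.{u} (A ⊗[k] B)} (hX : IsLeftProjective X) :
    projObj ((extFunctor (deltaR k A B)).obj X) := by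
  refine projective_extFunctor_of_restrictScalars (deltaR k A B)
    Algebra.TensorProduct.includeLeft
    (Algebra.TensorProduct.includeRight : B →ₐ[k] A ⊗[k] B).toLinearMap 1 hX ?_ ?_ ?_
  · intro s x
    rw [Algebra.TensorProduct.includeLeft_apply, extAct_deltaR, one_mul]
  · intro a x
    change extAct (deltaR k A B) X (1 ⊗ₜ a) _ = _
    rw [extAct_deltaR, mul_one, ← Algebra.TensorProduct.one_def, one_smul]
  · intro a b b'
    refine ⟨b * b', a, fun x => by rw [extAct_deltaR]; rfl, ?_⟩
    change (a ⊗ₜ b) * (1 ⊗ₜ b') = (1 ⊗ₜ (b * b')) * (a ⊗ₜ 1)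
    simp

end GoodFunctors
end FinRep
end

noncomputable section
namespace FinRep
open Module

/-! ### The centre of a tensor product and the identity functor -/

section Center

variable {k A B : Type*} [Field k] [Ring A] [Algebra k A] [Ring B] [Algebra k B]

/-- Commuting with `A ⊗ 1` puts `z` into `Z(A) ⊗ B`. This embeds into `A ⊗ B` by flatness, so
commuting with `1 ⊗ B` can be tested there and puts `z` into `Z(A) ⊗ Z(B)`. -/
lemma exists_map_center_eq {z : A ⊗[k] B} (hz : ∀ x, x * z = z * x) :
    ∃ w : Subalgebra.center k A ⊗[k] Subalgebra.center k B,
      Algebra.TensorProduct.map (Subalgebra.center k A).val (Subalgebra.center k B).val w = z := by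
  have h1 : z ∈ Subalgebra.centralizer k
      ((Algebra.TensorProduct.includeLeft : A →ₐ[k] A ⊗[k] B).range : Set (A ⊗[k] B)) :=
    Subalgebra.mem_centralizer_iff k |>.2 fun x _ => hz x
  rw [Subalgebra.centralizer_coe_range_includeLeft_eq_center_tensorProduct] at h1
  obtain ⟨w, rfl⟩ := h1
  have hinj : Function.Injective
      (Algebra.TensorProduct.map (Subalgebra.center k A).val (AlgHom.id k B)) :=
    Module.Flat.rTensor_preserves_injective_linearMap (M := B)
      (Subalgebra.center k A).val.toLinearMap Subtype.val_injective
  have h2 : w ∈ Subalgebra.centralizer k ((Algebra.TensorProduct.includeRight :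
      B →ₐ[k] Subalgebra.center k A ⊗[k] B).range : Set (Subalgebra.center k A ⊗[k] B)) := by
    refine Subalgebra.mem_centralizer_iff k |>.2 fun x _ => hinj ?_
    rw [map_mul, map_mul]
    exact hz _
  rw [Subalgebra.centralizer_range_includeRight_eq_center_tensorProduct] at h2
  obtain ⟨w, rfl⟩ := h2
  exact ⟨w, LinearMap.congr_fun (TensorProduct.ext' (g := (Algebra.TensorProduct.map
    (Subalgebra.center k A).val (Subalgebra.center k B).val).toLinearMap)
    (h := (Algebra.TensorProduct.map (Subalgebra.center k A).val (AlgHom.id k B)).toLinearMap ∘ₗ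
      (Algebra.TensorProduct.map (AlgHom.id k _) (Subalgebra.center k B).val).toLinearMap)
    fun a b => rfl) w⟩

lemma exists_isNilpotent_add {C : Type*} [CommRing C] [Algebra k C] {x y : C}
    (hx : ∃ c : k, IsNilpotent (x - algebraMap k C c))
    (hy : ∃ c : k, IsNilpotent (y - algebraMap k C c)) :
    ∃ c : k, IsNilpotent (x + y - algebraMap k C c) := by
  obtain ⟨c, hc⟩ := hx
  obtain ⟨d, hd⟩ := hy
  refine ⟨c + d, ?_⟩
  rw [map_add, add_sub_add_comm]
  exact (Commute.all _ _).isNilpotent_add hc hd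

lemma exists_isNilpotent_mul {C : Type*} [CommRing C] [Algebra k C] {x y : C}
    (hx : ∃ c : k, IsNilpotent (x - algebraMap k C c))
    (hy : ∃ c : k, IsNilpotent (y - algebraMap k C c)) :
    ∃ c : k, IsNilpotent (x * y - algebraMap k C c) := by
  obtain ⟨c, hc⟩ := hx
  obtain ⟨d, hd⟩ := hy
  refine ⟨c * d, ?_⟩
  have : x * y - algebraMap k C (c * d) =
      x * (y - algebraMap k C d) + algebraMap k C d * (x - algebraMap k C c) := by
    rw [map_mul]
    ring
  rw [this]
  exact (Commute.all _ _).isNilpotent_add ((Commute.all _ _).isNilpotent_mul_left hd)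
    ((Commute.all _ _).isNilpotent_mul_left hc)

lemma _root_.IsNilpotent.map_sub_algebraMap {R S : Type*} [Ring R] [Algebra k R] [Ring S]
    [Algebra k S] (φ : R →ₐ[k] S) {x : R} {c : k} (h : IsNilpotent (x - algebraMap k R c)) :
    IsNilpotent (φ x - algebraMap k S c) := by
  have := h.map φ
  rwa [map_sub, AlgHom.commutes] at this

/-- In a commutative algebra the elements of the form scalar plus nilpotent are closed under sums
and products, and pure tensors are products of such elements. -/
lemma exists_isNilpotent_tensorProduct {C D : Type*} [CommRing C] [Algebra k C] [CommRing D]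
    [Algebra k D] (hC : ∀ x : C, ∃ c : k, IsNilpotent (x - algebraMap k C c))
    (hD : ∀ x : D, ∃ c : k, IsNilpotent (x - algebraMap k D c)) (w : C ⊗[k] D) :
    ∃ c : k, IsNilpotent (w - algebraMap k (C ⊗[k] D) c) := by
  induction w using TensorProduct.induction_on with
  | zero => exact ⟨0, by rw [map_zero, sub_zero]; exact .zero⟩
  | add x y hx hy => exact exists_isNilpotent_add hx hy
  | tmul a b =>
    have : a ⊗ₜ[k] b = (a ⊗ₜ 1) * (1 ⊗ₜ b) := by simp
    rw [this]
    refine exists_isNilpotent_mul ?_ ?_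
    · obtain ⟨c, hc⟩ := hC a
      exact ⟨c, hc.map_sub_algebraMap (Algebra.TensorProduct.includeLeft : C →ₐ[k] C ⊗[k] D)⟩
    · obtain ⟨c, hc⟩ := hD b
      exact ⟨c, hc.map_sub_algebraMap (Algebra.TensorProduct.includeRight : D →ₐ[k] C ⊗[k] D)⟩

/-- For `c = 0` the idempotent is nilpotent, hence `0`; for `c ≠ 0` it is invertible, hence `1`. -/
lemma eq_zero_or_one_of_isNilpotent_sub {R : Type*} [Ring R] [Algebra k R] {e : R}
    (he : IsIdempotentElem e) {c : k} (h : IsNilpotent (e - algebraMap k R c)) :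
    e = 0 ∨ e = 1 := by
  by_cases hc : c = 0
  · subst hc
    rw [map_zero, sub_zero] at h
    obtain ⟨n, hn⟩ := h
    exact Or.inl (by rw [← he.pow_succ_eq n, pow_succ, hn, zero_mul])
  · right
    have hu : IsUnit e := by
      have := h.isUnit_add_right_of_commute ((isUnit_iff_ne_zero.2 hc).map (algebraMap k R))
        ((Algebra.commutes c _).symm)
      rwa [sub_add_cancel] at this
    exact hu.mul_left_cancel (by rw [he, mul_one])

lemma IsConnectedAlgebra.op {A : Type*} [Ring A] (hA : IsConnectedAlgebra A) : IsConnectedAlgebra Aᵐᵒᵖ := by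
  have := hA.1
  refine ⟨inferInstance, fun e he he' => ?_⟩
  rcases hA.2 e.unop (Subring.mem_center_iff.2 fun a =>
      (congrArg MulOpposite.unop (Subring.mem_center_iff.1 he (MulOpposite.op a))).symm)
      (congrArg MulOpposite.unop he') with h | h
  · exact Or.inl (MulOpposite.unop_injective h)
  · exact Or.inr (MulOpposite.unop_injective h)

variable [FiniteDimensional k A] [FiniteDimensional k B] [IsAlgClosed k]

/-- Connectedness says that the centre has only trivial idempotents, so over an algebraically closed
field its elements are scalars up to nilpotents. -/
lemma IsConnectedAlgebra.exists_isNilpotent (hA : IsConnectedAlgebra A)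
    (a : Subalgebra.center k A) : ∃ c : k, IsNilpotent (a - algebraMap k _ c) := by
  have := hA.1
  refine exists_isNilpotent_sub_algebraMap (fun e he => ?_) a
  rcases hA.2 e.1 e.2 (congrArg Subtype.val he) with h | h
  · exact Or.inl (Subtype.ext h)
  · exact Or.inr (Subtype.ext h)

/-- A central element comes from `Z(A) ⊗ Z(B)`, whose elements are scalars up to nilpotents; such an
idempotent is trivial. Algebraic closedness is what makes the tensor product connected. -/
lemma IsConnectedAlgebra.tensorProduct (hA : IsConnectedAlgebra A) (hB : IsConnectedAlgebra B)
    {z : A ⊗[k] B} (hz : ∀ x, x * z = z * x) (he : IsIdempotentElem z) : z = 0 ∨ z = 1 := by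
  obtain ⟨w, rfl⟩ := exists_map_center_eq hz
  obtain ⟨c, hc⟩ := exists_isNilpotent_tensorProduct (k := k) hA.exists_isNilpotent
    hB.exists_isNilpotent w
  exact eq_zero_or_one_of_isNilpotent_sub he (hc.map_sub_algebraMap
    (Algebra.TensorProduct.map (Subalgebra.center k A).val (Subalgebra.center k B).val))

end Center

/-! ### Endomorphisms of the identity functor -/

section Identity

attribute [local instance] Bimod.finite_of_fg finiteDimensional_hom

variable {k : Type u} [Field k]

/-- Naturality along the map from the regular module sending `1` to `x`. -/
lemma app_eq_smul {R : Type u} [Ring R] (α : 𝟭 (FGModuleCat.{u} R) ⟶ 𝟭 _)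
    (X : FGModuleCat.{u} R) (x : X) : (α.app X).hom.hom x =
      ((α.app (FGModuleCat.of R R)).hom.hom (1 : R) : R) • x := by
  let f : FGModuleCat.of R R ⟶ X := FGModuleCat.ofHom (LinearMap.toSpanSingleton R X x)
  have h : (α.app X).hom.hom (f.hom.hom (1 : R)) =
      f.hom.hom ((α.app (FGModuleCat.of R R)).hom.hom (1 : R)) :=
    congrArg (fun g : FGModuleCat.of R R ⟶ X => g.hom.hom (1 : R)) (α.naturality f)
  have h1 : f.hom.hom (1 : R) = x := one_smul R x
  rwa [h1] at h

/-- An endomorphism of the identity functor is multiplication by a central element, its value at `1`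
in the regular module. -/
lemma eq_zero_or_id_of_idempotent {R : Type u} [Ring R]
    (hR : ∀ z : R, (∀ x, x * z = z * x) → IsIdempotentElem z → z = 0 ∨ z = 1)
    (α : 𝟭 (FGModuleCat.{u} R) ⟶ 𝟭 _) (hα : α ≫ α = α) : α = 0 ∨ α = 𝟙 _ := by
  let z : R := (α.app (regMod R)).hom.hom (1 : R)
  have hc (x : R) : x * z = z * x := by
    refine Eq.trans ?_ (app_eq_smul α (regMod R) x)
    refine ((α.app (regMod R)).hom.hom.map_smul x (1 : R)).symm.trans ?_
    exact congrArg (α.app (regMod R)).hom.hom (mul_one x)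
  have hi : IsIdempotentElem z :=
    (app_eq_smul α (regMod R) z).symm.trans
      (congrArg (fun β : 𝟭 (FGModuleCat.{u} R) ⟶ 𝟭 _ => (β.app (regMod R)).hom.hom (1 : R)) hα)
  rcases hR _ hc hi with h | h
  · left
    ext X : 2
    refine FGModuleCat.hom_ext (LinearMap.ext fun x => ?_)
    exact (app_eq_smul α X x).trans ((congrArg (· • x) h).trans (zero_smul R x))
  · right
    ext X : 2
    refine FGModuleCat.hom_ext (LinearMap.ext fun x => ?_)
    exact (app_eq_smul α X x).trans ((congrArg (· • x) h).trans (one_smul R x))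

variable {A : Type u} [Ring A] [Algebra k A] [FiniteDimensional k A] [IsAlgClosed k]

/-- An idempotent endomorphism corresponds to a central idempotent of `A ⊗ Aᵐᵒᵖ`, which is trivial
since both factors are connected. -/
lemma isIndecomposable_unit (hA : IsConnectedAlgebra A) :
    IsIndecomposable (𝟙_ (GoodFun k A Aᵐᵒᵖ)) := by
  refine isIndecomposable_of_idempotents (fun h => ?_) fun e he => ?_
  · have h2 : (1 : A ⊗[k] Aᵐᵒᵖ) = 0 :=
      congrArg (fun f : 𝟙_ (GoodFun k A Aᵐᵒᵖ) ⟶ 𝟙_ (GoodFun k A Aᵐᵒᵖ) =>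
        (f.hom.app (regMod (A ⊗[k] Aᵐᵒᵖ))).hom.hom (1 : A ⊗[k] Aᵐᵒᵖ)) ((IsZero.iff_id_eq_zero _).1 h)
    have := hA.1
    exact one_ne_zero h2
  · rcases eq_zero_or_id_of_idempotent (fun z => hA.tensorProduct hA.op)
      e.hom (congrArg (fun f => f.hom) he) with h | h
    · exact Or.inl (ObjectProperty.hom_ext _ h)
    · exact Or.inr (ObjectProperty.hom_ext _ h)

end Identity
end FinRep
end

noncomputable section
namespace FinRep
open Module

/-! ### Morphisms between objects of additive closures -/

section AddClosureMaps

variable {C D : Type*} [Category* C] [Preadditive C] [Category* D] [Preadditive D]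

/-- Fullness is checked on generators: a morphism is cut into its matrix of components, each
component is lifted, and the lifts are reassembled. -/
lemma exists_map_eq_of_addClosure (Φ : C ⥤ D) [Φ.Additive] {S T : ObjectProperty C}
    (h : ∀ Y Y', S Y → T Y' → ∀ g : Φ.obj Y ⟶ Φ.obj Y', ∃ f, Φ.map f = g) {X X' : C}
    (hX : AddClosure S X) (hX' : AddClosure T X') (g : Φ.obj X ⟶ Φ.obj X') :
    ∃ f, Φ.map f = g := by
  obtain ⟨n, Y, a, b, hY, e⟩ := hX
  obtain ⟨m, Y', a', b', hY', e'⟩ := hX'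
  choose f hf using fun i j => h (Y i) (Y' j) (hY i) (hY' j) (Φ.map (b i) ≫ g ≫ Φ.map (a' j))
  refine ⟨∑ i, a i ≫ ∑ j, f i j ≫ b' j, ?_⟩
  simp only [Functor.map_sum, Functor.map_comp, hf, Category.assoc]
  have h1 : ∑ j, Φ.map (a' j) ≫ Φ.map (b' j) = 𝟙 _ := by
    rw [← Φ.map_id, ← e', Φ.map_sum]
    simp
  have h2 : ∑ i, Φ.map (a i) ≫ Φ.map (b i) = 𝟙 _ := by
    rw [← Φ.map_id, ← e, Φ.map_sum]
    simp
  have h3 (i) : ∑ j, Φ.map (b i) ≫ g ≫ Φ.map (a' j) ≫ Φ.map (b' j) = Φ.map (b i) ≫ g := by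
    rw [← Preadditive.comp_sum, ← Preadditive.comp_sum, h1, Category.comp_id]
  simp only [h3]
  simp only [← Category.assoc]
  rw [← Preadditive.sum_comp, h2, Category.id_comp]

/-- A morphism is the sum of its components between generators, so if `Φ` kills all of these it
kills the morphism. -/
lemma exists_component_ne_zero (Φ : C ⥤ D) [Φ.Additive] {S T : ObjectProperty C} {X X' : C}
    (hX : AddClosure S X) (hX' : AddClosure T X') {f : X ⟶ X'} (hf : Φ.map f ≠ 0) :
    ∃ (Y Y' : C) (b : Y ⟶ X) (a : X' ⟶ Y'), S Y ∧ T Y' ∧ Φ.map (b ≫ f ≫ a) ≠ 0 := by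
  obtain ⟨n, Y, a, b, hY, e⟩ := hX
  obtain ⟨m, Y', a', b', hY', e'⟩ := hX'
  by_contra! h
  refine hf ?_
  have h1 : f = ∑ i, ∑ j, a i ≫ (b i ≫ f ≫ a' j) ≫ b' j := by
    have h2 : f = (∑ i, a i ≫ b i) ≫ f ≫ ∑ j, a' j ≫ b' j := by
      rw [e, e', Category.id_comp, Category.comp_id]
    refine h2.trans ?_
    simp only [Preadditive.sum_comp, Preadditive.comp_sum, Category.assoc]
    exact Finset.sum_comm
  rw [h1]
  simp only [Functor.map_sum]
  refine Finset.sum_eq_zero fun i _ => Finset.sum_eq_zero fun j _ => ?_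
  rw [Φ.map_comp, Φ.map_comp, h _ _ _ _ (hY i) (hY' j), zero_comp, comp_zero]

lemma AddClosure.of_isZero {S : ObjectProperty C} {X : C} (h : IsZero X) : AddClosure S X :=
  ⟨0, fun i => i.elim0, fun i => i.elim0, fun i => i.elim0, fun i => i.elim0, h.eq_of_src _ _⟩

lemma isFinitaryCategory_of_fintype (k : Type*) [Field k] [Linear k C]
    (hbi : HasFiniteBiproducts C) (hidem : IsIdempotentComplete C)
    (hfin : ∀ X Y : C, FiniteDimensional k (X ⟶ Y)) {ι : Type*} [Fintype ι] (Y : ι → C)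
    (hY : ∀ i, IsLocalRing (End (Y i))) (h : ∀ X, AddClosure (fun Z => ∃ i, Z = Y i) X) :
    IsFinitaryCategory k C :=
  isFinitaryCategory_of_generators k hbi hidem hfin (fun j => Y ((Fintype.equivFin ι).symm j))
    (fun j => hY _) fun X => (h X).mono (by
      rintro _ ⟨i, rfl⟩
      exact ⟨Fintype.equivFin ι i, by simp⟩)

namespace HomIdeal

variable {k : Type*} [Field k] [Linear k C]

lemma exists_sum_of_mem_generatedBy {P : ObjectProperty C} {X Y : C} {f : X ⟶ Y}
    (hf : f ∈ (generatedBy (k := k) P).hom X Y) :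
    ∃ (ι : Type) (_ : Fintype ι) (Z : ι → C) (a : ∀ i, X ⟶ Z i) (b : ∀ i, Z i ⟶ Y),
      (∀ i, P (Z i)) ∧ ∑ i, a i ≫ b i = f := by
  change f ∈ Submodule.span k _ at hf
  induction hf using Submodule.span_induction with
  | mem f hf =>
    obtain ⟨Z, hZ, a, b, rfl⟩ := hf
    exact ⟨Unit, inferInstance, fun _ => Z, fun _ => a, fun _ => b, fun _ => hZ, by simp⟩
  | zero => exact ⟨Empty, inferInstance, fun i => i.elim, fun i => i.elim, fun i => i.elim,
      fun i => i.elim, by simp⟩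
  | add f g _ _ hf hg =>
    obtain ⟨ι, _, Z, a, b, hZ, rfl⟩ := hf
    obtain ⟨ι', _, Z', a', b', hZ', rfl⟩ := hg
    refine ⟨ι ⊕ ι', inferInstance, Sum.elim Z Z', fun | .inl i => a i | .inr i => a' i,
      fun | .inl i => b i | .inr i => b' i, fun | .inl i => hZ i | .inr i => hZ' i, ?_⟩
    rw [Fintype.sum_sum_type]
    rfl
  | smul c f _ hf =>
    obtain ⟨ι, _, Z, a, b, hZ, rfl⟩ := hf
    exact ⟨ι, inferInstance, Z, fun i => c • a i, b, hZ, by simp [Finset.smul_sum]⟩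

lemma mem_generatedBy_of_sum {P : ObjectProperty C} {X Y : C} {ι : Type*} [Fintype ι]
    {Z : ι → C} {a : ∀ i, X ⟶ Z i} {b : ∀ i, Z i ⟶ Y} (hZ : ∀ i, P (Z i)) :
    ∑ i, a i ≫ b i ∈ (generatedBy (k := k) P).hom X Y :=
  Submodule.sum_mem _ fun i _ => Submodule.subset_span ⟨Z i, hZ i, a i, b i, rfl⟩

/-- An identity written as a sum of morphisms through objects of `P` is a splitting off a sum of
these objects. -/
lemma addClosure_of_id_mem_generatedBy {P : ObjectProperty C} {X : C}
    (h : 𝟙 X ∈ (generatedBy (k := k) P).hom X X) : AddClosure P X := by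
  obtain ⟨ι, _, Z, a, b, hZ, e⟩ := exists_sum_of_mem_generatedBy h
  exact .of_fintype Z a b hZ e

/-- The intermediate objects lie in `P`, hence in `Q`, so a factorization found in `C` already lives
in the subcategory. -/
lemma mem_generatedBy_fullSubcategory_iff {P Q : ObjectProperty C} (h : P ≤ Q)
    {X Y : Q.FullSubcategory} (f : X ⟶ Y) :
    f ∈ (generatedBy (k := k) (fun X : Q.FullSubcategory => P X.obj)).hom X Y ↔
      f.hom ∈ (generatedBy (k := k) P).hom X.obj Y.obj := by
  constructor
  · intro hf
    obtain ⟨ι, _, Z, a, b, hZ, rfl⟩ := exists_sum_of_mem_generatedBy hf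
    have : (∑ i, a i ≫ b i).hom = ∑ i, (a i).hom ≫ (b i).hom := Q.ι.map_sum _ _
    rw [this]
    exact mem_generatedBy_of_sum hZ
  · intro hf
    obtain ⟨ι, _, Z, a, b, hZ, e⟩ := exists_sum_of_mem_generatedBy hf
    have : f = ∑ i, (ObjectProperty.homMk (a i) : X ⟶ ⟨Z i, h _ (hZ i)⟩) ≫
        ObjectProperty.homMk (b i) := by
      apply ObjectProperty.hom_ext
      exact e.symm.trans (Q.ι.map_sum _ _).symm
    rw [this]
    exact mem_generatedBy_of_sum (P := fun X : Q.FullSubcategory => P X.obj)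
      (Z := fun i => ⟨Z i, h _ (hZ i)⟩) hZ

end HomIdeal

end AddClosureMaps

/-! ### The invariant subcategories -/

section Invariant

attribute [local instance] Bimod.finite_of_fg finiteDimensional_hom

variable {k : Type u} [Field k] {A B : Type u} [Ring A] [Ring B] [Algebra k A] [Algebra k B]
  [FiniteDimensional k A] [FiniteDimensional k B]

lemma projObj_of_addClosure {X : FGModuleCat.{u} (A ⊗[k] B)} (h : AddClosure projObj X) :
    projObj X :=
  projective_of_addClosure (fun _ h => h) h

lemma projObj_of_isSummand {X Y : FGModuleCat.{u} (A ⊗[k] B)} (h : IsSummand X Y)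
    (hY : projObj Y) : projObj X :=
  projObj_of_addClosure ((AddClosure.of_mem hY).of_isSummand h)

variable (k A B) in
lemma projObj_invariant : (defining k A B).IsInvariant projObj :=
  fun (F : GoodFun k A B) (_ : FGModuleCat.{u} (A ⊗[k] B)) hX => F.property.projective hX

/-- The additive closure of the free and the one-sided free functors. -/
def IsLowerFun : ObjectProperty (FGModuleCat.{u} (A ⊗[k] B) ⥤ FGModuleCat.{u} (A ⊗[k] B)) :=
  AddClosure fun F => F = extFunctor (deltaF k A B) ∨ F = extFunctor (deltaL k A B) ∨
    F = extFunctor (deltaR k A B)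

/-- The only place where the two one-sided projectivity assumptions on the module are combined: each
serves one of the one-sided free functors, and the free functor needs neither. -/
lemma IsLowerFun.projective {F : FGModuleCat.{u} (A ⊗[k] B) ⥤ FGModuleCat.{u} (A ⊗[k] B)}
    (hF : IsLowerFun F) {M : FGModuleCat.{u} (A ⊗[k] B)} (hl : IsLeftProjective M)
    (hr : IsRightProjective M) : projObj (F.obj M) := by
  refine projObj_of_addClosure (AddClosure.app hF M ?_)
  rintro G (rfl | rfl | rfl)
  · exact .of_mem (projective_extFunctor_deltaF M)
  · exact .of_mem (projective_extFunctor_deltaL hr)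
  · exact .of_mem (projective_extFunctor_deltaR hl)

lemma addProj_invariant {M : FGModuleCat.{u} (A ⊗[k] B)} (hl : IsLeftProjective M)
    (hr : IsRightProjective M) : (defining k A B).IsInvariant (addProj M) := by
  intro (F : GoodFun k A B) (X : FGModuleCat.{u} (A ⊗[k] B)) hX
  have : F.obj.Additive := ⟨F.property.map_add _ _⟩
  refine AddClosure.map F.obj (fun Y hY => ?_) hX
  rcases hY with hY | rfl
  · exact .of_mem (Or.inl (F.property.projective hY))
  · refine (isGood_iff.1 F.property).app Y fun G hG => ?_
    rcases hG with rfl | hG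
    · exact .of_mem (Or.inr rfl)
    · exact .of_mem (Or.inl (IsLowerFun.projective (.of_mem hG) hl hr))

lemma IsElementary.isGood {F : FGModuleCat.{u} (A ⊗[k] B) ⥤ FGModuleCat.{u} (A ⊗[k] B)}
    (hF : IsElementary k A B F) : IsGood k A B F :=
  isGood_iff.2 (.of_mem hF)

lemma addClosure_goodFun (F : GoodFun k A B) :
    AddClosure (fun G : GoodFun k A B => IsElementary k A B G.obj) F :=
  addClosure_fullSubcategory (fun _ h => h.isGood) (isGood_iff.1 F.property)

lemma goodFun_eq_unit {F : GoodFun k A B} (h : F.obj = 𝟭 _) : F = 𝟙_ (GoodFun k A B) := by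
  obtain ⟨F, hF⟩ := F
  obtain rfl : F = 𝟭 _ := h
  rfl

/-- With a local endomorphism ring, `F` is a summand of a single elementary functor; if that is the
identity, indecomposability of the latter makes them isomorphic. -/
lemma iso_unit_or_isLowerFun (h1 : IsIndecomposable (𝟙_ (GoodFun k A B))) {F : GoodFun k A B}
    (hF : IsIndecomposable F) : Nonempty (F ≅ 𝟙_ (GoodFun k A B)) ∨ IsLowerFun F.obj := by
  have := hF.isLocalRing_end_goodFun
  have := h1.isLocalRing_end_goodFun
  obtain ⟨G, hG, hFG⟩ := (addClosure_goodFun F).exists_isSummand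
  rcases hG with hG | hG
  · obtain rfl := goodFun_eq_unit hG
    exact Or.inl (hFG.nonempty_iso_of_isLocalRing hF.1)
  · exact Or.inr (AddClosure.of_isSummand (isSummand_fullSubcategory_iff.1 hFG) (.of_mem hG))

variable (k A B) in
/-- The functor `E ⊗ Hom(E, -)` as a good functor. -/
def freeGood : GoodFun k A B :=
  ⟨freeTens k (A ⊗[k] B), homTens_good projective_regMod projective_regMod⟩

/-- The line spanned by `q` splits off from `Hom(Q, X)` over `k`, and `P` tensored with this line is
a copy of `P`. -/
lemma isSummand_homTens_obj {P Q X : FGModuleCat.{u} (A ⊗[k] B)} {q : Q ⟶ X} (hq : q ≠ 0) :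
    IsSummand P ((homTens k P Q).obj X) := by
  obtain ⟨l, hl⟩ : ∃ l : (Q ⟶ X) →ₗ[k] k, l q = 1 := by
    obtain ⟨l, hl⟩ := not_forall.1 (mt (Module.forall_dual_apply_eq_zero_iff k q).1 hq)
    exact ⟨(l q)⁻¹ • l, by simp [inv_mul_cancel₀ hl]⟩
  let c : P ⊗[k] (Q ⟶ X) →ₗ[k] P := (TensorProduct.rid k P).toLinearMap ∘ₗ l.lTensor P
  have hc (p q) : c (p ⊗ₜ q) = l q • p := by simp [c]
  refine ⟨⟨homOfKlin (k := k) ((ht k).flip q) (fun r p => rfl),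
    homOfKlin (k := k) (c ∘ₗ (actEquiv (homTensAct k P Q X)).symm.toLinearMap)
      (fun r => equivariant_of_tmul (φ := c) (ρ := homTensAct k P Q X r)
        (σ := Algebra.lsmul k k P r) fun p q => ?_), ?_⟩⟩
  · rw [homTensAct_tmul, hc, hc]
    exact smul_comm _ _ _
  · refine FGModuleCat.hom_ext (LinearMap.ext fun p => ?_)
    exact (hc p q).trans (by rw [hl, one_smul]; rfl)

/-- A non-zero element of `X` is a non-zero map from the regular module, so the regular module is a
summand of the value at `X`, and with it every indecomposable projective. -/
lemma isSummand_freeGood_obj {X Y : FGModuleCat.{u} (A ⊗[k] B)} (hX : ¬ IsZero X)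
    (hY : projObj Y) [IsLocalRing (End Y)] : IsSummand Y ((freeGood k A B).obj.obj X) := by
  obtain ⟨Z, rfl, hZ⟩ := (projective_iff_addClosure.1 hY).exists_isSummand
  refine hZ.trans ?_
  rw [isZero_iff_forall] at hX
  push Not at hX
  obtain ⟨x, hx⟩ := hX
  refine isSummand_homTens_obj (q := fromReg x) fun h => hx ?_
  have := congrArg (fun g : regMod (A ⊗[k] B) ⟶ X => g.hom.hom (1 : A ⊗[k] B)) h
  exact (one_smul (A ⊗[k] B) x).symm.trans this

lemma exists_projective_isLocalRing_end [Nontrivial (A ⊗[k] B)] :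
    ∃ Y : FGModuleCat.{u} (A ⊗[k] B), projObj Y ∧ IsLocalRing (End Y) := by
  obtain ⟨Y, hY, hY'⟩ := (hasLocalDecomposition_fgModuleCat k (regMod (A ⊗[k] B))).exists_isSummand
    (fun h => one_ne_zero (α := A ⊗[k] B) (isZero_iff_forall.1 h (1 : A ⊗[k] B)))
  exact ⟨Y, projObj_of_isSummand hY' projective_regMod, hY⟩

/-! ### Finitarity -/

lemma addProj_of_addClosure {M X : FGModuleCat.{u} (A ⊗[k] B)} (h : AddClosure (addProj M) X) :
    addProj M X :=
  h.bind fun _ h => h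

variable (k A B) in
lemma exists_projective_generators : ∃ (n : ℕ) (Y : Fin n → FGModuleCat.{u} (A ⊗[k] B)),
    (∀ i, projObj (Y i) ∧ IsLocalRing (End (Y i))) ∧
      ∀ X, projObj X → AddClosure (fun Z => ∃ i, Z = Y i) X := by
  obtain ⟨n, Y, a, b, hY, e⟩ :=
    (hasLocalDecomposition_fgModuleCat k (regMod (A ⊗[k] B))).addClosure
  refine ⟨n, Y, fun i => ⟨projObj_of_isSummand (hY i).2 projective_regMod, (hY i).1⟩,
    fun X hX => (projective_iff_addClosure.1 hX).bind ?_⟩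
  rintro _ rfl
  exact ⟨n, Y, a, b, fun i => ⟨i, rfl⟩, e⟩

variable (k A B) in
lemma isFinitaryCategory_projObj :
    IsFinitaryCategory k (projObj (k := k) (A := A) (B := B)).FullSubcategory := by
  have := isIdempotentComplete_fgModuleCat k (A ⊗[k] B)
  have := hasFiniteBiproducts_fgModuleCat k (A ⊗[k] B)
  obtain ⟨n, Y, hY, hgen⟩ := exists_projective_generators k A B
  refine isFinitaryCategory_of_fintype k
    (hasFiniteBiproducts_fullSubcategory fun _ => projObj_of_addClosure)
    (isIdempotentComplete_fullSubcategory fun _ => projObj_of_addClosure)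
    (fun X Y => finiteDimensional_fullSubcategory k X Y) (fun i => ⟨Y i, (hY i).1⟩)
    (fun i => isLocalRing_end_fullSubcategory_iff.2 (hY i).2) (fun X => ?_)
  refine (addClosure_fullSubcategory (S := fun Z => ∃ i, Z = Y i) ?_
    (hgen X.obj X.property)).mono ?_
  · rintro _ ⟨i, rfl⟩
    exact (hY i).1
  · rintro Z ⟨i, hi⟩
    exact ⟨i, ObjectProperty.FullSubcategory.ext hi⟩

variable {M : FGModuleCat.{u} (A ⊗[k] B)}

lemma isLocalRing_end_fgModuleCat (hM : IsIndecomposable M) : IsLocalRing (End M) :=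
  haveI := isIdempotentComplete_fgModuleCat k (A ⊗[k] B)
  hM.isLocalRing_end k

variable (M) in
lemma isIdempotentComplete_addProj : IsIdempotentComplete (addProj M).FullSubcategory :=
  haveI := isIdempotentComplete_fgModuleCat k (A ⊗[k] B)
  isIdempotentComplete_fullSubcategory fun _ => addProj_of_addClosure

variable (M) in
lemma hasFiniteBiproducts_addProj : HasFiniteBiproducts (addProj M).FullSubcategory :=
  haveI := hasFiniteBiproducts_fgModuleCat k (A ⊗[k] B)
  hasFiniteBiproducts_fullSubcategory fun _ => addProj_of_addClosure

variable (M) in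
/-- The object `M` of its additive closure with the projective modules. -/
def selfObj : (addProj M).FullSubcategory := ⟨M, .of_mem (Or.inr rfl)⟩

lemma isFinitaryCategory_addProj (hM : IsIndecomposable M) :
    IsFinitaryCategory k (addProj M).FullSubcategory := by
  obtain ⟨n, Y, hY, hgen⟩ := exists_projective_generators k A B
  refine isFinitaryCategory_of_fintype k (hasFiniteBiproducts_addProj M)
    (isIdempotentComplete_addProj M) (fun X Y => finiteDimensional_fullSubcategory k X Y)
    (ι := Option (Fin n)) (fun i => i.elim (selfObj M) fun i => ⟨Y i, .of_mem (Or.inl (hY i).1)⟩)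
    (fun i => isLocalRing_end_fullSubcategory_iff.2 ?_) (fun X => ?_)
  · cases i with
    | none => exact isLocalRing_end_fgModuleCat hM
    | some i => exact (hY i).2
  · have h : AddClosure (fun Z => Z = M ∨ ∃ i, Z = Y i) X.obj := X.property.bind fun Z hZ => by
      rcases hZ with hZ | rfl
      · exact (hgen Z hZ).mono fun _ h => Or.inr h
      · exact .of_mem (Or.inl rfl)
    refine (addClosure_fullSubcategory (S := fun Z => Z = M ∨ ∃ i, Z = Y i) ?_ h).mono ?_
    · rintro _ (rfl | ⟨i, rfl⟩)
      · exact .of_mem (Or.inr rfl)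
      · exact .of_mem (Or.inl (hY i).1)
    · rintro Z (h | ⟨i, hi⟩)
      · exact ⟨none, ObjectProperty.FullSubcategory.ext h⟩
      · exact ⟨some i, ObjectProperty.FullSubcategory.ext hi⟩

/-- The stable endomorphism algebra of a projective module is zero, since the identity factors
through the module itself. -/
lemma not_projObj_of_stableEnd [Nontrivial (StableEnd M)] : ¬ projObj M := fun h => by
  have : (1 : StableEnd M) = 0 := (HomIdeal.generatedBy (k := k) projObj).proj.map_id M |>.symm.trans
    ((HomIdeal.proj_map_eq_zero_iff _ _).2 (Submodule.subset_span ⟨M, h, 𝟙 M, 𝟙 M, by simp⟩))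
  exact one_ne_zero this

variable (M) in
/-- The ideal of the additive closure of `M` and the projective modules which is generated by the
projective modules. -/
abbrev projIdeal : HomIdeal k (addProj M).FullSubcategory :=
  HomIdeal.generatedBy fun X => projObj X.obj

lemma isZero_proj_obj {X : (addProj M).FullSubcategory} (hX : projObj X.obj) :
    IsZero ((projIdeal M).proj.obj X) := by
  rw [IsZero.iff_id_eq_zero, ← (projIdeal M).proj.map_id, HomIdeal.proj_map_eq_zero_iff]
  exact Submodule.subset_span ⟨X, hX, 𝟙 X, 𝟙 X, by simp⟩

/-- An object vanishing in the quotient has its identity in the ideal, so it is a summand of a sum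
of projectives. -/
lemma projObj_of_isZero_proj_obj {X : (addProj M).FullSubcategory}
    (h : IsZero ((projIdeal M).proj.obj X)) : projObj X.obj := by
  rw [IsZero.iff_id_eq_zero, ← (projIdeal M).proj.map_id, HomIdeal.proj_map_eq_zero_iff,
    HomIdeal.mem_generatedBy_fullSubcategory_iff (projObj_le_addProj M)] at h
  exact projObj_of_addClosure (HomIdeal.addClosure_of_id_mem_generatedBy h)

lemma addClosure_proj_obj (X : (projIdeal M).Quot) :
    AddClosure (fun Z => Z = (projIdeal M).proj.obj (selfObj M)) X := by
  have h := addClosure_fullSubcategory (P := addProj M) (S := fun X => projObj X ∨ X = M)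
    (fun _ h => .of_mem h) (X := X.as) X.as.property
  refine h.map (projIdeal M).proj fun Y hY => ?_
  rcases hY with hY | hY
  · exact .of_isZero (isZero_proj_obj hY)
  · obtain rfl : Y = selfObj M := ObjectProperty.FullSubcategory.ext hY
    exact .of_mem rfl

/-- The image of `M` generates the quotient. Its endomorphism ring is a quotient of a local ring:
non-zero because `M` is not projective, and local because idempotents lift. -/
lemma isFinitaryCategory_quot (hM : IsIndecomposable M) (hM' : ¬ projObj M) :
    IsFinitaryCategory k (projIdeal M).Quot := by
  have hfin : ∀ X Y : (addProj M).FullSubcategory, FiniteDimensional k (X ⟶ Y) :=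
    fun X Y => finiteDimensional_fullSubcategory k X Y
  have := isIdempotentComplete_addProj M
  have := hasFiniteBiproducts_addProj M
  refine isFinitaryCategory_of_fintype k (HomIdeal.hasFiniteBiproducts_quot _)
    (HomIdeal.isIdempotentComplete_quot _ fun X => hfin X X)
    (HomIdeal.finiteDimensional_quot _ hfin) (ι := Unit)
    (fun _ => (projIdeal M).proj.obj (selfObj M)) (fun _ => ?_)
    fun X => (addClosure_proj_obj X).mono fun _ h => ⟨(), h⟩
  have := nontrivial_end fun h => hM' (projObj_of_isZero_proj_obj (X := selfObj M) h)
  have hf1 : FiniteDimensional k (End ((projIdeal M).proj.obj (selfObj M))) :=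
    HomIdeal.finiteDimensional_quot _ hfin _ _
  have hf2 : FiniteDimensional k (End (selfObj M)) := hfin _ _
  have hl : IsLocalRing (End (selfObj M)) :=
    isLocalRing_end_fullSubcategory_iff.2 (isLocalRing_end_fgModuleCat hM)
  refine isLocalRing_of_idempotents k fun e he => ?_
  let φ : End (selfObj M) →* End ((projIdeal M).proj.obj (selfObj M)) :=
    (projIdeal M).proj.mapEnd (selfObj M)
  obtain ⟨a, rfl⟩ : ∃ a, φ a = e := (projIdeal M).proj.map_surjective e
  obtain ⟨e', he', h⟩ := exists_isIdempotentElem_lift k φ a he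
  rw [← h]
  rcases eq_zero_or_one_of_isIdempotentElem he' with rfl | rfl
  · exact Or.inl ((projIdeal M).proj.map_zero _ _)
  · exact Or.inr φ.map_one

end Invariant
end FinRep
end

noncomputable section
namespace FinRep
open Module

/-! ### The cell `2`-representation of a left cell of projective functors -/

section ProjectiveCell

attribute [local instance] Bimod.finite_of_fg finiteDimensional_hom

variable {k : Type u} [Field k] {A B : Type u} [Ring A] [Ring B] [Algebra k A] [Algebra k B]
  [FiniteDimensional k A] [FiniteDimensional k B]

/-- A non-zero homomorphism which spans its space of homomorphisms gives an isomorphism of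
`P ⊗ Hom(Q, S)` with `P`. -/
lemma exists_iso_homTens_obj {Q S : FGModuleCat.{u} (A ⊗[k] B)} {q : Q ⟶ S} (hq0 : q ≠ 0)
    (hq : ∀ q', ∃ c : k, q' = c • q) (P : FGModuleCat.{u} (A ⊗[k] B)) :
    ∃ e : P ≅ (homTens k P Q).obj S, ∀ p, e.hom.hom.hom p = ht k p q := by
  let f : P →ₗ[A ⊗[k] B] (homTens k P Q).obj S :=
    (homOfKlin (k := k) (X := P) (Y := (homTens k P Q).obj S) ((ht k).flip q)
      (fun r p => rfl)).hom.hom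
  have hf (p) : f p = ht k p q := rfl
  have hb : Function.Bijective f := by
    constructor
    · refine (injective_iff_map_eq_zero f).2 fun p hp => ?_
      refine (Module.forall_dual_apply_eq_zero_iff k p).1 fun l => ?_
      have h : contract l (ht k p q) = 0 := by
        rw [← hf, hp, map_zero]
      rw [contract_ht] at h
      exact (smul_eq_zero.1 h).resolve_right hq0
    · intro t
      obtain ⟨p, rfl⟩ := exists_eq_ht hq t
      exact ⟨p, rfl⟩
  let e := LinearEquiv.ofBijective f hb
  exact ⟨{ hom := ObjectProperty.homMk (ModuleCat.ofHom e.toLinearMap)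
           inv := ObjectProperty.homMk (ModuleCat.ofHom e.symm.toLinearMap)
           hom_inv_id := FGModuleCat.hom_ext (LinearMap.ext fun p => e.symm_apply_apply p)
           inv_hom_id := FGModuleCat.hom_ext (LinearMap.ext fun p => e.apply_symm_apply p) },
    fun p => rfl⟩

instance evaluation_additive {C D : Type*} [Category* C] [Category* D] [Preadditive D] (X : C) :
    ((evaluation C D).obj X).Additive := ⟨rfl⟩

section

variable {Q S : FGModuleCat.{u} (A ⊗[k] B)} {q : Q ⟶ S}

/-- Evaluation at `S` identifies `P ⊗ Hom(Q, -)` with `P`, and a map `P ⟶ P'` lifts to the functors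
by functoriality in the first variable. The general case follows by passing to components. -/
lemma exists_app_eq (hq0 : q ≠ 0) (hq : ∀ q', ∃ c : k, q' = c • q)
    {G G' : FGModuleCat.{u} (A ⊗[k] B) ⥤ FGModuleCat.{u} (A ⊗[k] B)}
    (hG : AddClosure (IsHomTens Q) G) (hG' : AddClosure (IsHomTens Q) G')
    (g : G.obj S ⟶ G'.obj S) : ∃ f : G ⟶ G', f.app S = g := by
  refine exists_map_eq_of_addClosure ((evaluation _ (FGModuleCat.{u} (A ⊗[k] B))).obj S)
    (fun Y Y' hY hY' g => ?_) hG hG' g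
  obtain ⟨P, hP, rfl⟩ := hY
  obtain ⟨P', hP', rfl⟩ := hY'
  change (homTens k P Q).obj S ⟶ (homTens k P' Q).obj S at g
  obtain ⟨e, he⟩ := exists_iso_homTens_obj hq0 hq P
  obtain ⟨e', he'⟩ := exists_iso_homTens_obj hq0 hq P'
  refine ⟨homTensMap Q (e.hom ≫ g ≫ e'.inv), homTens_hom_ext fun p q' => ?_⟩
  obtain ⟨c, rfl⟩ := hq q'
  rw [map_smul, ← LinearMap.smul_apply, ← map_smul]
  generalize c • p = p
  refine (he' _).symm.trans ?_
  rw [← he]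
  change (e'.hom.hom.hom (e'.inv.hom.hom (g.hom.hom (e.hom.hom.hom p)))) = _
  exact congrArg (fun f : (homTens k P' Q).obj S ⟶ (homTens k P' Q).obj S =>
    f.hom.hom (g.hom.hom (e.hom.hom.hom p))) e'.inv_hom_id

/-- Some component of `f` between functors `P ⊗ Hom(Q, -)` is non-zero at `S`; the identity factors
through that component, hence through `f`. -/
lemma exists_factorization (hq : ∀ q', ∃ c : k, q' = c • q) (P₀ : FGModuleCat.{u} (A ⊗[k] B))
    (hQ : ∀ z : End Q, IsUnit z ∨ IsNilpotent z)
    {G G' : FGModuleCat.{u} (A ⊗[k] B) ⥤ FGModuleCat.{u} (A ⊗[k] B)}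
    (hG : AddClosure (IsHomTens Q) G) (hG' : AddClosure (IsHomTens Q) G') (f : G ⟶ G')
    (hf : f.app S ≠ 0) :
    ∃ (α : homTens k P₀ Q ⟶ G ⋙ homTens k P₀ (regMod (A ⊗[k] B)))
      (β : G' ⋙ homTens k P₀ (regMod (A ⊗[k] B)) ⟶ homTens k P₀ Q),
      α ≫ Functor.whiskerRight f _ ≫ β = 𝟙 _ := by
  obtain ⟨Y, Y', b, a, hY, hY', h⟩ := exists_component_ne_zero
    ((evaluation _ (FGModuleCat.{u} (A ⊗[k] B))).obj S) hG hG' hf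
  obtain ⟨P, hP, rfl⟩ := hY
  obtain ⟨P', hP', rfl⟩ := hY'
  obtain ⟨α, β, h⟩ := exists_comp_eq_id_of_app_ne_zero P₀ hQ hq (b ≫ f ≫ a) h
  refine ⟨α ≫ Functor.whiskerRight b _, Functor.whiskerRight a _ ≫ β, ?_⟩
  rw [← h]
  simp [Functor.whiskerRight_comp]

end

/-- The free functor factors through the one-sided ones in either order, so the order can be chosen
to bring equal one-sided functors next to each other, where they collapse. -/
lemma addClosure_comp_free {F : FGModuleCat.{u} (A ⊗[k] B) ⥤ FGModuleCat.{u} (A ⊗[k] B)}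
    (hF : IsGood k A B F) :
    AddClosure (fun G => G = extFunctor (deltaF k A B)) (F ⋙ extFunctor (deltaF k A B)) := by
  refine (isGood_iff.1 hF).postcomp _ ?_
  rintro G (rfl | rfl | rfl | rfl)
  · exact .of_iso (Functor.leftUnitor _) rfl
  · refine .trans_iso (Functor.isoWhiskerLeft _ (leftRightIso k A B).symm ≪≫
      (Functor.associator _ _ _).symm) ((free_right k A B).postcomp _ ?_)
    rintro _ rfl
    exact free_left k A B
  · refine .trans_iso (Functor.isoWhiskerLeft _ (rightLeftIso k A B).symm ≪≫
      (Functor.associator _ _ _).symm) ((leftLeft k A B).postcomp _ ?_)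
    rintro _ rfl
    exact .of_iso (rightLeftIso k A B) rfl
  · refine .trans_iso (Functor.isoWhiskerLeft _ (leftRightIso k A B).symm ≪≫
      (Functor.associator _ _ _).symm) ((rightRight k A B).postcomp _ ?_)
    rintro _ rfl
    exact .of_iso (leftRightIso k A B) rfl

lemma free_comp_addClosure {F : FGModuleCat.{u} (A ⊗[k] B) ⥤ FGModuleCat.{u} (A ⊗[k] B)}
    (hF : IsGood k A B F) :
    AddClosure (fun G => G = extFunctor (deltaF k A B)) (extFunctor (deltaF k A B) ⋙ F) := by
  refine (isGood_iff.1 hF).precomp _ ?_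
  rintro G (rfl | rfl | rfl | rfl)
  · exact .of_iso (Functor.rightUnitor _) rfl
  · exact addClosure_comp_free (IsElementary.isGood (Or.inr (Or.inl rfl)))
  · exact free_left k A B
  · exact free_right k A B

lemma IsProjectiveFun.addClosure_free
    {F : FGModuleCat.{u} (A ⊗[k] B) ⥤ FGModuleCat.{u} (A ⊗[k] B)} (hF : IsProjectiveFun k A B F) :
    AddClosure (fun G => G = extFunctor (deltaF k A B)) F := by
  obtain ⟨Q, hQ, ⟨e⟩⟩ := hF
  refine .trans_iso e (hQ.addClosure.bind ?_)
  rintro _ rfl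
  exact .of_iso (freeIso k A B).symm rfl

/-- Summands of sums of copies of the free functor are stable under composition on both sides, so
the whole two-sided cell of a projective functor consists of such functors. -/
lemma addClosure_free_of_twoSidedLE {F G : GoodFun k A B} (hG : IsProjectiveFun k A B G.obj)
    (h : TwoSidedLE G F) : AddClosure (fun G => G = extFunctor (deltaF k A B)) F.obj := by
  obtain ⟨H₁, H₂, h⟩ := h
  refine .of_isSummand (isSummand_fullSubcategory_iff.1 h) ?_
  have : H₁.obj.Additive := ⟨H₁.property.map_add _ _⟩
  refine AddClosure.postcomp (S := fun G => G = extFunctor (deltaF k A B)) H₁.obj ?_ ?_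
  · rintro _ rfl
    exact free_comp_addClosure H₁.property
  · refine hG.addClosure_free.precomp H₂.obj ?_
    rintro _ rfl
    exact addClosure_comp_free H₂.property

variable (k A B) in
lemma addClosure_homTens_regMod : AddClosure
    (fun F : FGModuleCat.{u} (A ⊗[k] B) ⥤ FGModuleCat.{u} (A ⊗[k] B) =>
      ∃ Q, (IsLocalRing (End Q) ∧ projObj Q) ∧ F = homTens k (regMod (A ⊗[k] B)) Q)
    (extFunctor (deltaF k A B)) :=
  .trans_iso (freeTensIso k A B) (AddClosure.homTens_right _
    ((hasLocalDecomposition_fgModuleCat k (regMod (A ⊗[k] B))).addClosure.mono fun _ h =>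
      ⟨h.1, projObj_of_isSummand h.2 projective_regMod⟩))

/-- The functor `P ⊗ Hom(Q, -)` as a good functor. -/
abbrev homTensGood {P Q : FGModuleCat.{u} (A ⊗[k] B)} (hP : projObj P) (hQ : projObj Q) :
    GoodFun k A B := ⟨homTens k P Q, homTens_good hP hQ⟩

/-- Decomposing the regular module in the contravariant variable splits the free functor into the
functors `E ⊗ Hom(Q, -)` with `Q` indecomposable. This extracts the `Q` attached to `F`. -/
lemma exists_isSummand_homTensGood {F : GoodFun k A B} (hF : IsIndecomposable F)
    (h : AddClosure (fun G => G = extFunctor (deltaF k A B)) F.obj) :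
    ∃ (Q : FGModuleCat.{u} (A ⊗[k] B)) (hQ : projObj Q), IsLocalRing (End Q) ∧
      IsSummand F (homTensGood projective_regMod hQ) := by
  have := hF.isLocalRing_end_goodFun
  have h1 := h.bind (by rintro _ rfl; exact addClosure_homTens_regMod k A B)
  have h2 := addClosure_fullSubcategory (P := IsGood k A B) ?_ h1
  · obtain ⟨G, ⟨Q, hQ, hG⟩, hFG⟩ := h2.exists_isSummand
    refine ⟨Q, hQ.2, hQ.1, ?_⟩
    obtain rfl : G = homTensGood projective_regMod hQ.2 := ObjectProperty.FullSubcategory.ext hG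
    exact hFG
  · rintro _ ⟨Q, hQ, rfl⟩
    exact homTens_good projective_regMod hQ.2

/-- A summand of `P ⊗ Hom(Q, -)` does not vanish on some simple module. -/
lemma exists_simple_obj_ne_zero [IsAlgClosed k] {F : FGModuleCat.{u} (A ⊗[k] B) ⥤ FGModuleCat.{u} (A ⊗[k] B)}
    {P Q : FGModuleCat.{u} (A ⊗[k] B)} (hQ : projObj Q) [IsLocalRing (End Q)] (hF : ¬ IsZero F)
    (h : IsSummand F (homTens k P Q)) :
    ∃ (S : FGModuleCat.{u} (A ⊗[k] B)) (q : Q ⟶ S), q ≠ 0 ∧ (∀ q', ∃ c : k, q' = c • q) ∧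
      ¬ IsZero (F.obj S) := by
  obtain ⟨ρ⟩ := h
  obtain ⟨S, hS, hS'⟩ := exists_simple_app_ne_zero (ρ.r ≫ ρ.i) (by simp) (fun h => hF (by
    have h1 : ρ.i ≫ (ρ.r ≫ ρ.i) ≫ ρ.r = 0 := by rw [h, zero_comp, comp_zero]
    rw [Category.assoc, ρ.retract_assoc, ρ.retract] at h1
    exact (IsZero.iff_id_eq_zero _).2 h1))
  have hidem : ∀ z : End Q, IsIdempotentElem z → z = 0 ∨ z = 1 :=
    fun _ hz => eq_zero_or_one_of_isIdempotentElem hz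
  have : FiniteDimensional k (End Q) := finiteDimensional_hom Q Q
  obtain ⟨q, hq⟩ : ∃ q : Q ⟶ S, q ≠ 0 := by
    by_contra! h
    refine hS (homTens_hom_ext fun p q => ?_)
    rw [h q, map_zero, map_zero, map_zero]
  refine ⟨S, q, hq, hS'.exists_smul_eq hQ (isUnit_or_isNilpotent k hidem)
    (exists_isNilpotent_sub_algebraMap hidem) hq, fun h0 => hS ?_⟩
  rw [NatTrans.comp_app, h0.eq_of_tgt (ρ.r.app S) 0, zero_comp]

lemma mem_leftCell {D : Type*} [Category* D] [Preadditive D] [MonoidalCategory D] {F : D}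
    (hF : IsIndecomposable F) : F ∈ leftCell F :=
  ⟨hF, ⟨𝟙_ D, .of_iso (λ_ F).symm⟩, ⟨𝟙_ D, .of_iso (λ_ F).symm⟩⟩

/-- Everything in the span arises from `F` by left composition and summands, and neither changes
`Q`. -/
lemma addClosure_isHomTens_of_leftSpan {Q : FGModuleCat.{u} (A ⊗[k] B)} {F G : GoodFun k A B}
    (hF : AddClosure (IsHomTens Q) F.obj) (hG : leftSpan (leftCell F) G) :
    AddClosure (IsHomTens Q) G.obj := by
  have : (IsGood k A B).ι.Additive := ⟨rfl⟩
  refine AddClosure.map (IsGood k A B).ι ?_ hG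
  rintro X ⟨Z, hZ, H, ⟨e⟩⟩
  obtain ⟨-, ⟨H', h⟩, -⟩ := hZ
  refine .trans_iso ((IsGood k A B).ι.mapIso e) ?_
  refine IsHomTens.addClosure_comp (G := H.obj) ?_ H.property
  exact .of_isSummand (isSummand_fullSubcategory_iff.1 h)
    (IsHomTens.addClosure_comp (G := H'.obj) hF H'.property)

/-- The cell `2`-representation of a left cell of projective functors is equivalent to the action on
the projective modules. -/
theorem projObj_equivalent_cellRep [IsAlgClosed k] {L : Set (GoodFun k A B)} (hL : IsLeftCell L)
    (hLJ : L ⊆ projectiveCell k A B) :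
    ((defining k A B).sub projObj (projObj_invariant k A B)).Equivalent (cellRep k L) := by
  obtain ⟨F, hF, rfl⟩ := hL
  obtain ⟨G, -, hG, -, hGF, -⟩ := hLJ (mem_leftCell hF)
  obtain ⟨Q, hQ, hQloc, hFQ⟩ :=
    exists_isSummand_homTensGood hF (addClosure_free_of_twoSidedLE hG hGF)
  have hFQ' : IsSummand F.obj (homTens k (regMod (A ⊗[k] B)) Q) := isSummand_fullSubcategory_iff.1 hFQ
  have hFadd : AddClosure (IsHomTens Q) F.obj :=
    .of_isSummand hFQ' (.of_mem ⟨_, projective_regMod, rfl⟩)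
  -- The module at which functors will be evaluated: `Hom(Q, S)` is the line through `q`, and `F`
  -- does not vanish on `S`.
  obtain ⟨S, q, hq0, hq, hFS⟩ := exists_simple_obj_ne_zero hQ
    (fun h => hF.1 (isZero_fullSubcategory_iff.2 h)) hFQ'
  have : FiniteDimensional k (End Q) := finiteDimensional_hom Q Q
  have hQ' : ∀ z : End Q, IsUnit z ∨ IsNilpotent z :=
    isUnit_or_isNilpotent k fun _ hz => eq_zero_or_one_of_isIdempotentElem hz
  let T : GoodFun k A B := homTensGood projective_regMod hQ
  have hspan {G : GoodFun k A B} (hG : leftSpan (leftCell F) G) : AddClosure (IsHomTens Q) G.obj :=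
    addClosure_isHomTens_of_leftSpan hFadd hG
  -- The factorization applied to `𝟙 F`, which is non-zero at `S`, makes `E ⊗ Hom(Q, -)` a summand
  -- of the free functor composed with `F`. So the span of the cell reaches all `P ⊗ Hom(Q, -)` with
  -- `P` projective.
  have hT : leftSpan (leftCell F) T := by
    obtain ⟨α, β, h⟩ := exists_factorization hq (regMod (A ⊗[k] B)) hQ' hFadd hFadd (𝟙 F.obj)
      (fun h => hFS ((IsZero.iff_id_eq_zero _).2 h))
    refine .of_isSummand (Y := freeGood k A B ⊗ F) ⟨⟨ObjectProperty.homMk α,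
      ObjectProperty.homMk β, ObjectProperty.hom_ext _ ?_⟩⟩
      (.of_mem ⟨F, mem_leftCell hF, freeGood k A B, ⟨Iso.refl _⟩⟩)
    rw [Functor.whiskerRight_id', Category.id_comp] at h
    exact h
  have hTP {P : FGModuleCat.{u} (A ⊗[k] B)} (hP : projObj P) :
      leftSpan (leftCell F) (homTensGood hP hQ) := by
    have h1 : AddClosure (fun F => ∃ P', P' = regMod (A ⊗[k] B) ∧ F = homTens k P' Q)
      (homTens k P Q) := (projective_iff_addClosure.1 hP).homTens_left Q
    refine (addClosure_fullSubcategory (X := homTensGood hP hQ) ?_ h1).bind ?_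
    · rintro _ ⟨_, rfl, rfl⟩
      exact homTens_good projective_regMod hQ
    · rintro G ⟨_, rfl, hG⟩
      obtain rfl : G = T := ObjectProperty.FullSubcategory.ext hG
      exact hT
  let Ψ := (TwoRep.evalHom (defining k A B) S).restrict
    (leftSpan_invariant (k := k) (leftCell F)) (projObj_invariant k A B)
    (fun G hG => projObj_of_addClosure ((hspan hG).app S (by
      rintro _ ⟨P, hP, rfl⟩
      exact .of_mem (projective_homTens_obj k hP Q S))))
  refine TwoRep.equivalent_quot_maxIdeal Ψ _ ?_ ?_ ?_ ?_
  · intro X Y g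
    obtain ⟨f, hf⟩ := exists_app_eq hq0 hq (hspan X.property) (hspan Y.property) g.hom
    exact ⟨ObjectProperty.homMk (ObjectProperty.homMk f), ObjectProperty.hom_ext _ hf⟩
  · intro Y
    obtain ⟨e, -⟩ := exists_iso_homTens_obj hq0 hq Y.obj
    exact ⟨⟨homTensGood Y.property hQ, hTP Y.property⟩, ⟨ObjectProperty.isoMk _ e.symm⟩⟩
  -- Since `F` is a summand of `H ∘ Z`, vanishing of `Z` on `S` would force `F` to vanish there.
  · intro Z hZ h0
    obtain ⟨-, -, H, hH⟩ := hZ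
    have h1 : 𝟙 (Z.obj.obj.obj S) = 0 := congrArg (fun f => f.hom) h0
    have : H.obj.Additive := ⟨H.property.map_add _ _⟩
    have h2 : IsSummand (F.obj.obj S) (H.obj.obj (Z.obj.obj.obj S)) :=
      (isSummand_fullSubcategory_iff.1 hH).map ((evaluation _ _).obj S)
    obtain ⟨ρ⟩ := h2
    refine hFS ((IsZero.iff_id_eq_zero _).2 ?_)
    rw [← ρ.retract, (H.obj.map_isZero ((IsZero.iff_id_eq_zero _).2 h1)).eq_of_tgt ρ.i 0, zero_comp]
  -- The invariant ideal contains the whiskering of `f` by the free functor, hence the identity of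
  -- `E ⊗ Hom(Q, -)`. Compressing by the retract `ρ` yields `𝟙 F`.
  · intro J X Y f hf hf0
    have hfS : f.hom.hom.app S ≠ 0 := fun h => hf0 (ObjectProperty.hom_ext _ h)
    obtain ⟨α, β, h⟩ := exists_factorization hq (regMod (A ⊗[k] B)) hQ' (hspan X.property)
      (hspan Y.property) f.hom.hom hfS
    obtain ⟨ρ⟩ := hFQ
    refine ⟨⟨F, .of_mem ⟨F, mem_leftCell hF, 𝟙_ _, ⟨(λ_ F).symm⟩⟩⟩, mem_leftCell hF, ?_⟩
    have h1 := J.comp_right (X := ⟨F, .of_mem ⟨F, mem_leftCell hF, 𝟙_ _, ⟨(λ_ F).symm⟩⟩⟩)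
      (Z := ⟨F, .of_mem ⟨F, mem_leftCell hF, 𝟙_ _, ⟨(λ_ F).symm⟩⟩⟩)
      (ObjectProperty.homMk (ObjectProperty.homMk (β ≫ ρ.r.hom)))
      (J.comp_left (ObjectProperty.homMk (ObjectProperty.homMk (ρ.i.hom ≫ α)))
        (J.invariant (freeGood k A B) hf))
    refine (congrArg (fun g => g ∈ J.hom _ _) (ObjectProperty.hom_ext _
      (ObjectProperty.hom_ext _ ?_))).mp h1
    refine Eq.trans ?_ (congrArg (fun g => g.hom) ρ.retract)
    change ((ρ.i.hom ≫ α) ≫ Functor.whiskerRight f.hom.hom _) ≫ β ≫ ρ.r.hom = ρ.i.hom ≫ ρ.r.hom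
    rw [Category.assoc, Category.assoc]
    exact congrArg (fun g => ρ.i.hom ≫ g) (by
      rw [← Category.assoc, ← Category.assoc, Category.assoc α, h]; exact Category.id_comp _)

end ProjectiveCell
end FinRep
end

noncomputable section
namespace FinRep
open Module

/-! ### Full functors: essential surjectivity and detection of isomorphisms -/

section Additive

variable {C D : Type*} [Category* C] [Preadditive C] [Category* D] [Preadditive D]

/-- A summand of the image of `⨁ W` is cut out by an idempotent. This lifts along the full functor
to an idempotent of `⨁ W`, whose splitting maps onto the given object. -/
lemma AddClosure.exists_obj_iso (k : Type*) [Field k] [Linear k C] [HasFiniteBiproducts C]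
    [IsIdempotentComplete C] (hfin : ∀ X Y : C, FiniteDimensional k (X ⟶ Y)) (Φ : C ⥤ D)
    [Φ.Additive] [Φ.Full] {X : D} (h : AddClosure (fun Z => ∃ Y, Z = Φ.obj Y) X) :
    ∃ Y, Nonempty (Φ.obj Y ≅ X) := by
  obtain ⟨n, Y, a, b, hY, e⟩ := h
  choose W hW using hY
  obtain rfl : Y = fun i => Φ.obj (W i) := funext hW
  let i : X ⟶ Φ.obj (⨁ W) := ∑ j, a j ≫ Φ.map (biproduct.ι W j)
  let r : Φ.obj (⨁ W) ⟶ X := ∑ j, Φ.map (biproduct.π W j) ≫ b j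
  have hir : i ≫ r = 𝟙 X := by
    rw [← e]
    simp only [i, r, Preadditive.sum_comp, Preadditive.comp_sum, Category.assoc]
    refine Finset.sum_congr rfl fun j _ => ?_
    rw [Finset.sum_eq_single j]
    · rw [← Category.assoc (Φ.map _), ← Φ.map_comp, biproduct.ι_π_self, Φ.map_id, Category.id_comp]
    · intro j' _ hj
      rw [← Category.assoc (Φ.map _), ← Φ.map_comp, biproduct.ι_π_ne W hj, Φ.map_zero,
        zero_comp, comp_zero]
    · simp
  obtain ⟨p, hp⟩ := Φ.map_surjective (r ≫ i)
  have : FiniteDimensional k (End (⨁ W)) := hfin _ _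
  have hidem : Φ.map p ≫ Φ.map p = Φ.map p := by
    rw [hp, Category.assoc, reassoc_of% hir]
  obtain ⟨q, hq, hqp⟩ := exists_isIdempotentElem_lift k (Φ.mapEnd (⨁ W)) p hidem
  obtain ⟨Y, i₀, r₀, h₀, h₁⟩ := IsIdempotentComplete.idempotents_split (⨁ W) q hq
  have hq' : Φ.map r₀ ≫ Φ.map i₀ = r ≫ i := by
    rw [← Φ.map_comp, h₁, ← hp]
    exact hqp
  have h₂ : Φ.map i₀ ≫ Φ.map r₀ = 𝟙 _ := by rw [← Φ.map_comp, h₀, Φ.map_id]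
  refine ⟨Y, ⟨⟨Φ.map i₀ ≫ r, i ≫ Φ.map r₀, ?_, ?_⟩⟩⟩
  · rw [Category.assoc, ← Category.assoc r, ← hq', Category.assoc, reassoc_of% h₂, h₂]
  · rw [Category.assoc, ← Category.assoc (Φ.map r₀), hq', Category.assoc, reassoc_of% hir, hir]

/-- If all endomorphisms of `Φ U` are scalar, then an endomorphism of `U` which is not annihilated
by `Φ` is invertible, where `U` has a local endomorphism ring. -/
lemma exists_comp_eq_id_of_map_ne_zero (k : Type*) [Field k] [Linear k C] [Linear k D] {U : C}
    (hfin : FiniteDimensional k (U ⟶ U)) (hloc : IsLocalRing (End U)) (Φ : C ⥤ D) [Φ.Additive]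
    (hU : ∀ g : Φ.obj U ⟶ Φ.obj U, ∃ c : k, g = c • 𝟙 _) {g : U ⟶ U} (h : Φ.map g ≠ 0) :
    ∃ v, g ≫ v = 𝟙 U := by
  have : FiniteDimensional k (End U) := hfin
  rcases isUnit_or_isNilpotent k (fun _ hz => eq_zero_or_one_of_isIdempotentElem hz) (End.of g)
    with hg | ⟨n, hn⟩
  · exact hg.exists_left_inv
  · obtain ⟨c, hc⟩ := hU (Φ.map g)
    have h2 : (Φ.mapEnd U (End.of g)) ^ n = 0 := by
      rw [← map_pow, hn]
      exact Φ.map_zero _ _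
    have h3 : Φ.mapEnd U (End.of g) = c • 1 := hc
    rw [h3, smul_pow, one_pow] at h2
    exfalso
    rcases smul_eq_zero.1 h2 with h4 | h4
    · exact h (by rw [hc, eq_zero_of_pow_eq_zero h4, zero_smul])
    · exact h (by rw [hc, show 𝟙 (Φ.obj U) = 0 from h4, smul_zero])

end Additive

/-! ### The cell `2`-representation of the identity -/

section UnitCell

attribute [local instance] Bimod.finite_of_fg finiteDimensional_hom

variable {k : Type u} [Field k] {A B : Type u} [Ring A] [Ring B] [Algebra k A] [Algebra k B]
  [FiniteDimensional k A] [FiniteDimensional k B]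

lemma hasFiniteBiproducts_goodFun : HasFiniteBiproducts (GoodFun k A B) :=
  haveI := hasFiniteBiproducts_fgModuleCat k (A ⊗[k] B)
  haveI : HasFiniteBiproducts (FGModuleCat.{u} (A ⊗[k] B) ⥤ FGModuleCat.{u} (A ⊗[k] B)) :=
    .of_hasFiniteProducts
  hasFiniteBiproducts_fullSubcategory fun _ => IsGood.of_addClosure

variable {M : FGModuleCat.{u} (A ⊗[k] B)}

/-- The scalar is the image of `m` under the isomorphism of the stable endomorphism algebra with
`k`. -/
lemma exists_sub_smul_id_mem (φ : StableEnd M ≃ₐ[k] k) (m : M ⟶ M) :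
    ∃ c : k, m - c • 𝟙 M ∈ (HomIdeal.generatedBy (k := k) projObj).hom M M := by
  let I := HomIdeal.generatedBy (k := k) (projObj (k := k) (A := A) (B := B))
  refine ⟨φ (I.proj.map m), ?_⟩
  rw [← HomIdeal.proj_map_eq_zero_iff, Functor.map_sub, sub_eq_zero, Functor.map_smul,
    CategoryTheory.Functor.map_id]
  refine φ.injective ?_
  refine Eq.trans ?_ (map_smul φ (φ (I.proj.map m)) (1 : StableEnd M)).symm
  rw [map_one, smul_eq_mul, mul_one]

lemma exists_smul_id_of_stableEnd (φ : StableEnd M ≃ₐ[k] k)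
    (g : (projIdeal M).proj.obj (selfObj M) ⟶ (projIdeal M).proj.obj (selfObj M)) :
    ∃ c : k, g = c • 𝟙 _ := by
  obtain ⟨m, rfl⟩ := (projIdeal M).proj.map_surjective g
  obtain ⟨c, hc⟩ := exists_sub_smul_id_mem φ m.hom
  refine ⟨c, ?_⟩
  rw [← CategoryTheory.Functor.map_id, ← Functor.map_smul, ← sub_eq_zero, ← Functor.map_sub,
    HomIdeal.proj_map_eq_zero_iff,
    HomIdeal.mem_generatedBy_fullSubcategory_iff (projObj_le_addProj M)]
  exact hc

/-- Every `G` is `G ∘ 𝟙`, so the span of this cell is the whole category of good functors. -/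
lemma leftSpan_leftCell_unit (h1 : IsIndecomposable (𝟙_ (GoodFun k A B))) (G : GoodFun k A B) :
    leftSpan (leftCell (𝟙_ (GoodFun k A B))) G :=
  .of_mem ⟨𝟙_ _, mem_leftCell h1, G, ⟨(ρ_ G).symm⟩⟩

lemma addClosure_leftSpan {L : Set (GoodFun k A B)} (hL : ∀ G, leftSpan L G)
    (X : (leftSpan L).FullSubcategory) :
    AddClosure (fun G : (leftSpan L).FullSubcategory => IsElementary k A B G.obj.obj) X :=
  addClosure_fullSubcategory (P := leftSpan L) (S := fun G => IsElementary k A B G.obj)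
    (fun G _ => hL G) (addClosure_goodFun X.obj)

/-- The cell `2`-representation of the left cell of the identity is equivalent to the quotient of
the additive closure of `M` and the projective modules by the projective modules. -/
theorem quot_equivalent_cellRep_unit (h1 : IsIndecomposable (𝟙_ (GoodFun k A B)))
    (hstable : Nonempty (StableEnd M ≃ₐ[k] k)) (hl : IsLeftProjective M)
    (hr : IsRightProjective M) :
    (((defining k A B).sub (addProj M) (addProj_invariant hl hr)).quot
      ((defining k A B).relIdeal (projObj_invariant k A B) (addProj_invariant hl hr))).Equivalent
      (cellRep k (leftCell (𝟙_ (GoodFun k A B)))) := by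
  obtain ⟨φ⟩ := hstable
  have : Nontrivial (StableEnd M) := φ.toEquiv.nontrivial
  have hM' : ¬ projObj M := not_projObj_of_stableEnd
  have hspan := leftSpan_leftCell_unit h1
  -- Evaluation at `M`, followed by the projection modulo the projectives.
  let Ψ := (TwoRep.Hom.restrict (TwoRep.evalHom (defining k A B) M)
    (leftSpan_invariant (k := k) (leftCell (𝟙_ (GoodFun k A B)))) (addProj_invariant hl hr)
    (fun G _ => addProj_invariant hl hr G M (.of_mem (Or.inr rfl)))).comp
    (TwoRep.quotProj _ ((defining k A B).relIdeal (projObj_invariant k A B)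
      (addProj_invariant hl hr)))
  let Φ : (leftSpan (leftCell (𝟙_ (GoodFun k A B)))).FullSubcategory ⥤ (projIdeal M).Quot :=
    Ψ.functor
  have : Φ.Additive := Ψ.additive
  have : Φ.Linear k := Ψ.linear
  let U : (leftSpan (leftCell (𝟙_ (GoodFun k A B)))).FullSubcategory := ⟨𝟙_ _, hspan _⟩
  -- Elementary functors other than the identity send `M` to projectives, so on generators only the
  -- unit survives.
  have hlow {Y : (leftSpan (leftCell (𝟙_ (GoodFun k A B)))).FullSubcategory}
      (hY : IsElementary k A B Y.obj.obj) : Y = U ∨ IsZero (Φ.obj Y) := by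
    rcases hY with hY | hY
    · exact Or.inl (ObjectProperty.FullSubcategory.ext (goodFun_eq_unit hY))
    · exact Or.inr (isZero_proj_obj (X := ⟨Y.obj.obj.obj M, _⟩)
        (IsLowerFun.projective (.of_mem hY) hl hr))
  have hU (g : Φ.obj U ⟶ Φ.obj U) : ∃ c : k, g = c • 𝟙 _ := exists_smul_id_of_stableEnd φ g
  have hfull : Φ.Full := ⟨fun {X Y} g => by
    refine exists_map_eq_of_addClosure Φ (fun Y Y' hY hY' g => ?_) (addClosure_leftSpan hspan X)
      (addClosure_leftSpan hspan Y) g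
    rcases hlow hY with rfl | h0
    · rcases hlow hY' with rfl | h0
      · obtain ⟨c, rfl⟩ := hU g
        exact ⟨c • 𝟙 _, by rw [Functor.map_smul, CategoryTheory.Functor.map_id]⟩
      · exact ⟨0, h0.eq_of_tgt _ _⟩
    · exact ⟨0, h0.eq_of_src _ _⟩⟩
  refine TwoRep.equivalent_quot_maxIdeal Ψ _ (fun g => Φ.map_surjective g) ?_ ?_ ?_
  · intro Y
    have := hasFiniteBiproducts_goodFun (k := k) (A := A) (B := B)
    have := hasFiniteBiproducts_fullSubcategory (P := leftSpan (leftCell (𝟙_ (GoodFun k A B))))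
      fun X _ => hspan X
    have := isIdempotentComplete_fullSubcategory (P := leftSpan (leftCell (𝟙_ (GoodFun k A B))))
      fun X _ => hspan X
    refine AddClosure.exists_obj_iso k (fun X Y => finiteDimensional_fullSubcategory k X Y) Φ
      ((addClosure_proj_obj Y).mono ?_)
    rintro _ rfl
    exact ⟨U, rfl⟩
  -- The identity is a summand of `H ∘ Z`; if `Z M` were projective, so would be `M`.
  · intro Z hZ h0
    obtain ⟨-, -, H, hH⟩ := hZ
    have h2 : projObj (Z.obj.obj.obj M) :=
      projObj_of_isZero_proj_obj (X := ⟨Z.obj.obj.obj M, _⟩)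
        ((IsZero.iff_id_eq_zero (Φ.obj Z)).2 ((Φ.map_id Z).symm.trans h0))
    exact hM' (projObj_of_isSummand ((isSummand_fullSubcategory_iff.1 hH).map ((evaluation _ _).obj M))
      (H.property.projective h2))
  · intro J (X : (leftSpan (leftCell (𝟙_ (GoodFun k A B)))).FullSubcategory)
      (Y : (leftSpan (leftCell (𝟙_ (GoodFun k A B)))).FullSubcategory) (f : X ⟶ Y) hf
      (hf0 : Φ.map f ≠ 0)
    -- The surviving component is an endomorphism of the unit with non-zero image. Its image is a
    -- scalar, so it is not nilpotent; it is therefore invertible, and the ideal contains the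
    -- identity of the unit.
    obtain ⟨Y₁, Y₂, b, a, hY₁, hY₂, h⟩ := exists_component_ne_zero Φ (addClosure_leftSpan hspan X)
      (addClosure_leftSpan hspan Y) hf0
    obtain rfl := (hlow hY₁).resolve_right fun h0 => h (h0.eq_of_src _ _)
    obtain rfl := (hlow hY₂).resolve_right fun h0 => h (h0.eq_of_tgt _ _)
    have hJ : b ≫ f ≫ a ∈ J.hom U U := J.comp_left b (J.comp_right a hf)
    refine ⟨U, mem_leftCell h1, ?_⟩
    obtain ⟨v, hv⟩ := exists_comp_eq_id_of_map_ne_zero k (finiteDimensional_fullSubcategory k U U)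
      (isLocalRing_end_fullSubcategory_iff.2 h1.isLocalRing_end_goodFun) Φ hU h
    exact (congrArg (fun g => g ∈ J.hom U U) hv).mp (J.comp_right v hJ)

end UnitCell
end FinRep
end

noncomputable section
namespace FinRep
open Module

/-! ### Direct summands of tensoring with a projective bimodule -/

section BimodSummand

attribute [local instance] Bimod.finite_of_fg

variable {k : Type u} [Field k] {R : Type u} [Ring R] [Algebra k R]

namespace Bimod

/-- The homomorphism of `R ⊗ Rᵒᵖ`-modules given by a homomorphism of bimodules. -/
def modHom {Q Q' : Bimod k R} (φ : Q.carrier →ₗ[k] Q'.carrier)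
    (hl : ∀ r q, φ (Q.left r q) = Q'.left r (φ q)) (hr : ∀ s q, φ (Q.right s q) = Q'.right s (φ q)) :
    ActMod Q.act →ₗ[R ⊗[k] Rᵐᵒᵖ] ActMod Q'.act where
  toFun := φ
  map_add' := φ.map_add
  map_smul' t q := by
    change φ (Q.act t q) = Q'.act t (φ q)
    induction t using TensorProduct.induction_on with
    | zero =>
      rw [map_zero, map_zero]
      exact φ.map_zero
    | add t t' h h' =>
      rw [map_add, map_add]
      exact (φ.map_add _ _).trans (congrArg₂ _ h h')
    | tmul r s =>
      rw [act, act, Algebra.TensorProduct.lift_tmul, Algebra.TensorProduct.lift_tmul]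
      exact (hl r _).trans (congrArg _ (hr s q))

/-- The image of an endomorphism of a bimodule. -/
def range (Q : Bimod k R) (ε : Q.carrier →ₗ[k] Q.carrier)
    (hl : ∀ r q, ε (Q.left r q) = Q.left r (ε q)) (hr : ∀ s q, ε (Q.right s q) = Q.right s (ε q)) :
    Bimod k R :=
  have hl' (r : R) : ∀ q ∈ LinearMap.range ε, Q.left r q ∈ LinearMap.range ε := by
    rintro _ ⟨q, rfl⟩
    exact ⟨Q.left r q, hl r q⟩
  have hr' (s : Rᵐᵒᵖ) : ∀ q ∈ LinearMap.range ε, Q.right s q ∈ LinearMap.range ε := by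
    rintro _ ⟨q, rfl⟩
    exact ⟨Q.right s q, hr s q⟩
  { carrier := LinearMap.range ε
    left := AlgHom.ofLinearMap
      { toFun := fun r => (Q.left r).restrict (hl' r)
        map_add' := fun r s => by ext q; simp
        map_smul' := fun c r => by ext q; simp } (by ext q; simp) (fun r s => by ext q; simp)
    right := AlgHom.ofLinearMap
      { toFun := fun s => (Q.right s).restrict (hr' s)
        map_add' := fun r s => by ext q; simp
        map_smul' := fun c r => by ext q; simp } (by ext q; simp) (fun r s => by ext q; simp)
    commute := fun r s => LinearMap.ext fun q => Subtype.ext (Q.left_right r s q) }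

variable [FiniteDimensional k R]

variable (k R) in
-- The regular module with a generator `e` and the coordinate `π`, kept abstract: only these
-- properties are used to recover a bimodule from its tensor functor.
lemma exists_regular : ∃ (E : FGModuleCat.{u} R) (e : E) (π : E →ₗ[k] R),
    (∀ x, π x • e = x) ∧ π e = 1 ∧ (∀ r x, π (r • x) = r * π x) ∧
      ∀ (X : FGModuleCat.{u} R) (x : X), ∃ f : E ⟶ X, f.hom.hom e = x := by
  obtain ⟨E, ⟨φ⟩⟩ : ∃ E : FGModuleCat.{u} R, Nonempty (R ≃ₗ[R] E) :=
    ⟨regMod R, ⟨LinearEquiv.refl R R⟩⟩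
  refine ⟨E, φ 1, φ.symm.toLinearMap.restrictScalars k, fun x => ?_, φ.symm_apply_apply 1,
    fun r x => φ.symm.map_smul r x, fun X x =>
    ⟨FGModuleCat.ofHom (LinearMap.toSpanSingleton R X x ∘ₗ φ.symm.toLinearMap), ?_⟩⟩
  · change φ.symm x • φ 1 = x
    rw [← map_smul, smul_eq_mul, mul_one, φ.apply_symm_apply]
  · change φ.symm (φ 1) • x = x
    rw [φ.symm_apply_apply, one_smul]

section

variable {E : FGModuleCat.{u} R}

/-- The canonical map `Q ⊗ E → Q`, where `π` identifies `E` with the regular module. -/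
def tensReg (Q : Bimod k R) (π : E →ₗ[k] R) (hπ : ∀ r x, π (r • x) = r * π x) :
    Q.Tens E →ₗ[k] Q.carrier :=
  Q.tensLift (TensorProduct.lift ((Q.right.toLinearMap ∘ₗ
    (MulOpposite.opLinearEquiv k (M := R)).toLinearMap ∘ₗ π).flip)) (fun q r x => by
      simp [hπ])

lemma tensReg_tmul (Q : Bimod k R) (π : E →ₗ[k] R) (hπ : ∀ r x, π (r • x) = r * π x)
    (q : Q.carrier) (x : E) :
    Q.tensReg π hπ (Q.tmul q x) = Q.right (MulOpposite.op (π x)) q := rfl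

/-- Every element of `Q ⊗ E` has the form `q ⊗ e`, because scalars move across the tensor sign. -/
lemma tmul_tensReg (Q : Bimod k R) {e : E} {π : E →ₗ[k] R} (he : ∀ x, π x • e = x)
    (hπ : ∀ r x, π (r • x) = r * π x) (t : Q.Tens E) :
    Q.tmul (Q.tensReg π hπ t) e = t := by
  refine LinearMap.congr_fun (Q.tens_hom_ext (f := ((Q.tmulₗ E).flip e) ∘ₗ Q.tensReg π hπ)
    (g := LinearMap.id) fun q x => ?_) t
  refine (Q.tmul_balanced q (π x) e).trans ?_
  rw [he]
  rfl

end

/-- Every natural transformation between tensor functors is given by a homomorphism of bimodules. -/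
lemma exists_tensNat_eq {Q Q' : Bimod k R} (α : Q.tensFunctor ⟶ Q'.tensFunctor) :
    ∃ (ε : Q.carrier →ₗ[k] Q'.carrier) (hl : ∀ r q, ε (Q.left r q) = Q'.left r (ε q))
      (hr : ∀ s q, ε (Q.right s q) = Q'.right s (ε q)), tensNat ε hl hr = α := by
  obtain ⟨E, e, π, he, he1, hπ, hE⟩ := exists_regular k R
  let ε : Q.carrier →ₗ[k] Q'.carrier := Q'.tensReg π hπ ∘ₗ
    (actEquiv (Q'.tensAct E)).symm.toLinearMap ∘ₗ klin (α.app E) ∘ₗ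
    (actEquiv (Q.tensAct E)).toLinearMap ∘ₗ (Q.tmulₗ E).flip e
  have hone (q) : (α.app E).hom.hom (Q.tm q e) = Q'.tm (ε q) e :=
    (congrArg (actEquiv (Q'.tensAct E)) (Q'.tmul_tensReg he hπ ((actEquiv _).symm
      ((α.app E).hom.hom (Q.tm q e))))).symm
  -- Any `x` is the image of the generator `e`, so naturality reduces `q ⊗ x` to `q ⊗ e`, where `ε`
  -- was defined.
  have happ {X : FGModuleCat.{u} R} (q : Q.carrier) (x : X) :
      (α.app X).hom.hom (Q.tm q x) = Q'.tm (ε q) x := by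
    obtain ⟨f, rfl⟩ := hE X x
    have h1 := congrArg (fun g => g.hom.hom (Q.tm q e)) (α.naturality f)
    exact h1.trans (congrArg (Q'.tensFunctor.map f).hom.hom (hone q))
  have hinj {q q' : Q'.carrier} (h : Q'.tm q e = Q'.tm q' e) : q = q' := by
    have h1 := congrArg (Q'.tensReg π hπ) ((actEquiv (Q'.tensAct E)).injective h)
    rw [tensReg_tmul, tensReg_tmul, he1] at h1
    simpa using h1
  refine ⟨ε, fun r q => hinj ?_, fun s q => hinj ?_, ?_⟩
  · rw [← hone]
    exact (map_smul (α.app E).hom.hom r (Q.tm q e)).trans (congrArg (r • ·) (hone q))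
  · obtain ⟨s, rfl⟩ := MulOpposite.op_surjective s
    rw [← hone]
    have h1 : Q.tm (Q.right (MulOpposite.op s) q) e = Q.tm q (s • e) :=
      congrArg (actEquiv (Q.tensAct E)) (Q.tmul_balanced q s e)
    have h2 : Q'.tm (Q'.right (MulOpposite.op s) (ε q)) e = Q'.tm (ε q) (s • e) :=
      congrArg (actEquiv (Q'.tensAct E)) (Q'.tmul_balanced (ε q) s e)
    rw [h1, h2, happ]
  · ext X : 2
    exact actHom_ext (Q.tens_hom_ext fun q x => (happ q x).symm)

lemma tensNat_injective {Q Q' : Bimod k R} {ε ε' : Q.carrier →ₗ[k] Q'.carrier} {hl hr hl' hr'}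
    (h : tensNat ε hl hr = tensNat ε' hl' hr') : ε = ε' := by
  obtain ⟨E, e, π, he, he1, hπ, hE⟩ := exists_regular k R
  ext q
  have h1 : Q'.right (MulOpposite.op (π e)) (ε q) = Q'.right (MulOpposite.op (π e)) (ε' q) :=
    congrArg (fun α : Q.tensFunctor ⟶ Q'.tensFunctor => Q'.tensReg π hπ ((actEquiv _).symm
      ((α.app E).hom.hom (Q.tm q e)))) h
  simpa [he1] using h1

/-- A direct summand of the functor of tensoring with a projective bimodule is of the same form. -/
lemma exists_iso_of_isSummand {Q : Bimod k R} (hQ : Q.IsProjective)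
    {G : FGModuleCat.{u} R ⥤ FGModuleCat.{u} R} (h : IsSummand G Q.tensFunctor) :
    ∃ Q' : Bimod k R, Q'.IsProjective ∧ Nonempty (G ≅ Q'.tensFunctor) := by
  obtain ⟨ρ⟩ := h
  obtain ⟨ε, hl, hr, hε⟩ := exists_tensNat_eq (ρ.r ≫ ρ.i)
  -- The idempotent transformation comes from a bimodule endomorphism `ε`; since bimodule maps are
  -- determined by their transformations, `ε` is idempotent, and its image is the required bimodule.
  have hidem (q) : ε (ε q) = ε q := by
    have h1 : tensNat (ε ∘ₗ ε) (fun r q => by simp [hl]) (fun r q => by simp [hr]) =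
        tensNat ε hl hr := by
      refine Eq.trans (b := tensNat ε hl hr ≫ tensNat ε hl hr) ?_ (by rw [hε]; simp)
      ext X : 2
      exact actHom_ext (Q.tens_hom_ext fun q x => rfl)
    exact LinearMap.congr_fun (tensNat_injective h1) q
  let Q' := Q.range ε hl hr
  let i : Q'.carrier →ₗ[k] Q.carrier := (LinearMap.range ε).subtype
  let r : Q.carrier →ₗ[k] Q'.carrier := ε.rangeRestrict
  have hil (a : R) (q) : i (Q'.left a q) = Q.left a (i q) := rfl
  have hir (s : Rᵐᵒᵖ) (q) : i (Q'.right s q) = Q.right s (i q) := rfl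
  have hrl (a : R) (q) : r (Q.left a q) = Q'.left a (r q) := Subtype.ext (hl a q)
  have hrr (s : Rᵐᵒᵖ) (q) : r (Q.right s q) = Q'.right s (r q) := Subtype.ext (hr s q)
  have hri (q) : r (i q) = q := by
    obtain ⟨_, ⟨q, rfl⟩⟩ := q
    exact Subtype.ext (hidem q)
  refine ⟨Q', ?_, ⟨⟨ρ.i ≫ tensNat r hrl hrr, tensNat i hil hir ≫ ρ.r, ?_, ?_⟩⟩⟩
  · have : Module.Projective (R ⊗[k] Rᵐᵒᵖ) (ActMod Q.act) := hQ
    exact Module.Projective.of_split (modHom i hil hir) (modHom r hrl hrr) (LinearMap.ext hri)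
  · have h1 : tensNat r hrl hrr ≫ tensNat i hil hir = ρ.r ≫ ρ.i := by
      rw [← hε]
      ext X : 2
      exact actHom_ext (Q.tens_hom_ext fun q x => rfl)
    rw [Category.assoc, reassoc_of% h1]
    simp
  · rw [Category.assoc, ← Category.assoc ρ.r, ← hε]
    ext X : 2
    refine actHom_ext (Q'.tens_hom_ext fun q x => ?_)
    refine congrArg (fun q => Q'.tm q x) (?_ : r (ε (i q)) = q)
    obtain ⟨_, ⟨p, rfl⟩⟩ := q
    exact Subtype.ext ((hidem _).trans (hidem p))

end Bimod

end BimodSummand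
end FinRep
end

noncomputable section
namespace FinRep
open Module

/-! ### The diagram and its decoration -/

section Diagram

attribute [local instance] Bimod.finite_of_fg finiteDimensional_hom

variable {k : Type u} [Field k] {A B : Type u} [Ring A] [Ring B] [Algebra k A] [Algebra k B]
  [FiniteDimensional k A] [FiniteDimensional k B] {M : FGModuleCat.{u} (A ⊗[k] B)}

/-- The `2`-representation on the additive closure of `M` and the projective modules. -/
abbrev addProjRep (hl : IsLeftProjective M) (hr : IsRightProjective M) : TwoRep k (GoodFun k A B) :=
  (defining k A B).sub (addProj M) (addProj_invariant hl hr)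

lemma isLocalRing_end_addProj {X : (addProj M).FullSubcategory} (hX : IsIndecomposable X) :
    IsLocalRing (End X.obj) := by
  have := isIdempotentComplete_addProj M
  have : FiniteDimensional k (X ⟶ X) := finiteDimensional_fullSubcategory k X X
  exact isLocalRing_end_fullSubcategory_iff.1 (hX.isLocalRing_end k)

lemma isIndecomposable_addProj {X : (addProj M).FullSubcategory} (hX : IsLocalRing (End X.obj)) :
    IsIndecomposable X :=
  haveI := isLocalRing_end_fullSubcategory_iff.2 hX
  isIndecomposable_of_isLocalRing

lemma projObj_or_iso (hM : IsIndecomposable M) {X : (addProj M).FullSubcategory}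
    (hX : IsIndecomposable X) : projObj X.obj ∨ Nonempty (X.obj ≅ M) := by
  have := isLocalRing_end_addProj hX
  have := isLocalRing_end_fgModuleCat hM
  obtain ⟨Y, hY | rfl, h⟩ := AddClosure.exists_isSummand X.property
  · exact Or.inl (projObj_of_isSummand h hY)
  · exact Or.inr (h.nonempty_iso_of_isLocalRing not_isZero_of_nontrivial_end)

lemma projObj_of_iso {X Y : FGModuleCat.{u} (A ⊗[k] B)} (e : X ≅ Y) (h : projObj Y) : projObj X :=
  projObj_of_isSummand (.of_iso e) h

/-- The free functor alone takes any indecomposable object to one containing all indecomposable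
projectives. -/
lemma reaches_projective (hl : IsLeftProjective M) (hr : IsRightProjective M)
    {X Y : (addProj M).FullSubcategory} (hX : IsIndecomposable X) (hY : IsIndecomposable Y)
    (hY' : projObj Y.obj) : (addProjRep hl hr).Reaches X Y := by
  have := isLocalRing_end_addProj hX
  have := isLocalRing_end_addProj hY
  exact ⟨freeGood k A B, isSummand_fullSubcategory_iff.2
    (isSummand_freeGood_obj not_isZero_of_nontrivial_end hY')⟩

lemma projObj_of_reaches (hl : IsLeftProjective M) (hr : IsRightProjective M)
    {X Y : (addProj M).FullSubcategory} (hX : projObj X.obj)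
    (h : (addProjRep hl hr).Reaches X Y) : projObj Y.obj := by
  obtain ⟨F, h⟩ := h
  exact projObj_of_isSummand (isSummand_fullSubcategory_iff.1 h) (F.property.projective hX)

lemma reaches_of_iso (hl : IsLeftProjective M) (hr : IsRightProjective M)
    {X Y : (addProj M).FullSubcategory} (e : Y.obj ≅ X.obj) : (addProjRep hl hr).Reaches X Y :=
  ⟨𝟙_ _, isSummand_fullSubcategory_iff.2 (.of_iso e)⟩

/-- The vertices of the diagram of the additive closure of `M` and the projective modules. -/
theorem exists_vertices [Nontrivial (A ⊗[k] B)] (hM : IsIndecomposable M) (hM' : ¬ projObj M)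
    (hl : IsLeftProjective M) (hr : IsRightProjective M) :
    ∃ ρ τ : (addProjRep hl hr).Diagram, (∀ x, x = ρ ∨ x = τ) ∧ τ ⋖ ρ ∧
      (∀ X : (addProjRep hl hr).Ind, (addProjRep hl hr).vertex X = τ ↔ projObj X.1.obj) ∧
      (∀ X : (addProjRep hl hr).Ind, (addProjRep hl hr).vertex X = ρ ↔ Nonempty (X.1.obj ≅ M)) := by
  obtain ⟨P, hP, hPloc⟩ := exists_projective_isLocalRing_end (k := k) (A := A) (B := B)
  have hMloc := isLocalRing_end_fgModuleCat hM
  let S : (addProjRep hl hr).Ind := ⟨selfObj M, isIndecomposable_addProj (X := selfObj M) hMloc⟩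
  let T : (addProjRep hl hr).Ind := ⟨(⟨P, .of_mem (Or.inl hP)⟩ : (addProj M).FullSubcategory),
    isIndecomposable_addProj (X := ⟨P, .of_mem (Or.inl hP)⟩) hPloc⟩
  have hT (X : (addProjRep hl hr).Ind) : (addProjRep hl hr).vertex X = (addProjRep hl hr).vertex T ↔
      projObj X.1.obj := by
    refine Quotient.eq.trans ⟨fun h => projObj_of_reaches hl hr hP h.1, fun h => ?_⟩
    exact ⟨reaches_projective hl hr T.2 X.2 h, reaches_projective hl hr X.2 T.2 hP⟩
  have hS (X : (addProjRep hl hr).Ind) : (addProjRep hl hr).vertex X = (addProjRep hl hr).vertex S ↔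
      Nonempty (X.1.obj ≅ M) := by
    refine Quotient.eq.trans ⟨fun h => ?_, fun ⟨e⟩ => ?_⟩
    · exact (projObj_or_iso hM X.2).resolve_left fun h' => hM' (projObj_of_reaches hl hr h' h.2)
    · exact ⟨reaches_of_iso hl hr e, reaches_of_iso hl hr e.symm⟩
  have hall (x : (addProjRep hl hr).Diagram) :
      x = (addProjRep hl hr).vertex S ∨ x = (addProjRep hl hr).vertex T := by
    obtain ⟨X, rfl⟩ : ∃ X, (addProjRep hl hr).vertex X = x := Quotient.exists_rep x
    rw [hS, hT]
    exact (projObj_or_iso hM X.2).symm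
  refine ⟨(addProjRep hl hr).vertex S, (addProjRep hl hr).vertex T, hall, ⟨?_, fun x h h' => ?_⟩,
    hT, hS⟩
  · refine lt_of_le_of_ne ?_ fun h => hM' ((hT S).1 h.symm)
    exact (reaches_projective hl hr S.2 T.2 hP : T ≤ S)
  · rcases hall x with rfl | rfl
    · exact lt_irrefl _ h'
    · exact lt_irrefl _ h

/-- The indecomposable `1`-morphisms in the decoration. -/
lemma mem_decoration_iff (h1 : IsIndecomposable (𝟙_ (GoodFun k A B))) (hM : IsIndecomposable M)
    (hM' : ¬ projObj M) (hl : IsLeftProjective M) (hr : IsRightProjective M)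
    {ρ τ : (addProjRep hl hr).Diagram}
    (hτ : ∀ X : (addProjRep hl hr).Ind, (addProjRep hl hr).vertex X = τ ↔ projObj X.1.obj)
    (hρ : ∀ X : (addProjRep hl hr).Ind, (addProjRep hl hr).vertex X = ρ ↔ Nonempty (X.1.obj ≅ M))
    {F : GoodFun k A B} : F ∈ (addProjRep hl hr).decoration τ ρ ↔
      IsIndecomposable F ∧ projObj (F.obj.obj M) ∧ ¬ IsZero (F.obj.obj M) := by
  have hMloc := isLocalRing_end_fgModuleCat hM
  constructor
  · rintro ⟨hF, X, Y, hX, hY, hYX⟩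
    obtain ⟨e⟩ := (hρ X).1 hX
    obtain ⟨Z, hZ, hZ', h⟩ : ∃ Z : FGModuleCat.{u} (A ⊗[k] B), IsLocalRing (End Z) ∧ projObj Z ∧
        IsSummand Z (F.obj.obj M) :=
      ⟨Y.1.obj, isLocalRing_end_addProj Y.2, (hτ Y).1 hY,
        (isSummand_fullSubcategory_iff.1 hYX : IsSummand _ (F.obj.obj X.1.obj)).trans
          (.of_iso (F.obj.mapIso e))⟩
    have h0 : ¬ IsZero (F.obj.obj M) := fun h0 => by
      obtain ⟨r⟩ := h
      refine not_isZero_of_nontrivial_end (X := Z) ((IsZero.iff_id_eq_zero _).2 ?_)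
      rw [← r.retract, h0.eq_of_tgt r.i 0, zero_comp]
    refine ⟨hF, ?_, h0⟩
    -- The identity is excluded: a projective summand of the indecomposable `M` would be `M` itself.
    -- All other indecomposable functors make `M` projective.
    rcases iso_unit_or_isLowerFun h1 hF with ⟨⟨f⟩⟩ | hF'
    · have h' : IsSummand Z M := h.trans (.of_iso (((IsGood k A B).ι.mapIso f).app M))
      obtain ⟨e'⟩ := h'.nonempty_iso_of_isLocalRing not_isZero_of_nontrivial_end
      exact absurd (projObj_of_iso e'.symm hZ') hM'
    · exact hF'.projective hl hr
  · rintro ⟨hF, hp, h0⟩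
    obtain ⟨Y, hY, hYF⟩ := (hasLocalDecomposition_fgModuleCat k (F.obj.obj M)).exists_isSummand h0
    have hY' : projObj Y := projObj_of_isSummand hYF hp
    let X : (addProjRep hl hr).Ind := ⟨selfObj M, isIndecomposable_addProj (X := selfObj M) hMloc⟩
    let Z : (addProjRep hl hr).Ind := ⟨(⟨Y, .of_mem (Or.inl hY')⟩ : (addProj M).FullSubcategory),
      isIndecomposable_addProj (X := ⟨Y, .of_mem (Or.inl hY')⟩) hY⟩
    exact ⟨hF, X, Z, (hρ X).2 ⟨Iso.refl _⟩, (hτ Z).2 hY', isSummand_fullSubcategory_iff.2 hYF⟩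

lemma projObj_obj_of_leftLE {F G : GoodFun k A B} (h : LeftLE F G) (hF : projObj (F.obj.obj M)) :
    projObj (G.obj.obj M) := by
  obtain ⟨H, h⟩ := h
  exact projObj_of_isSummand ((isSummand_fullSubcategory_iff.1 h).map ((evaluation _ _).obj M))
    (H.property.projective hF)

lemma isZero_obj_of_leftLE {F G : GoodFun k A B} (h : LeftLE F G) (hF : IsZero (F.obj.obj M)) :
    IsZero (G.obj.obj M) := by
  obtain ⟨H, h⟩ := h
  have : H.obj.Additive := ⟨H.property.map_add _ _⟩
  obtain ⟨r⟩ : IsSummand (G.obj.obj M) (H.obj.obj (F.obj.obj M)) :=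
    (isSummand_fullSubcategory_iff.1 h).map ((evaluation _ _).obj M)
  rw [IsZero.iff_id_eq_zero, ← r.retract, (H.obj.map_isZero hF).eq_of_tgt r.i 0, zero_comp]

/-- Take the identity as the right-hand factor. -/
lemma leftCell_subset_twoSidedCell {D : Type*} [Category* D] [Preadditive D] [MonoidalCategory D]
    (F : D) : leftCell F ⊆ twoSidedCell F := by
  have key {F G : D} (h : LeftLE F G) : TwoSidedLE F G := by
    obtain ⟨H, h⟩ := h
    exact ⟨H, 𝟙_ D, h.trans (.of_iso (whiskerLeftIso H (ρ_ F).symm))⟩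
  exact fun G h => ⟨h.1, key h.2.1, key h.2.2⟩

/-- A functor which does not annihilate `M` has an indecomposable summand with this property. -/
lemma exists_isSummand_obj_ne_zero {F : GoodFun k A B} (hF : ¬ IsZero (F.obj.obj M)) :
    ∃ G : GoodFun k A B, IsIndecomposable G ∧ IsSummand G F ∧ ¬ IsZero (G.obj.obj M) := by
  by_contra! h
  refine hF ?_
  obtain ⟨n, Y, a, b, hY, e⟩ := (hasLocalDecomposition_goodFun F).addClosure
  rw [IsZero.iff_id_eq_zero]
  have : (IsGood k A B).ι.Additive := ⟨rfl⟩
  have e' : ∑ i, (a i).hom.app M ≫ (b i).hom.app M = 𝟙 (F.obj.obj M) := by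
    have h2 := congrArg (((IsGood k A B).ι ⋙ (evaluation _ (FGModuleCat.{u} (A ⊗[k] B))).obj M).map) e
    rw [Functor.map_sum, CategoryTheory.Functor.map_id] at h2
    exact h2
  rw [← e']
  refine Finset.sum_eq_zero fun i _ => ?_
  have := (hY i).1
  rw [(h (Y i) isIndecomposable_of_isLocalRing (hY i).2).eq_of_tgt ((a i).hom.app M) 0, zero_comp]

/-- A linear form that is non-zero on `v` shows `v ⊗ x ≠ 0` for `v` and `x` non-zero. -/
lemma not_isZero_extFunctor_obj {V : Type u} [AddCommGroup V] [Module k V] [FiniteDimensional k V]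
    [Nontrivial V] {R : Type u} [Ring R] [Algebra k R] [FiniteDimensional k R]
    (δ : R →ₐ[k] Module.End k V ⊗[k] R) {X : FGModuleCat.{u} R} (hX : ¬ IsZero X) :
    ¬ IsZero ((extFunctor δ).obj X) := by
  intro h
  rw [isZero_iff_forall] at hX h
  push Not at hX
  obtain ⟨x, hx⟩ := hX
  obtain ⟨v, hv⟩ := exists_ne (0 : V)
  have h2 : v ⊗ₜ[k] x = 0 := (actEquiv (extAct δ X)).map_eq_zero_iff.1 (h _)
  obtain ⟨l, hl⟩ := not_forall.1 (mt (Module.forall_dual_apply_eq_zero_iff k v).1 hv)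
  have h3 : l v • x = 0 :=
    (congrArg ((TensorProduct.lid k X).toLinearMap ∘ₗ l.rTensor X) h2).trans (map_zero _)
  exact hx ((smul_eq_zero_iff_right hl).1 h3)

end Diagram
end FinRep
end

noncomputable section
namespace FinRep
open Module

/-! ### The decoration of the edge, transitivity and the short exact sequence -/

section Decoration

attribute [local instance] Bimod.finite_of_fg finiteDimensional_hom

variable {k : Type u} [Field k] {A B : Type u} [Ring A] [Ring B] [Algebra k A] [Algebra k B]
  [FiniteDimensional k A] [FiniteDimensional k B] {M : FGModuleCat.{u} (A ⊗[k] B)}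

lemma nontrivial_of_not_isZero (hM : ¬ IsZero M) : Nontrivial (A ⊗[k] B) :=
  ⟨1, 0, fun h => hM (isZero_iff_forall.2 fun x => by
    rw [← one_smul (A ⊗[k] B) x, h, zero_smul])⟩

lemma exists_isSummand_projective_obj {T : GoodFun k A B} (hT : projObj (T.obj.obj M))
    (hT' : ¬ IsZero (T.obj.obj M)) : ∃ G : GoodFun k A B, IsIndecomposable G ∧
      IsSummand G.obj T.obj ∧ projObj (G.obj.obj M) ∧ ¬ IsZero (G.obj.obj M) := by
  obtain ⟨G, hG, hGT, h⟩ := exists_isSummand_obj_ne_zero hT'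
  have h1 : IsSummand G.obj T.obj := isSummand_fullSubcategory_iff.1 hGT
  exact ⟨G, hG, h1, projObj_of_isSummand (h1.map ((evaluation _ _).obj M)) hT, h⟩

/-- The indecomposable `1`-morphisms which map `M` to a non-zero projective module form a union of
left cells, which contains left cells of projective and of one-sided projective functors. -/
theorem exists_leftCells [Nontrivial A] [Nontrivial B] (hM : ¬ IsZero M)
    (hl : IsLeftProjective M) (hr : IsRightProjective M) {X : Set (GoodFun k A B)}
    (hX : ∀ F, F ∈ X ↔ IsIndecomposable F ∧ projObj (F.obj.obj M) ∧ ¬ IsZero (F.obj.obj M)) :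
    ∃ S : Set (Set (GoodFun k A B)), (∀ L ∈ S, IsLeftCell L) ∧ X = ⋃₀ S ∧
      (∃ L ∈ S, L ⊆ leftProjectiveCell k A B) ∧ (∃ L ∈ S, L ⊆ rightProjectiveCell k A B) ∧
      (∃ L ∈ S, L ⊆ projectiveCell k A B) := by
  -- Both directions of left equivalence are used: `F ≤ G` carries projectivity of the value at `M`
  -- from `F` to `G`, and `G ≤ F` carries non-vanishing.
  have hcell {F : GoodFun k A B} (hF : F ∈ X) : leftCell F ⊆ X := fun G hG =>
    (hX G).2 ⟨hG.1, projObj_obj_of_leftLE hG.2.1 ((hX F).1 hF).2.1,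
      fun h => ((hX F).1 hF).2.2 (isZero_obj_of_leftLE hG.2.2 h)⟩
  have hmem {F : GoodFun k A B} (hF : F ∈ X) : leftCell F ∈ {L | IsLeftCell L ∧ L ⊆ X} :=
    ⟨⟨F, ((hX F).1 hF).1, rfl⟩, hcell hF⟩
  refine ⟨{L | IsLeftCell L ∧ L ⊆ X}, fun L hL => hL.1, ?_, ?_, ?_, ?_⟩
  · refine subset_antisymm (fun F hF => ⟨leftCell F, hmem hF, mem_leftCell ((hX F).1 hF).1⟩) ?_
    rintro F ⟨L, hL, hF⟩
    exact hL.2 hF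
  -- As `T M` is a non-zero projective, some indecomposable summand of `T` does not kill `M`, and
  -- its left cell is a witness. The other two kinds of cells are treated alike.
  · let T : GoodFun k A B := ⟨leftFun k A B, .of_mem (Or.inr (Or.inr (Or.inl rfl)))⟩
    obtain ⟨G, hG, hGT, h⟩ := exists_isSummand_projective_obj (T := T)
      (projObj_of_iso ((leftIso k A B).symm.app M) (projective_extFunctor_deltaL hr))
      (fun h => not_isZero_extFunctor_obj (deltaL k A B) hM (h.of_iso ((leftIso k A B).app M)))
    exact ⟨leftCell G, hmem ((hX G).2 ⟨hG, h⟩), fun F hF =>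
      ⟨G, hG, .of_isSummand hGT (.of_mem rfl), leftCell_subset_twoSidedCell G hF⟩⟩
  · let T : GoodFun k A B := ⟨rightFun k A B, .of_mem (Or.inr (Or.inr (Or.inr rfl)))⟩
    obtain ⟨G, hG, hGT, h⟩ := exists_isSummand_projective_obj (T := T)
      (projObj_of_iso ((rightIso k A B).symm.app M) (projective_extFunctor_deltaR hl))
      (fun h => not_isZero_extFunctor_obj (deltaR k A B) hM (h.of_iso ((rightIso k A B).app M)))
    exact ⟨leftCell G, hmem ((hX G).2 ⟨hG, h⟩), fun F hF =>
      ⟨G, hG, .of_isSummand hGT (.of_mem rfl), leftCell_subset_twoSidedCell G hF⟩⟩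
  · let T : GoodFun k A B := ⟨(Bimod.outer k (A ⊗[k] B)).tensFunctor,
      .of_mem (Or.inr (Or.inl ⟨_, outer_projective, ⟨Iso.refl _⟩⟩))⟩
    obtain ⟨G, hG, hGT, h⟩ := exists_isSummand_projective_obj (T := T)
      (projObj_of_iso ((freeIso k A B).symm.app M) (projective_extFunctor_deltaF M))
      (fun h => not_isZero_extFunctor_obj (deltaF k A B) hM (h.of_iso ((freeIso k A B).app M)))
    exact ⟨leftCell G, hmem ((hX G).2 ⟨hG, h⟩), fun F hF =>
      -- The summand must again be tensoring with a projective bimodule, which requires lifting the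
      -- splitting from functors to bimodules.
      ⟨G, hG, Bimod.exists_iso_of_isSummand outer_projective hGT,
        leftCell_subset_twoSidedCell G hF⟩⟩

variable (k A B) in
lemma isTransitive_projObj [Nontrivial (A ⊗[k] B)] :
    ((defining k A B).sub projObj (projObj_invariant k A B)).IsTransitive := by
  have := isIdempotentComplete_fgModuleCat k (A ⊗[k] B)
  have : IsIdempotentComplete (projObj (k := k) (A := A) (B := B)).FullSubcategory :=
    isIdempotentComplete_fullSubcategory fun _ => projObj_of_addClosure
  have hloc {X : (projObj (k := k) (A := A) (B := B)).FullSubcategory} (hX : IsIndecomposable X) :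
      IsLocalRing (End X.obj) := by
    have : FiniteDimensional k (X ⟶ X) := finiteDimensional_fullSubcategory k X X
    exact isLocalRing_end_fullSubcategory_iff.1 (hX.isLocalRing_end k)
  refine ⟨?_, fun X Y => ?_⟩
  · obtain ⟨P, hP, hPloc⟩ := exists_projective_isLocalRing_end (k := k) (A := A) (B := B)
    let P' : (projObj (k := k) (A := A) (B := B)).FullSubcategory := ⟨P, hP⟩
    have : IsLocalRing (End P') := isLocalRing_end_fullSubcategory_iff.2 hPloc
    have h : IsIndecomposable P' := isIndecomposable_of_isLocalRing
    exact ⟨⟨P', h⟩⟩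
  · obtain ⟨X, hX⟩ := X
    obtain ⟨Y, hY⟩ := Y
    have := hloc hX
    have := hloc hY
    exact ⟨freeGood k A B, isSummand_fullSubcategory_iff.2
      (isSummand_freeGood_obj not_isZero_of_nontrivial_end Y.property)⟩

/-- The projective modules, the additive closure of `M` and the projective modules, and the
quotient form a short exact sequence. -/
theorem isShortExact [Nontrivial (A ⊗[k] B)] (hM : IsIndecomposable M) (hM' : ¬ projObj M)
    (hl : IsLeftProjective M) (hr : IsRightProjective M) :
    TwoRep.IsShortExact
      ((defining k A B).subInclusion (projObj_invariant k A B) (addProj_invariant hl hr)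
        (projObj_le_addProj M))
      ((addProjRep hl hr).quotProj
        ((defining k A B).relIdeal (projObj_invariant k A B) (addProj_invariant hl hr))) where
  card_diagram := by
    obtain ⟨ρ, τ, hall, hτρ, -⟩ := exists_vertices hM hM' hl hr
    refine Nat.card_eq_two_iff.2 ⟨ρ, τ, hτρ.1.ne', ?_⟩
    ext x
    simpa using hall x
  transitive := isTransitive_projObj k A B
  full := inferInstanceAs (ObjectProperty.ιOfLE (projObj_le_addProj M)).Full
  faithful := inferInstanceAs (ObjectProperty.ιOfLE (projObj_le_addProj M)).Faithful
  proj_essSurj := inferInstanceAs (projIdeal M).proj.EssSurj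
  proj_full := inferInstanceAs (projIdeal M).proj.Full
  proj_eq_zero {X Y} f := by
    -- The objects isomorphic to one in the image of the inclusion are exactly the projective ones,
    -- so the two generated ideals coincide.
    have h : (fun Z : (addProj M).FullSubcategory => projObj Z.obj) = fun Z =>
        ∃ W, Nonempty ((ObjectProperty.ιOfLE (projObj_le_addProj M)).obj W ≅ Z) := by
      ext Z
      refine ⟨fun hZ => ⟨⟨Z.obj, hZ⟩, ⟨Iso.refl _⟩⟩, ?_⟩
      rintro ⟨W, ⟨e⟩⟩
      exact projObj_of_iso ((addProj M).ι.mapIso e.symm) W.property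
    refine (HomIdeal.proj_map_eq_zero_iff (projIdeal M) f).trans ?_
    exact (congrArg (fun P : ObjectProperty (addProj M).FullSubcategory =>
      f ∈ (HomIdeal.generatedBy (k := k) P).hom X Y) h).to_iff

end Decoration
end FinRep
end

/-! ### The main theorem -/

theorem proposition71 (k A : Type u) [Field k] [IsAlgClosed k] [Ring A] [Algebra k A]
    [FiniteDimensional k A] (hbasic : IsBasicAlgebra A) (hconn : IsConnectedAlgebra A)
    (hsimple : ¬ IsSimpleRing A)
    (L : Set (GoodFun k A Aᵐᵒᵖ)) (hL : IsLeftCell L) (hLJ : L ⊆ projectiveCell k A Aᵐᵒᵖ)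
    (M : FGModuleCat.{u} (A ⊗[k] Aᵐᵒᵖ)) (hM : IsIndecomposable M)
    (hstable : Nonempty (StableEnd M ≃ₐ[k] k))
    (hleft : IsLeftProjective M) (hright : IsRightProjective M) :
    ∃ (hP : (defining k A Aᵐᵒᵖ).IsInvariant projObj)
      (hQ : (defining k A Aᵐᵒᵖ).IsInvariant (addProj M)),
      let K := (defining k A Aᵐᵒᵖ).sub projObj hP
      let MM := (defining k A Aᵐᵒᵖ).sub (addProj M) hQ
      let NM := MM.quot ((defining k A Aᵐᵒᵖ).relIdeal hP hQ)
      (K.IsFinitary ∧ MM.IsFinitary ∧ NM.IsFinitary) ∧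
      K.Equivalent (cellRep k L) ∧
      TwoRep.IsShortExact (K := K) (M := MM) (N := NM)
        ((defining k A Aᵐᵒᵖ).subInclusion hP hQ (projObj_le_addProj M))
        (MM.quotProj ((defining k A Aᵐᵒᵖ).relIdeal hP hQ)) ∧
      NM.Equivalent (cellRep k (leftCell (𝟙_ (GoodFun k A Aᵐᵒᵖ)))) ∧
      ∃ ρ τ : MM.Diagram,
        (∀ x : MM.Diagram, x = ρ ∨ x = τ) ∧ τ ⋖ ρ ∧
        (∀ X : MM.Ind, MM.vertex X = τ ↔ projObj X.1.obj) ∧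
        (∀ X : MM.Ind, MM.vertex X = ρ ↔ Nonempty (X.1.obj ≅ M)) ∧
        ∃ S : Set (Set (GoodFun k A Aᵐᵒᵖ)),
          (∀ L' ∈ S, IsLeftCell L') ∧ MM.decoration τ ρ = ⋃₀ S ∧
          (∃ L' ∈ S, L' ⊆ leftProjectiveCell k A Aᵐᵒᵖ) ∧
          (∃ L' ∈ S, L' ⊆ rightProjectiveCell k A Aᵐᵒᵖ) ∧
          (∃ L' ∈ S, L' ⊆ projectiveCell k A Aᵐᵒᵖ) := by
  have : Nontrivial (StableEnd M) := hstable.some.toEquiv.nontrivial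
  have hM' : ¬ projObj M := not_projObj_of_stableEnd
  have := hconn.1
  have := nontrivial_of_not_isZero hM.1
  have h1 : IsIndecomposable (𝟙_ (GoodFun k A Aᵐᵒᵖ)) := isIndecomposable_unit hconn
  refine ⟨projObj_invariant k A Aᵐᵒᵖ, addProj_invariant hleft hright,
    ⟨isFinitaryCategory_projObj k A Aᵐᵒᵖ, isFinitaryCategory_addProj hM,
      isFinitaryCategory_quot hM hM'⟩,
    projObj_equivalent_cellRep hL hLJ, isShortExact hM hM' hleft hright,
    quot_equivalent_cellRep_unit h1 hstable hleft hright, ?_⟩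
  obtain ⟨ρ, τ, hall, hτρ, hτ, hρ⟩ := exists_vertices hM hM' hleft hright
  exact ⟨ρ, τ, hall, hτρ, hτ, hρ, exists_leftCells hM.1 hleft hright fun F =>
    mem_decoration_iff h1 hM hM' hleft hright hτ hρ⟩
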